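/- For $\tau=x+iy$ in the upper half-plane $\mathbb H$ and $z\in\mathbb C$ write $q^r=e^{2\pi i r\tau}$, $\zeta^r=e^{2\pi i r z}$. For $a,b\in\mathbb R$ let $$\vartheta_{a,b}(z;\tau)=\sum_{n\in\mathbb Z}e^{2\pi i(n+a)b}q^{\frac12(n+a)^2}\zeta^{n+a},\qquad \theta_1=-\vartheta_{\frac12,\frac12},\quad \theta_2=\vartheta_{\frac12,0},\quad \theta_3=\vartheta_{0,0},$$ and, for $z\notin\mathbb Z\tau+\mathbb Z$, let $\mu$ be $i$ times Zwegers' function $\mu(z,z;\tau)$: $$\mu(z;\tau)=\frac{i\,\zeta^{1/2}}{\vartheta_{\frac12,\frac12}(z;\tau)}\sum_{n\in\mathbb Z}\frac{(-1)^nq^{\frac12n(n+1)}\zeta^n}{1-\zeta q^n}.$$ For $\ell\in\mathbb Z$ let $S_\ell(\tau)$ be the coefficient of $q^{\ell^2/4}\zeta^\ell$ in $\theta_1(z;\tau)^2\mu(z;\tau)$, i.e. $S_\ell(\tau)=q^{-\ell^2/4}\int_0^1\theta_1(z;\tau)^2\mu(z;\tau)\,\zeta^{-\ell}\,dt$ with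 $z=t+\tfrac{iy}{2}$. Let $A=\begin{pmatrix}1&2\\2&2\end{pmatrix}$, $Q(\nu)=\frac12\nu^TA\nu$, $B(\nu,\nu')=\nu^TA\nu'$, $a(\ell)=(\frac12,-\frac{\ell}2)^T$, $b=(\frac12,0)^T$, $c_1=(-1,1)^T$, $c_2=(-2,1)^T$, $\beta(u)=\int_u^\infty s^{-1/2}e^{-\pi s}\,ds$, and let $\vartheta^\ell$ be Zwegers' indefinite theta function $$\vartheta^\ell(\tau)=\sum_{\nu\in a(\ell)+\mathbb Z^2}\Bigl(\rho_{c_1}(\nu)-\rho_{c_2}(\nu)\Bigr)e^{2\pi iB(\nu,b)}q^{Q(\nu)},\qquad \rho_{c}(\nu)=\operatorname{sgn}B(\nu,c)\Bigl(1-\beta\bigl(-\tfrac{B(\nu,c)^2}{Q(c)}y\bigr)\Bigr).$$ For an integer $k$ and a subgroup $\Gamma\le\mathrm{SL}_2(\mathbb Z)$, call $h$ the holomorphic part of a function $H$ on $\mathbb H$ (in weight $k$, for $\Gamma$) if $h$ is holomorphic on $\mathbb H$, bounded at $i\infty$, and $H-h$ is a finite sum of products $f\cdot g^*$, where, for some $w\in\frac12\mathbb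 Z$, $f$ is a holomorphic modular form of weight $w$ and $g$ a cusp form of weight $2-(k-w)$, both on $\Gamma$ with unitary multiplier systems, and $g^*(\tau)=\int_y^\infty (t+y)^{-(k-w)}\,\overline{g(x+it)}\,dt$ is the non-holomorphic Eichler integral of $g$. Such an $h$ is called a (mixed) mock modular form of weight $k$ on $\Gamma$ with unitary multiplier $\chi$ and completion $H$ if moreover $H(\gamma\tau)=\chi(\gamma)(c\tau+d)^kH(\tau)$ for $\gamma=\begin{pmatrix}*&*\\c&d\end{pmatrix}\in\Gamma$ and $(c\tau+d)^{-k}H(\gamma\tau)$ is bounded at $i\infty$ for every $\gamma\in\mathrm{SL}_2(\mathbb Z)$. A tuple $(h_i)$ is a vector-valued (mixed) mock modular form of weight $k$ on $\mathrm{SL}_2(\mathbb Z)$ with representation $\rho$ and completion $H=(H_i)^T$ if the $H_i$ are bounded at $i\infty$, $H(\gamma\tau)=(c\tau+d)^k\rho(\gamma)H(\tau)$ for all $\gamma\in\mathrm{SL}_2(\mathbb Z)$, and for some finite-index subgroup $\Gamma$ each $h_i$ is the holomorphic part of $H_i$ in weight $k$ for $\Gamma$. **Proposition.** 1. For $\tau\in\mathbb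 H$ and $z\notin\mathbb Z\tau+\mathbb Z$, $\ \theta_1(z;\tau)^2\mu(z;\tau)=S_0(\tau)\theta_3(2z;2\tau)+S_1(\tau)\theta_2(2z;2\tau)$. 2. $A$ is symmetric with $\det A<0$, and $Q(c_1),Q(c_2),B(c_1,c_2)<0$. For all $\ell\in\mathbb Z$ and $\tau\in\mathbb H$ the series $\vartheta^\ell(\tau)$ and the following series converge absolutely, and $$2i\,S_\ell(\tau)=\sum_{\nu\in a(\ell)+\mathbb Z^2}\bigl(\operatorname{sgn}B(\nu,c_1)-\operatorname{sgn}B(\nu,c_2)\bigr)e^{2\pi iB(\nu,b)}q^{Q(\nu)},$$ $$\vartheta^\ell(\tau)=2i\,S_\ell(\tau)+\sum_{j=1}^2(-1)^j\sum_{\nu\in a(\ell)+\mathbb Z^2}\operatorname{sgn}B(\nu,c_j)\,\beta\bigl(-\tfrac{B(\nu,c_j)^2}{Q(c_j)}y\bigr)e^{2\pi iB(\nu,b)}q^{Q(\nu)}.$$ 3. For $\ell=0,1$, $S_\ell$ is a (mixed) mock modular form of weight $1$ on $\Gamma_0(4)$ with completion $\frac1{2i}\vartheta^\ell$ and some unitary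 character $\chi_\ell$ of $\Gamma_0(4)$ as multiplier; in particular it is the holomorphic part of $\frac{1}{2i}\vartheta^\ell$. 4. $(S_0,S_1)$ is a vector-valued (mixed) mock modular form of weight $1$ on $\mathrm{SL}_2(\mathbb Z)$ with completion $\frac1{2i}(\vartheta^0,\vartheta^1)^T$ and a representation $\rho$ satisfying $$\rho\begin{pmatrix}1&1\\0&1\end{pmatrix}=\begin{pmatrix}e^{\pi i/4}&0\\0&e^{-\pi i/4}\end{pmatrix},\qquad \rho\begin{pmatrix}0&-1\\1&0\end{pmatrix}=-\frac{i}{\sqrt2}\begin{pmatrix}1&1\\1&-1\end{pmatrix}.$$ -/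

import Mathlib

open Complex MeasureTheory Matrix
open scoped UpperHalfPlane MatrixGroups Manifold

noncomputable section

namespace MockTheta

/-! ### Jacobi theta series and the `μ`-function -/

/-- The theta series with characteristics,
`∑ₙ e^{2πi(n+a)b} q^{(n+a)²/2} ζ^{n+a}` with `q = e^{2πiτ}`, `ζ = e^{2πiz}`. -/
def thetaChar (a b : ℝ) (z τ : ℂ) : ℂ :=
  ∑' n : ℤ, cexp (2 * Real.pi * I * ((n + a) * b) + Real.pi * I * (n + a) ^ 2 * τ
    + 2 * Real.pi * I * (n + a) * z)

def theta1 (z τ : ℂ) : ℂ := -thetaChar (1 / 2) (1 / 2) z τ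

def theta2 (z τ : ℂ) : ℂ := thetaChar (1 / 2) 0 z τ

def theta3 (z τ : ℂ) : ℂ := thetaChar 0 0 z τ

/-- Zwegers' function `μ(z, z; τ)` multiplied by `i`. -/
def mu (z τ : ℂ) : ℂ :=
  I * cexp (Real.pi * I * z) / thetaChar (1 / 2) (1 / 2) z τ *
    ∑' n : ℤ, (-1 : ℂ) ^ n * cexp (Real.pi * I * (n * (n + 1)) * τ + 2 * Real.pi * I * n * z) /
      (1 - cexp (2 * Real.pi * I * (z + n * τ)))

/-- `S_ℓ(τ)`: the coefficient of `q^{ℓ²/4} ζ^ℓ` in `θ₁(z;τ)² μ(z;τ)`, i.e. `q^{-ℓ²/4}` times the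
`ℓ`-th Fourier coefficient in `z`, computed on the line `Im z = Im τ / 2`, which avoids `ℤτ + ℤ`. -/
def S (l : ℤ) (τ : ℍ) : ℂ :=
  cexp (-2 * Real.pi * I * ((l : ℂ) ^ 2 / 4) * τ) *
    ∫ x in (0 : ℝ)..1,
      theta1 (x + I * (τ.im / 2)) τ ^ 2 * mu (x + I * (τ.im / 2)) τ *
        cexp (-2 * Real.pi * I * l * (x + I * (τ.im / 2)))

/-! ### Zwegers' indefinite theta functions of rank two -/

/-- `B(x, y) = xᵀ A y`. -/
def bilin (A : Matrix (Fin 2) (Fin 2) ℝ) (x y : Fin 2 → ℝ) : ℝ := x ⬝ᵥ (A *ᵥ y)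

/-- `Q(x) = ½ xᵀ A x`. -/
def quad (A : Matrix (Fin 2) (Fin 2) ℝ) (x : Fin 2 → ℝ) : ℝ := bilin A x x / 2

/-- `β(x) = ∫_x^∞ u^{-1/2} e^{-πu} du`. -/
def beta (x : ℝ) : ℝ := ∫ u in Set.Ioi x, u ^ (-(1 / 2) : ℝ) * Real.exp (-Real.pi * u)

/-- `e^{2πi B(ν,b)} q^{Q(ν)}`. -/
def qTerm (A : Matrix (Fin 2) (Fin 2) ℝ) (b ν : Fin 2 → ℝ) (τ : ℍ) : ℂ :=
  cexp (2 * Real.pi * I * bilin A ν b + 2 * Real.pi * I * quad A ν * τ)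

/-- `sgn B(ν,c) · β(-B(ν,c)² y / Q(c))`, with `y = Im τ`. -/
def betaTerm (A : Matrix (Fin 2) (Fin 2) ℝ) (c ν : Fin 2 → ℝ) (τ : ℍ) : ℝ :=
  Real.sign (bilin A ν c) * beta (-(bilin A ν c ^ 2 / quad A c) * τ.im)

/-- `ρ_{c₁,c₂}(ν)`. -/
def rho (A : Matrix (Fin 2) (Fin 2) ℝ) (c₁ c₂ ν : Fin 2 → ℝ) (τ : ℍ) : ℝ :=
  Real.sign (bilin A ν c₁) * (1 - beta (-(bilin A ν c₁ ^ 2 / quad A c₁) * τ.im)) -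
    Real.sign (bilin A ν c₂) * (1 - beta (-(bilin A ν c₂ ^ 2 / quad A c₂) * τ.im))

/-- The point `a + n` of the coset `a + ℤ²`. -/
def shift (a : Fin 2 → ℝ) (n : Fin 2 → ℤ) : Fin 2 → ℝ := fun i => a i + n i

/-- The indefinite theta function `∑_{ν ∈ a + ℤ²} ρ_{c₁,c₂}(ν) e^{2πi B(ν,b)} q^{Q(ν)}`. -/
def indefTheta (A : Matrix (Fin 2) (Fin 2) ℝ) (a b c₁ c₂ : Fin 2 → ℝ) (τ : ℍ) : ℂ :=
  ∑' n : Fin 2 → ℤ, (rho A c₁ c₂ (shift a n) τ : ℂ) * qTerm A b (shift a n) τ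

def A₀ : Matrix (Fin 2) (Fin 2) ℝ := !![1, 2; 2, 2]

def a₀ (l : ℤ) : Fin 2 → ℝ := ![1 / 2, -(l / 2)]

def b₀ : Fin 2 → ℝ := ![1 / 2, 0]

def c₁ : Fin 2 → ℝ := ![-1, 1]

def c₂ : Fin 2 → ℝ := ![-2, 1]

/-- `ϑ^ℓ`. -/
def vartheta (l : ℤ) (τ : ℍ) : ℂ := indefTheta A₀ (a₀ l) b₀ c₁ c₂ τ

/-! ### Modular forms with multiplier and mock modular forms -/

/-- The factor of automorphy `cτ + d`. -/
def autFactor (γ : SL(2, ℤ)) (τ : ℍ) : ℂ := (γ 1 0 : ℂ) * τ + (γ 1 1 : ℂ)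

/-- Holomorphic modular forms of real weight `w` on `Γ` with a unitary multiplier system;
`(cτ + d)^w` is the principal branch. -/
structure IsModularForm (Γ : Subgroup SL(2, ℤ)) (w : ℝ) (f : ℍ → ℂ) : Prop where
  holo : MDifferentiable 𝓘(ℂ) 𝓘(ℂ) f
  modular : ∃ v : Γ → ℂ, (∀ γ, ‖v γ‖ = 1) ∧
    ∀ (γ : Γ) (τ : ℍ), f ((γ : SL(2, ℤ)) • τ) = v γ * autFactor γ τ ^ (w : ℂ) * f τ
  cusps : ∀ γ : SL(2, ℤ),
    UpperHalfPlane.IsBoundedAtImInfty fun τ => autFactor γ τ ^ (-w : ℂ) * f (γ • τ)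

/-- Cusp forms of real weight `w` on `Γ` with a unitary multiplier system. -/
structure IsCuspForm (Γ : Subgroup SL(2, ℤ)) (w : ℝ) (f : ℍ → ℂ) : Prop
    extends IsModularForm Γ w f where
  cusps_zero : ∀ γ : SL(2, ℤ),
    UpperHalfPlane.IsZeroAtImInfty fun τ => autFactor γ τ ^ (-w : ℂ) * f (γ • τ)

/-- The non-holomorphic Eichler integral `∫_{-τ̄}^{i∞} (z + τ)^{-κ} \overline{g(-z̄)} dz` of a cusp
form `g` of weight `2 - κ`, up to the constant factor `i^{1-κ}`: on the vertical path
`z = -x + it`, `t > y`, where `τ = x + iy`, one has `z + τ = i(t + y)` and `-z̄ = x + it`. -/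
def eichlerIntegral (κ : ℝ) (g : ℍ → ℂ) (τ : ℍ) : ℂ :=
  ∫ t in Set.Ioi τ.im, (((t + τ.im) ^ (-κ) : ℝ) : ℂ) *
    (starRingEnd ℂ) (g (UpperHalfPlane.ofComplex (τ.re + I * t)))

/-- `h` is the holomorphic part of the weight `k` function `H`: `h` is holomorphic on `ℍ`, bounded
at `i∞`, and `H - h` is a finite sum of products `f · g*`, where `f` is a modular form of weight
`w ∈ ½ℤ` and `g*` is the non-holomorphic Eichler integral of a cusp form `g` of weight
`2 - (k - w)`. -/
def IsHolomorphicPart (Γ : Subgroup SL(2, ℤ)) (k : ℤ) (h H : ℍ → ℂ) : Prop :=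
  MDifferentiable 𝓘(ℂ) 𝓘(ℂ) h ∧ UpperHalfPlane.IsBoundedAtImInfty h ∧
    ∃ (n : ℕ) (w : Fin n → ℤ) (f g : Fin n → ℍ → ℂ),
      (∀ j, IsModularForm Γ ((w j : ℝ) / 2) (f j)) ∧
      (∀ j, IsCuspForm Γ (2 - (k - (w j : ℝ) / 2)) (g j)) ∧
      ∀ τ, H τ = h τ + ∑ j, f j τ * eichlerIntegral (k - (w j : ℝ) / 2) (g j) τ

/-- `h` is a (mixed) mock modular form of weight `k` on `Γ` with multiplier system `χ` and
completion `H`. -/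
structure IsMockModularForm (Γ : Subgroup SL(2, ℤ)) (k : ℤ) (χ : Γ →* ℂ) (h H : ℍ → ℂ) :
    Prop where
  unitary : ∀ γ, ‖χ γ‖ = 1
  holomorphicPart : IsHolomorphicPart Γ k h H
  modular : ∀ (γ : Γ) (τ : ℍ), H ((γ : SL(2, ℤ)) • τ) = χ γ * autFactor γ τ ^ k * H τ
  cusps : ∀ γ : SL(2, ℤ),
    UpperHalfPlane.IsBoundedAtImInfty fun τ => autFactor γ τ ^ (-k) * H (γ • τ)

/-- `h` is a vector-valued (mixed) mock modular form of weight `k` on `SL₂(ℤ)` with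
representation `R` and completion `H`. -/
structure IsVectorMockModularForm {d : ℕ} (k : ℤ)
    (R : SL(2, ℤ) →* Matrix (Fin d) (Fin d) ℂ) (h H : Fin d → ℍ → ℂ) : Prop where
  holomorphicPart : ∃ Γ : Subgroup SL(2, ℤ), Γ.FiniteIndex ∧
    ∀ i, IsHolomorphicPart Γ k (h i) (H i)
  modular : ∀ (γ : SL(2, ℤ)) (τ : ℍ) (i : Fin d),
    H i (γ • τ) = autFactor γ τ ^ k * ∑ j, R γ i j * H j τ
  cusp : ∀ i, UpperHalfPlane.IsBoundedAtImInfty (H i)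

end MockTheta

end

open MockTheta

noncomputable section

namespace MockTheta

/-! ### Summability of Gaussians -/

/-! Fourier coefficients. For `0 < Im z < Im τ` the denominators `1 - ζqⁿ` of the Appell-Lerch sum
are expanded in geometric series and multiplied by the one theta series that survives in `θ₁² μ`.
Collecting powers of `ζ` exhibits `S_ℓ` as a sum of `e^{2πiB(ν,b)} q^{Q(ν)}` over two opposite
quadrants (`hasSum_modes`, `S_eq_tsum`). This sum depends only on `ℓ` mod 2, which is the theta
decomposition in the strip; quasi-periodicity under `z ↦ z + τ` and a limit onto the real line give
it everywhere off the lattice (`theta_decomposition`). The quadrant signs differ from the sign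
coefficients by a function of the second coordinate alone. Such coefficients contribute nothing: for
a fixed second coordinate a reflection of the first preserves `Q` and changes the sign of the
character (`qTerm_reflect`, `tsum_snd_mul_qTerm`).

Non-holomorphic part. The `β`-sum at `c₂` vanishes by the same reflection. At `c₁` one has `Q = (ν₀
+ ν₁)² - ν₀²/2`, so the sum factors into the unary theta series `fTheta ℓ` of weight `1/2` and the
Eichler integral of the cusp form `gTheta` of weight `3/2` (`tsum_betaTerm_c₁`,
`eichlerIntegral_gTheta`). Hence `ϑ^ℓ = 2i S_ℓ + (-1)^ℓ f_ℓ g*`.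

Modularity. Since `sgn(x)(1 - β(x²))` is an error function, `ρ` is the integral of its derivative
along the segment of negative vectors `c(s) = (-s, 1)`, `1 ≤ s ≤ 2`, from `c₁` to `c₂`
(`rho_mul_qTerm`). The integrand is a Siegel-type theta kernel, a linear form times a Gaussian, and
Poisson summation in one variable at a time gives its inversion formula (`tsum_binTermDual`,
`kernel_inversion`). Integrating over `s` yields `vartheta_inversion`; the translation `τ ↦ τ + 1`
acts term by term.

Representation. The generators provide some matrix for every `γ`. It is unique, because the two
completions are linearly independent: they have different `T`-eigenvalues, `S` mixes them, and the
first has the leading term `q^{1/8}` (`exists_completion_zero_ne_zero`). Uniqueness makes the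
matrices a homomorphism. On `Γ₀(4)`, generated by `T`, `-1` and `S T⁴ S⁻¹`, it is diagonal and
unitary since `T⁴` acts by a scalar; its diagonal entries are the characters. -/

lemma summable_gaussian_int {ε : ℝ} (hε : 0 < ε) (a : ℝ) :
    Summable fun n : ℤ => Real.exp (-ε * (n + a) ^ 2) := by
  have h := summable_pow_mul_jacobiTheta₂_term_bound (|a|) (T := ε / Real.pi)
    (div_pos hε Real.pi_pos) 0
  have h2 := summable_pow_mul_jacobiTheta₂_term_bound (ε * |a| / Real.pi) (T := ε / Real.pi)
    (div_pos hε Real.pi_pos) 0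
  refine Summable.of_nonneg_of_le (fun n => (Real.exp_pos _).le) (fun n => ?_) h2
  rw [pow_zero, one_mul]
  apply Real.exp_le_exp.mpr
  have hp : Real.pi ≠ 0 := Real.pi_pos.ne'
  have e : -Real.pi * (ε / Real.pi * (n:ℝ) ^ 2 - 2 * (ε * |a| / Real.pi) * |(n:ℝ)|)
      = -ε * ((n:ℝ)^2 - 2 * |a| * |(n:ℝ)|) := by field_simp
  push_cast
  rw [e]
  have : -(|a| * |(n:ℝ)|) ≤ a * n := by rw [← abs_mul]; exact neg_abs_le _
  nlinarith [sq_nonneg a]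

lemma summable_gaussian_prod {ε : ℝ} (hε : 0 < ε) (a b : ℝ) :
    Summable fun p : ℤ × ℤ => Real.exp (-ε * ((p.1 + a) ^ 2 + (p.2 + b) ^ 2)) := by
  have h := (summable_gaussian_int hε a).mul_of_nonneg (summable_gaussian_int hε b)
    (fun _ => (Real.exp_pos _).le) (fun _ => (Real.exp_pos _).le)
  refine h.congr fun p => ?_
  rw [← Real.exp_add]; congr 1; ring

/-- Half of the Gaussian is spent on the linear factor: `1 + |x| ≤ 2 + x²`, which is at most a
constant times `1 + εx²/2 ≤ e^{εx²/2}`. -/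
lemma abs_mul_exp_neg_sq_le {ε : ℝ} (hε : 0 < ε) :
    ∃ C > 0, ∀ x : ℝ, (1 + |x|) * Real.exp (-ε * x ^ 2) ≤ C * Real.exp (-(ε / 2) * x ^ 2) := by
  refine ⟨2 + 2 / ε, by positivity, fun x => ?_⟩
  have h1 : Real.exp (-ε * x ^ 2) = Real.exp (-(ε / 2) * x ^ 2) * Real.exp (-(ε / 2) * x ^ 2) := by
    rw [← Real.exp_add]; congr 1; ring
  rw [h1, ← mul_assoc]
  refine mul_le_mul_of_nonneg_right ?_ (Real.exp_pos _).le
  rw [neg_mul, Real.exp_neg, ← div_eq_mul_inv, div_le_iff₀ (Real.exp_pos _)]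
  have h2 := Real.add_one_le_exp (ε / 2 * x ^ 2)
  have h3 : 1 + |x| ≤ 2 + x ^ 2 := by nlinarith [sq_abs x, sq_nonneg (|x| - 1 / 2)]
  calc 1 + |x| ≤ 2 + x ^ 2 := h3
    _ ≤ (2 + 2 / ε) * (ε / 2 * x ^ 2 + 1) := by
      have : (2 + 2 / ε) * (ε / 2 * x ^ 2 + 1) = ε * x ^ 2 + 2 + x ^ 2 + 2 / ε := by
        field_simp; ring
      rw [this]; have : 0 < 2 / ε := by positivity
      nlinarith [sq_nonneg x]
    _ ≤ _ := by gcongr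

/-- A family dominated by a linear function times a Gaussian is summable over a shifted lattice. -/
lemma summable_of_le_linear_gaussian {E : Type*} [NormedAddCommGroup E] [CompleteSpace E]
    {ε C : ℝ} (hε : 0 < ε) (a b : ℝ)
    {F : ℤ × ℤ → E} (hF : ∀ p, ‖F p‖ ≤ C * ((1 + |p.1 + a|) * (1 + |p.2 + b|)) *
      Real.exp (-ε * ((p.1 + a) ^ 2 + (p.2 + b) ^ 2))) : Summable F := by
  obtain ⟨D, hD, h⟩ := abs_mul_exp_neg_sq_le hε
  refine Summable.of_norm_bounded ((summable_gaussian_prod (half_pos hε) a b).mul_left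
    (|C| * (D * D))) fun p => (hF p).trans ?_
  have e1 : C * ((1 + |p.1 + a|) * (1 + |p.2 + b|)) *
      Real.exp (-ε * ((p.1 + a) ^ 2 + (p.2 + b) ^ 2)) = C * (((1 + |p.1 + a|) *
      Real.exp (-ε * (p.1 + a) ^ 2)) * ((1 + |p.2 + b|) * Real.exp (-ε * (p.2 + b) ^ 2))) := by
    rw [mul_add (-ε), Real.exp_add]; ring
  have e2 : |C| * (D * D) * Real.exp (-(ε / 2) * ((p.1 + a) ^ 2 + (p.2 + b) ^ 2)) =
      |C| * ((D * Real.exp (-(ε / 2) * (p.1 + a) ^ 2)) *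
        (D * Real.exp (-(ε / 2) * (p.2 + b) ^ 2))) := by
    rw [mul_add (-(ε / 2)), Real.exp_add]; ring
  rw [e1, e2]
  have hx : ∀ x : ℝ, 0 ≤ (1 + |x|) * Real.exp (-ε * x ^ 2) := fun x => by positivity
  calc _ ≤ |C| * _ := mul_le_mul_of_nonneg_right (le_abs_self C) (mul_nonneg (hx _) (hx _))
    _ ≤ _ := mul_le_mul_of_nonneg_left (mul_le_mul (h _) (h _) (hx _)
      (by positivity)) (abs_nonneg _)

/-! ### Poisson summation for linear polynomials times Gaussians -/

/-- The general term of a one-dimensional theta series with a linear factor. -/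
def linTerm (α l a w d : ℂ) (n : ℤ) : ℂ :=
  (α + l * (n + a)) * cexp (Real.pi * I * d * (n + a) ^ 2 + 2 * Real.pi * I * (n + a) * w)

/-- Expanding `(n + a)²` moves the characteristic into the elliptic variable `w + da`, and the
linear factor in `n` is a derivative in that variable. This gives access to the functional equations
of `jacobiTheta₂` and `jacobiTheta₂'`. -/
lemma linTerm_eq (α l a w d : ℂ) (n : ℤ) : linTerm α l a w d n =
    cexp (Real.pi * I * d * a ^ 2 + 2 * Real.pi * I * a * w) *
      ((α + l * a) * jacobiTheta₂_term n (w + d * a) d +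
        l / (2 * Real.pi * I) * jacobiTheta₂'_term n (w + d * a) d) := by
  have hp : (Real.pi : ℂ) ≠ 0 := ofReal_ne_zero.mpr Real.pi_pos.ne'
  have : cexp (Real.pi * I * d * (n + a) ^ 2 + 2 * Real.pi * I * (n + a) * w) =
      cexp (Real.pi * I * d * a ^ 2 + 2 * Real.pi * I * a * w) *
        jacobiTheta₂_term n (w + d * a) d := by
    rw [jacobiTheta₂_term, ← Complex.exp_add]; congr 1; ring
  rw [linTerm, this, jacobiTheta₂'_term]
  field_simp
  ring

lemma hasSum_linTerm (α l a w : ℂ) {d : ℂ} (hd : 0 < d.im) : HasSum (linTerm α l a w d)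
    (cexp (Real.pi * I * d * a ^ 2 + 2 * Real.pi * I * a * w) *
      ((α + l * a) * jacobiTheta₂ (w + d * a) d +
        l / (2 * Real.pi * I) * jacobiTheta₂' (w + d * a) d)) := by
  simp_rw [funext (linTerm_eq α l a w d)]
  exact (((hasSum_jacobiTheta₂_term _ hd).mul_left _).add
    ((hasSum_jacobiTheta₂'_term _ hd).mul_left _)).mul_left _

lemma summable_linTerm (α l a w : ℂ) {d : ℂ} (hd : 0 < d.im) : Summable (linTerm α l a w d) :=
  (hasSum_linTerm α l a w hd).summable

lemma im_neg_one_div_pos {d : ℂ} (hd : 0 < d.im) : 0 < (-1 / d).im := by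
  rw [div_eq_mul_inv, neg_one_mul, neg_im, inv_im, neg_div, neg_neg]
  exact div_pos hd (normSq_pos.mpr (fun h ↦ lt_irrefl 0 (zero_im ▸ h ▸ hd)))

/-- The general term of the Poisson dual of `linTerm`. -/
def linTermDual (α l a w d : ℂ) (m : ℤ) : ℂ :=
  (α + l * (m - w) / d) * cexp (-Real.pi * I * (m - w) ^ 2 / d + 2 * Real.pi * I * m * a)

/-- Poisson summation, read off from the functional equations of `jacobiTheta₂` and its derivative.
The undifferentiated term in the equation for the derivative turns the constant `α + la` into `α -
lw/d`. -/
theorem hasSum_linTermDual (α l a w : ℂ) {d : ℂ} (hd : 0 < d.im) :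
    HasSum (linTermDual α l a w d) ((-I * d) ^ (1 / 2 : ℂ) * ∑' n, linTerm α l a w d n) := by
  have hd0 : d ≠ 0 := fun h => by simp [h] at hd
  have hp : (Real.pi : ℂ) ≠ 0 := ofReal_ne_zero.mpr Real.pi_pos.ne'
  have hr : (-I * d) ^ (1 / 2 : ℂ) ≠ 0 := by
    rw [Complex.cpow_ne_zero_iff]; left; simp [hd0]
  have hd' := im_neg_one_div_pos hd
  set z := w + d * a with hz
  have key : HasSum (linTermDual α l a w d) (cexp (-Real.pi * I * w ^ 2 / d) *
      ((α - l * w / d) * jacobiTheta₂ (z / d) (-1 / d) +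
        l / (2 * Real.pi * I * d) * jacobiTheta₂' (z / d) (-1 / d))) := by
    have : linTermDual α l a w d = fun m => cexp (-Real.pi * I * w ^ 2 / d) *
      ((α - l * w / d) * jacobiTheta₂_term m (z / d) (-1 / d) +
        l / (2 * Real.pi * I * d) * jacobiTheta₂'_term m (z / d) (-1 / d)) := by
      funext m
      have : cexp (-Real.pi * I * (m - w) ^ 2 / d + 2 * Real.pi * I * m * a) =
        cexp (-Real.pi * I * w ^ 2 / d) * jacobiTheta₂_term m (z / d) (-1 / d) := by
        rw [jacobiTheta₂_term, ← Complex.exp_add]; congr 1; rw [hz]; field_simp; ring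
      rw [linTermDual, this, jacobiTheta₂'_term]
      field_simp
      ring
    rw [this]
    exact (((hasSum_jacobiTheta₂_term _ hd').mul_left _).add
      ((hasSum_jacobiTheta₂'_term _ hd').mul_left _)).mul_left _
  convert key using 1
  rw [(hasSum_linTerm α l a w hd).tsum_eq, ← hz, jacobiTheta₂_functional_equation z d,
    jacobiTheta₂'_functional_equation z d]
  have : cexp (-Real.pi * I * w ^ 2 / d) =
      cexp (Real.pi * I * d * a ^ 2 + 2 * Real.pi * I * a * w) * cexp (-Real.pi * I * z ^ 2 / d) := by
    rw [← Complex.exp_add]; congr 1; rw [hz]; field_simp; ring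
  rw [this]
  have hw : w = z - d * a := by rw [hz]; ring
  rw [hw]
  generalize (-I * d) ^ (1 / 2 : ℂ) = r at *
  field_simp
  ring

/-! ### Poisson summation for binary theta series with a linear factor -/

/-- The imaginary part of the complex binary form `a x² + 2 b x y + d y²` is positive definite. -/
def ImPosDef (a b d : ℂ) : Prop :=
  ∃ ε > 0, ∀ x y : ℝ, ε * (x ^ 2 + y ^ 2) ≤ a.im * x ^ 2 + 2 * b.im * x * y + d.im * y ^ 2

lemma ImPosDef.swap {a b d : ℂ} (h : ImPosDef a b d) : ImPosDef d b a := by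
  obtain ⟨ε, hε, h⟩ := h
  exact ⟨ε, hε, fun x y => by have := h y x; nlinarith⟩

lemma ImPosDef.im_pos {a b d : ℂ} (h : ImPosDef a b d) : 0 < d.im := by
  obtain ⟨ε, hε, h⟩ := h
  have := h 0 1
  norm_num at this
  linarith

/-- A partial Fourier transform in the second variable keeps the Gaussian decaying. Put `u = bx +
dξ` with `ξ` complex; because `u` is real, the new imaginary part at `(x, u)` is the old one at `(x,
Re ξ)` plus `Im d · (Im ξ)²`, and `u²` is controlled by `x²` and `|ξ|²`. -/
lemma ImPosDef.partial_inv {a b d : ℂ} (h : ImPosDef a b d) :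
    ImPosDef (a - b ^ 2 / d) (b / d) (-1 / d) := by
  have hd := h.im_pos
  have hd0 : d ≠ 0 := fun h => by simp [h] at hd
  obtain ⟨ε, hε, h⟩ := h
  set δ := min ε d.im with hδ
  have hδ0 : 0 < δ := lt_min hε hd
  -- `x² + u² ≤ N (x² + |ξ|²)`, from `|bx + dξ|² ≤ 2|b|²x² + 2|d|²|ξ|²`.
  set N := 1 + 2 * normSq b + 2 * normSq d with hN
  have hN0 : 0 < N := by have := normSq_nonneg b; have := normSq_nonneg d; positivity
  refine ⟨δ / N, by positivity, fun x u => ?_⟩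
  set ξ : ℂ := (u - b * x) / d with hξ
  have hu : (u : ℂ) = b * x + d * ξ := by rw [hξ]; field_simp; ring
  have e1 : (a - b ^ 2 / d).im * x ^ 2 + 2 * (b / d).im * x * u + (-1 / d).im * u ^ 2 =
      (a * x ^ 2 - d * ξ ^ 2).im := by
    have : a * x ^ 2 - d * ξ ^ 2 = (x ^ 2 : ℝ) * (a - b ^ 2 / d) + (2 * x * u : ℝ) * (b / d) +
        (u ^ 2 : ℝ) * (-1 / d) := by rw [hξ]; push_cast; field_simp; ring
    rw [this, add_im, add_im, im_ofReal_mul, im_ofReal_mul, im_ofReal_mul]; ring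
  have hre := congrArg Complex.re hu
  have him := congrArg Complex.im hu
  simp at hre him
  have e2 : (a * x ^ 2 - d * ξ ^ 2).im =
      a.im * x ^ 2 + 2 * b.im * x * ξ.re + d.im * ξ.re ^ 2 + d.im * ξ.im ^ 2 := by
    have : (a * x ^ 2 - d * ξ ^ 2).im = a.im * x ^ 2 - d.im * (ξ.re ^ 2 - ξ.im ^ 2) -
        d.re * (2 * ξ.re * ξ.im) := by
      simp [pow_two]; ring
    rw [this]; linear_combination (2 * ξ.re) * him
  rw [e1, e2]
  have h1 := h x ξ.re
  have h2 : δ * (x ^ 2 + (ξ.re ^ 2 + ξ.im ^ 2)) ≤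
      a.im * x ^ 2 + 2 * b.im * x * ξ.re + d.im * ξ.re ^ 2 + d.im * ξ.im ^ 2 := by
    have : δ ≤ ε := min_le_left _ _
    have : δ ≤ d.im := min_le_right _ _
    nlinarith [sq_nonneg x, sq_nonneg ξ.re, sq_nonneg ξ.im]
  refine le_trans ?_ h2
  rw [div_mul_eq_mul_div, div_le_iff₀ hN0, mul_assoc]
  refine mul_le_mul_of_nonneg_left ?_ hδ0.le
  have h3 : u ^ 2 ≤ 2 * (normSq b * x ^ 2) + 2 * (normSq d * (ξ.re ^ 2 + ξ.im ^ 2)) := by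
    have hb : normSq b = b.re ^ 2 + b.im ^ 2 := by rw [normSq_apply]; ring
    have hdn : normSq d = d.re ^ 2 + d.im ^ 2 := by rw [normSq_apply]; ring
    rw [hre, hb, hdn]
    nlinarith [sq_nonneg (b.re * x - (d.re * ξ.re - d.im * ξ.im)), sq_nonneg (b.im * x),
      sq_nonneg (d.re * ξ.im + d.im * ξ.re)]
  have := normSq_nonneg b
  have := normSq_nonneg d
  have hz : 0 ≤ ξ.re ^ 2 + ξ.im ^ 2 := by positivity
  have hx : 0 ≤ x ^ 2 := by positivity
  rw [hN]
  nlinarith [mul_nonneg (normSq_nonneg b) hx, mul_nonneg (normSq_nonneg d) hx,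
    mul_nonneg (normSq_nonneg b) hz, mul_nonneg (normSq_nonneg d) hz]

lemma ImPosDef.summable {a b d : ℂ} (h : ImPosDef a b d) (s t : ℝ) (c₁ c₂ : ℂ) {F : ℤ × ℤ → ℂ}
    (hF : ∀ p : ℤ × ℤ, ‖F p‖ = ‖c₁ * (p.1 + s) + c₂ * (p.2 + t)‖ * ‖cexp (Real.pi * I *
      (a * (p.1 + s) ^ 2 + 2 * b * (p.1 + s) * (p.2 + t) + d * (p.2 + t) ^ 2))‖) :
    Summable F := by
  obtain ⟨ε, hε, h⟩ := h
  refine summable_of_le_linear_gaussian (ε := Real.pi * ε) (C := ‖c₁‖ + ‖c₂‖)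
    (mul_pos Real.pi_pos hε) s t fun p => ?_
  rw [hF]
  set x : ℝ := p.1 + s with hx
  set y : ℝ := p.2 + t with hy
  have ex : ((p.1 : ℂ) + s) = (x : ℂ) := by rw [hx]; push_cast; rfl
  have ey : ((p.2 : ℂ) + t) = (y : ℂ) := by rw [hy]; push_cast; rfl
  rw [ex, ey]
  refine mul_le_mul ?_ ?_ (norm_nonneg _) (by positivity)
  · refine (norm_add_le _ _).trans ?_
    rw [norm_mul, norm_mul, norm_real, norm_real, Real.norm_eq_abs, Real.norm_eq_abs]
    have h1 := norm_nonneg c₁; have h2 := norm_nonneg c₂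
    have h3 := abs_nonneg x; have h4 := abs_nonneg y
    nlinarith [mul_nonneg h1 h3, mul_nonneg h1 h4, mul_nonneg h2 h3, mul_nonneg h2 h4,
      mul_nonneg h1 (mul_nonneg h3 h4), mul_nonneg h2 (mul_nonneg h3 h4)]
  · rw [Complex.norm_exp]
    apply Real.exp_le_exp.mpr
    have : (Real.pi * I * (a * x ^ 2 + 2 * b * x * y + d * y ^ 2)).re =
        -Real.pi * (a.im * x ^ 2 + 2 * b.im * x * y + d.im * y ^ 2) := by
      have : Real.pi * I * (a * x ^ 2 + 2 * b * x * y + d * y ^ 2) =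
        ((Real.pi * x ^ 2 : ℝ) * a + (Real.pi * (2 * x * y) : ℝ) * b +
          (Real.pi * y ^ 2 : ℝ) * d) * I := by
        push_cast; ring
      rw [this, mul_I_re, add_im, add_im, im_ofReal_mul, im_ofReal_mul, im_ofReal_mul]
      ring
    rw [this]
    nlinarith [h x y, Real.pi_pos]

lemma norm_exp_add_I_mul_real (z : ℂ) (r : ℝ) : ‖cexp (z + r * I)‖ = ‖cexp z‖ := by
  rw [Complex.exp_add, norm_mul, Complex.norm_exp_ofReal_mul_I, mul_one]

/-- The general term of a binary theta series with characteristics and a linear factor. -/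
def binTerm (x₁ x₂ a b d : ℂ) (a₁ a₂ b₁ b₂ : ℝ) (p : ℤ × ℤ) : ℂ :=
  (x₁ * (p.1 + a₁) + x₂ * (p.2 + a₂)) * cexp (Real.pi * I *
    (a * (p.1 + a₁) ^ 2 + 2 * b * (p.1 + a₁) * (p.2 + a₂) + d * (p.2 + a₂) ^ 2) +
    2 * Real.pi * I * ((p.1 + a₁) * b₁ + (p.2 + a₂) * b₂))

/-- The Poisson dual of `binTerm` in the second variable. -/
def binTermMid (x₁ x₂ a b d : ℂ) (a₁ a₂ b₁ b₂ : ℝ) (p : ℤ × ℤ) : ℂ :=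
  ((x₁ - x₂ * b / d) * (p.1 + a₁) + x₂ / d * (p.2 - b₂)) * cexp (Real.pi * I *
    ((a - b ^ 2 / d) * (p.1 + a₁) ^ 2 + 2 * (b / d) * (p.1 + a₁) * (p.2 - b₂) +
      (-1 / d) * (p.2 - b₂) ^ 2) + 2 * Real.pi * I * ((p.1 + a₁) * b₁ + p.2 * a₂))

/-- The Poisson dual of `binTerm`, where `e = a - b² / d`. -/
def binTermDual (x₁ x₂ b d e : ℂ) (a₁ a₂ b₁ b₂ : ℝ) (p : ℤ × ℤ) : ℂ :=
  (x₂ / d * (p.2 - b₂) + (x₁ - x₂ * b / d) / e * ((p.1 - b₁) - b / d * (p.2 - b₂))) *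
    cexp (-Real.pi * I * (((p.1 - b₁) - b / d * (p.2 - b₂)) ^ 2 / e + (p.2 - b₂) ^ 2 / d) +
    2 * Real.pi * I * (p.1 * a₁ + p.2 * a₂))

lemma ImPosDef.summable_binTerm {a b d : ℂ} (h : ImPosDef a b d) (x₁ x₂ : ℂ)
    (a₁ a₂ b₁ b₂ : ℝ) : Summable (binTerm x₁ x₂ a b d a₁ a₂ b₁ b₂) := by
  refine h.summable a₁ a₂ x₁ x₂ fun p => ?_
  rw [binTerm, norm_mul]
  congr 1
  refine Eq.trans ?_ (norm_exp_add_I_mul_real _ (2 * Real.pi * ((p.1 + a₁) * b₁ + (p.2 + a₂) * b₂)))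
  congr 2; push_cast; ring

lemma ImPosDef.summable_binTermMid {a b d : ℂ} (h : ImPosDef a b d) (x₁ x₂ : ℂ)
    (a₁ a₂ b₁ b₂ : ℝ) : Summable (binTermMid x₁ x₂ a b d a₁ a₂ b₁ b₂) := by
  refine h.partial_inv.summable a₁ (-b₂) (x₁ - x₂ * b / d) (x₂ / d) fun p => ?_
  rw [binTermMid, norm_mul]
  congr 1
  · push_cast; rfl
  refine Eq.trans ?_ (norm_exp_add_I_mul_real _ (2 * Real.pi * ((p.1 + a₁) * b₁ + p.2 * a₂)))
  congr 2; push_cast; ring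

lemma ImPosDef.summable_binTermDual {a b d e : ℂ} (h : ImPosDef a b d) (he : e = a - b ^ 2 / d)
    (x₁ x₂ : ℂ) (a₁ a₂ b₁ b₂ : ℝ) : Summable (binTermDual x₁ x₂ b d e a₁ a₂ b₁ b₂) := by
  have h2 := h.partial_inv
  rw [← he] at h2
  -- The second inversion acts on the first variable, hence the swap before and after.
  refine h2.swap.partial_inv.swap.summable (-b₁) (-b₂) ((x₁ - x₂ * b / d) / e)
    (x₂ / d - (x₁ - x₂ * b / d) / e * (b / d)) fun p => ?_
  rw [binTermDual, norm_mul]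
  congr 1
  · congr 1; push_cast; ring
  refine Eq.trans ?_ (norm_exp_add_I_mul_real _ (2 * Real.pi * (p.1 * a₁ + p.2 * a₂)))
  congr 2; push_cast; ring

/-- One-dimensional Poisson summation in the second variable for a fixed first one, then in the
first variable for a fixed second one. Absolute convergence of the original, the intermediate and
the dual double series justifies the interchanges. -/
theorem tsum_binTermDual {a b d e : ℂ} (h : ImPosDef a b d) (he : e = a - b ^ 2 / d)
    (x₁ x₂ : ℂ) (a₁ a₂ b₁ b₂ : ℝ) :
    ∑' p, binTermDual x₁ x₂ b d e a₁ a₂ b₁ b₂ p =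
      (-I * e) ^ (1 / 2 : ℂ) * (-I * d) ^ (1 / 2 : ℂ) *
        ∑' p, binTerm x₁ x₂ a b d a₁ a₂ b₁ b₂ p := by
  have hd := h.im_pos
  have hd0 : d ≠ 0 := fun h => by simp [h] at hd
  have he' : 0 < e.im := he ▸ h.partial_inv.swap.im_pos
  have he0 : e ≠ 0 := fun h => by simp [h] at he'
  have step1 : ∀ n : ℤ, ∑' m, binTermMid x₁ x₂ a b d a₁ a₂ b₁ b₂ (n, m) =
      (-I * d) ^ (1 / 2 : ℂ) * ∑' m, binTerm x₁ x₂ a b d a₁ a₂ b₁ b₂ (n, m) := by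
    intro n
    have h1 := (hasSum_linTermDual (x₁ * (n + a₁)) x₂ a₂ (b * (n + a₁) + b₂) hd).tsum_eq
    set c := cexp (Real.pi * I * (a * (n + a₁) ^ 2) + 2 * Real.pi * I * ((n + a₁) * b₁)) with hc
    have e1 : ∀ m, binTermMid x₁ x₂ a b d a₁ a₂ b₁ b₂ (n, m) =
        c * linTermDual (x₁ * (n + a₁)) x₂ a₂ (b * (n + a₁) + b₂) d m := by
      intro m
      rw [binTermMid, linTermDual, mul_left_comm, hc, ← Complex.exp_add]
      congr 1
      · field_simp; ring
      · congr 1; field_simp; ring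
    have e2 : ∀ m, binTerm x₁ x₂ a b d a₁ a₂ b₁ b₂ (n, m) =
        c * linTerm (x₁ * (n + a₁)) x₂ a₂ (b * (n + a₁) + b₂) d m := by
      intro m
      rw [binTerm, linTerm, mul_left_comm, hc, ← Complex.exp_add]
      congr 2; ring
    simp_rw [e1, e2, tsum_mul_left, h1]
    ring
  have step2 : ∀ m : ℤ, ∑' n, binTermDual x₁ x₂ b d e a₁ a₂ b₁ b₂ (n, m) =
      (-I * e) ^ (1 / 2 : ℂ) * ∑' n, binTermMid x₁ x₂ a b d a₁ a₂ b₁ b₂ (n, m) := by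
    intro m
    have h1 := (hasSum_linTermDual (x₂ / d * (m - b₂)) (x₁ - x₂ * b / d) a₁
      (b₁ + b / d * (m - b₂)) he').tsum_eq
    set c := cexp (-Real.pi * I * ((m - b₂) ^ 2 / d) + 2 * Real.pi * I * (m * a₂)) with hc
    have e1 : ∀ n, binTermDual x₁ x₂ b d e a₁ a₂ b₁ b₂ (n, m) =
        c * linTermDual (x₂ / d * (m - b₂)) (x₁ - x₂ * b / d) a₁ (b₁ + b / d * (m - b₂)) e n := by
      intro n
      rw [binTermDual, linTermDual, mul_left_comm, hc, ← Complex.exp_add]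
      congr 1
      · ring
      · congr 1; ring
    have e2 : ∀ n, binTermMid x₁ x₂ a b d a₁ a₂ b₁ b₂ (n, m) =
        c * linTerm (x₂ / d * (m - b₂)) (x₁ - x₂ * b / d) a₁ (b₁ + b / d * (m - b₂)) e n := by
      intro n
      rw [binTermMid, linTerm, mul_left_comm, hc, ← Complex.exp_add, ← he]
      congr 1
      · ring
      · congr 1; ring
    simp_rw [e1, e2, tsum_mul_left, h1]
    ring
  have s1 := h.summable_binTerm x₁ x₂ a₁ a₂ b₁ b₂
  have s2 := h.summable_binTermMid x₁ x₂ a₁ a₂ b₁ b₂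
  have s3 := h.summable_binTermDual he x₁ x₂ a₁ a₂ b₁ b₂
  rw [s1.tsum_prod, s3.tsum_prod, mul_assoc, ← tsum_mul_left]
  simp_rw [← step1]
  rw [← Summable.tsum_comm (f := fun n m => binTermDual x₁ x₂ b d e a₁ a₂ b₁ b₂ (n, m)) s3,
    ← Summable.tsum_comm (f := fun n m => binTermMid x₁ x₂ a b d a₁ a₂ b₁ b₂ (n, m)) s2]
  simp_rw [step2, tsum_mul_left]

/-! ### The theta kernel attached to a negative vector `(-s, 1)` -/

/-- `-Q(c)` for `c = (-s, 1)`. -/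
def kerP (s : ℝ) : ℝ := 2 * s - 1 - s ^ 2 / 2

lemma kerP_mem {s : ℝ} (hs : s ∈ Set.Icc (1 : ℝ) 2) : 1 / 2 ≤ kerP s ∧ kerP s ≤ 1 := by
  obtain ⟨h1, h2⟩ := hs
  unfold kerP
  constructor <;> nlinarith

lemma kerP_pos {s : ℝ} (hs : s ∈ Set.Icc (1 : ℝ) 2) : 0 < kerP s := by
  linarith [(kerP_mem hs).1]

/-- Coefficients of the form `τ X² - τ̄ ψ²`, where `2 Q = X² - ψ²` is the decomposition along
`c = (-s, 1)` and its orthogonal complement. -/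
def kerA (τ : ℂ) (s : ℝ) : ℂ :=
  (τ - (starRingEnd ℂ) τ * ((2 - s) ^ 2 / 2)) / (kerP s : ℂ)

def kerB (τ : ℂ) (s : ℝ) : ℂ :=
  (τ * s - (starRingEnd ℂ) τ * ((2 - s) * (1 - s))) / (kerP s : ℂ)

def kerD (τ : ℂ) (s : ℝ) : ℂ :=
  (τ * s ^ 2 - (starRingEnd ℂ) τ * (2 * (1 - s) ^ 2)) / (kerP s : ℂ)

lemma kerA_im (τ : ℂ) (s : ℝ) : (kerA τ s).im = τ.im * (1 + (2 - s) ^ 2 / 2) / kerP s := by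
  have : kerA τ s = ((1 / kerP s : ℝ) : ℂ) * τ -
      (((2 - s) ^ 2 / 2 / kerP s : ℝ) : ℂ) * (starRingEnd ℂ) τ := by
    rw [kerA]; push_cast; ring
  rw [this, sub_im, im_ofReal_mul, im_ofReal_mul, conj_im]; ring

lemma kerB_im (τ : ℂ) (s : ℝ) :
    (kerB τ s).im = τ.im * (s + (2 - s) * (1 - s)) / kerP s := by
  have : kerB τ s = ((s / kerP s : ℝ) : ℂ) * τ -
      (((2 - s) * (1 - s) / kerP s : ℝ) : ℂ) * (starRingEnd ℂ) τ := by
    rw [kerB]; push_cast; ring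
  rw [this, sub_im, im_ofReal_mul, im_ofReal_mul, conj_im]; ring

lemma kerD_im (τ : ℂ) (s : ℝ) :
    (kerD τ s).im = τ.im * (s ^ 2 + 2 * (1 - s) ^ 2) / kerP s := by
  have : kerD τ s = ((s ^ 2 / kerP s : ℝ) : ℂ) * τ -
      ((2 * (1 - s) ^ 2 / kerP s : ℝ) : ℂ) * (starRingEnd ℂ) τ := by
    rw [kerD]; push_cast; ring
  rw [this, sub_im, im_ofReal_mul, im_ofReal_mul, conj_im]; ring

/-- Up to the factor `y`, the imaginary part is the majorant `X² + ψ²`. The smaller eigenvalue of a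
positive binary form is at least determinant over trace; after scaling by `2 kerP s` the determinant
is `8 (kerP s)²` and the trace is at most `15` on the segment. -/
lemma kernel_im_lower {τ : ℂ} (hτ : 0 < τ.im) {s : ℝ} (hs : s ∈ Set.Icc (1 : ℝ) 2) (u v : ℝ) :
    τ.im / 15 * (u ^ 2 + v ^ 2) ≤
      (kerA τ s).im * u ^ 2 + 2 * (kerB τ s).im * u * v + (kerD τ s).im * v ^ 2 := by
  have hp := kerP_pos hs
  obtain ⟨hp1, hp2⟩ := kerP_mem hs
  have e : (kerA τ s).im * u ^ 2 + 2 * (kerB τ s).im * u * v + (kerD τ s).im * v ^ 2 =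
      τ.im / 2 * (((2 + (2 - s) ^ 2) * u ^ 2 + 2 * (2 * s + 2 * (2 - s) * (1 - s)) * u * v +
        (2 * s ^ 2 + 4 * (1 - s) ^ 2) * v ^ 2) / kerP s) := by
    rw [kerA_im, kerB_im, kerD_im]; ring
  rw [e, show τ.im / 15 * (u ^ 2 + v ^ 2) = τ.im / 2 * (2 / 15 * (u ^ 2 + v ^ 2)) by ring]
  refine mul_le_mul_of_nonneg_left ?_ (by linarith)
  rw [le_div_iff₀ hp]
  set α := 2 + (2 - s) ^ 2 with hα
  set β := 2 * s + 2 * (2 - s) * (1 - s) with hβ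
  set γ := 2 * s ^ 2 + 4 * (1 - s) ^ 2 with hγ
  have hdet : α * γ - β ^ 2 = 8 * kerP s ^ 2 := by rw [hα, hβ, hγ, kerP]; ring
  have hα0 : 0 < α := by positivity
  have hγ0 : 0 ≤ γ := by positivity
  have htr : α + γ ≤ 15 := by rw [hα, hγ]; nlinarith [hs.1, hs.2]
  have hF : 0 ≤ α * u ^ 2 + 2 * β * u * v + γ * v ^ 2 := by
    by_contra hc
    push Not at hc
    nlinarith [sq_nonneg (α * u + β * v), sq_nonneg v, sq_nonneg (kerP s), mul_nonneg
      (sq_nonneg (kerP s)) (sq_nonneg v)]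
  -- Cayley-Hamilton: for the symmetric matrix `M` of the form, `tr(M) M - det(M) = M²` is positive
  -- semidefinite.
  have h1 : 8 * kerP s ^ 2 * (u ^ 2 + v ^ 2) ≤
      (α + γ) * (α * u ^ 2 + 2 * β * u * v + γ * v ^ 2) := by
    rw [← hdet]
    nlinarith [sq_nonneg (α * u + β * v), sq_nonneg (β * u + γ * v)]
  have h2 : (α + γ) * (α * u ^ 2 + 2 * β * u * v + γ * v ^ 2) ≤
      15 * (α * u ^ 2 + 2 * β * u * v + γ * v ^ 2) := mul_le_mul_of_nonneg_right htr hF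
  have h3 : 2 * kerP s * (u ^ 2 + v ^ 2) ≤ 8 * kerP s ^ 2 * (u ^ 2 + v ^ 2) :=
    mul_le_mul_of_nonneg_right (by nlinarith) (by positivity)
  linarith

lemma kernel_imPosDef {τ : ℂ} (hτ : 0 < τ.im) {s : ℝ} (hs : s ∈ Set.Icc (1 : ℝ) 2) :
    ImPosDef (kerA τ s) (kerB τ s) (kerD τ s) :=
  ⟨τ.im / 15, by positivity, kernel_im_lower hτ hs⟩

/-- `X² - ψ²` has determinant `det A = -2`; scaling the two orthogonal directions by `τ` and `τ̄`
multiplies it by `ττ̄`. -/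
lemma kernel_det (τ : ℂ) {s : ℝ} (hs : s ∈ Set.Icc (1 : ℝ) 2) :
    kerA τ s * kerD τ s - kerB τ s ^ 2 = -2 * (τ * (starRingEnd ℂ) τ) := by
  have hp : (kerP s : ℂ) ≠ 0 := ofReal_ne_zero.mpr (kerP_pos hs).ne'
  rw [kerA, kerB, kerD]
  field_simp
  rw [kerP]; push_cast
  ring

/-- The term of index `ν = (n₁ + 1/2, n₂ - l/2)` of the theta kernel. -/
def kernelTerm (l : ℤ) (τ : ℂ) (s : ℝ) (p : ℤ × ℤ) : ℂ :=
  binTerm 1 s (kerA τ s) (kerB τ s) (kerD τ s) (1 / 2) (-(l / 2)) (1 / 2) 1 p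

/-- `-Iz` lies in the right half-plane and `-Iw` is a positive multiple of its inverse, so the
logarithms cancel up to `2 log r` and no branch sign appears. -/
lemma sqrt_mul_sqrt {z w : ℂ} (hz : 0 < z.im) {r : ℝ} (hr : 0 < r)
    (h : z * w = -(r ^ 2 : ℝ)) : (-I * z) ^ (1 / 2 : ℂ) * (-I * w) ^ (1 / 2 : ℂ) = r := by
  have hre : 0 < (-I * z).re := by simpa using hz
  have hz0 : z ≠ 0 := fun h => by simp [h] at hz
  have ha0 : -I * z ≠ 0 := by simp [hz0]
  have harg : (-I * z).arg ≠ Real.pi := fun h => by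
    have := abs_arg_lt_pi_div_two_iff.mpr (Or.inl hre)
    rw [h, abs_of_pos Real.pi_pos] at this
    linarith [Real.pi_pos]
  have hw : -I * w = ((r ^ 2 : ℝ) : ℂ) * (-I * z)⁻¹ := by
    have : w = -(r ^ 2 : ℝ) / z := by rw [← h]; field_simp
    rw [this]; field_simp; push_cast; rw [I_sq]; ring
  have hw0 : -I * w ≠ 0 := by
    rw [hw]; exact mul_ne_zero (ofReal_ne_zero.mpr (by positivity)) (inv_ne_zero ha0)
  rw [cpow_def_of_ne_zero ha0, cpow_def_of_ne_zero hw0, ← Complex.exp_add, hw,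
    Complex.log_ofReal_mul (by positivity) (inv_ne_zero ha0), Complex.log_inv _ harg, Real.log_pow]
  have : log (-I * z) * (1 / 2) + (((2 : ℕ) * Real.log r : ℝ) + -log (-I * z)) * (1 / 2) =
      (Real.log r : ℂ) := by push_cast; ring
  rw [this, ← ofReal_exp, Real.exp_log hr]

/-- A sum split along two injections with complementary ranges. -/
lemma tsum_eq_add_of_isCompl {ι κ : Type*} {f : ι → ℂ} (hf : Summable f) {g₀ g₁ : κ → ι}
    (h₀ : Function.Injective g₀) (h₁ : Function.Injective g₁)
    (hc : IsCompl (Set.range g₀) (Set.range g₁)) :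
    ∑' i, f i = ∑' k, f (g₀ k) + ∑' k, f (g₁ k) := by
  have h2 : (Set.range g₀)ᶜ = Set.range g₁ := hc.compl_eq
  rw [← hf.tsum_subtype_add_tsum_subtype_compl (Set.range g₀), h2]
  congr 1
  · exact tsum_range f h₀
  · exact tsum_range f h₁

/-- The lattice points of the dual lattice in the class of `l'`, in the coordinates of
`(1/2, -l'/2) + ℤ²`. -/
def dualIndex (l' : ℤ) (p : ℤ × ℤ) : ℤ × ℤ :=
  -- This is `A (p + (1/2, -l'/2)) + Ab` with `Ab = (1/2, 1)`. The second entry has the parity of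
  -- `l'`, which separates the two classes of the dual lattice.
  (p.1 + 2 * p.2 + 1 - l', 2 * (p.1 + p.2 + 1 - l') + l')

lemma dualIndex_injective (l' : ℤ) : Function.Injective (dualIndex l') := by
  rintro ⟨a, b⟩ ⟨c, d⟩ h
  simp only [dualIndex, Prod.mk.injEq] at h ⊢
  omega

lemma dualIndex_isCompl : IsCompl (Set.range (dualIndex 0)) (Set.range (dualIndex 1)) := by
  constructor
  · rw [Set.disjoint_left]
    rintro ⟨a, b⟩ ⟨⟨x, y⟩, h⟩ ⟨⟨z, w⟩, h2⟩
    simp only [dualIndex, Prod.mk.injEq] at h h2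
    omega
  · rw [codisjoint_iff_le_sup]
    rintro ⟨a, b⟩ -
    rcases Int.even_or_odd' b with ⟨k, hk | hk⟩
    · exact Or.inl ⟨(2 * k - a - 1, a - k), by simp only [dualIndex, Prod.mk.injEq]; omega⟩
    · exact Or.inr ⟨(2 * k - a, a - k), by simp only [dualIndex, Prod.mk.injEq]; omega⟩

/-- After removing the characteristic, the dual index is `A` applied to a point of the coset for
`l'`. Inverting `A` turns the dual quadratic form back into the kernel form, now at `-1/τ`; only the
phase `(-1)^{ll'}` and the factor `I/τ` remain. -/
lemma binTermDual_kernel (l l' : ℤ) {τ : ℂ} (hτ : 0 < τ.im) {s : ℝ} (hs : s ∈ Set.Icc (1 : ℝ) 2)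
    (p : ℤ × ℤ) :
    binTermDual 1 s (kerB τ s) (kerD τ s) (kerA τ s - kerB τ s ^ 2 / kerD τ s)
      (1 / 2) (-(l / 2)) (1 / 2) 1 (dualIndex l' p) =
    I / τ * ((-1) ^ (l * l') * kernelTerm l' (-1 / τ) s p) := by
  have hp : (kerP s : ℂ) ≠ 0 := ofReal_ne_zero.mpr (kerP_pos hs).ne'
  have hd0 : kerD τ s ≠ 0 := fun h => by
    have := (kernel_imPosDef hτ hs).im_pos; simp [h] at this
  have hτ0 : τ ≠ 0 := fun h => by simp [h] at hτ
  have hc0 : (starRingEnd ℂ) τ ≠ 0 := by simpa using hτ0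
  have hdet := kernel_det τ hs
  have hP : (kerP s : ℂ) = 2 * s - 1 - s ^ 2 / 2 := by rw [kerP]; push_cast; ring
  set N := τ * (starRingEnd ℂ) τ with hN
  have hN0 : N ≠ 0 := mul_ne_zero hτ0 hc0
  have he : kerA τ s - kerB τ s ^ 2 / kerD τ s = -2 * N / kerD τ s := by
    rw [← hdet]; field_simp
  set a := kerA τ s with ha
  set b := kerB τ s with hb
  set d := kerD τ s with hd
  have hb2 : b ^ 2 = a * d + 2 * N := by linear_combination -hdet
  -- Here and in `quadr` the new coordinates are `A⁻¹(u, v) = (v - u, u - v/2)`: the linear form `X`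
  -- picks up `1/τ`, and the quadratic form is evaluated at `-1/τ`.
  have lin : ∀ u v : ℂ, (s : ℂ) / d * v + (1 - s * b / d) / (-2 * N / d) * (u - b / d * v) =
      1 / τ * ((s - 1) * u + (1 - s / 2) * v) := by
    intro u v
    have h1 : (s : ℂ) / d * v + (1 - s * b / d) / (-2 * N / d) * (u - b / d * v) =
        (u * (s * b - d) + v * (b - s * a)) / (2 * N) := by
      field_simp
      linear_combination (-(s : ℂ) * v) * hb2
    have h2 : (s : ℂ) * b - d = 2 * (starRingEnd ℂ) τ * (s - 1) := by
      rw [hb, hd, kerB, kerD]; field_simp; rw [hP]; ring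
    have h3 : b - s * a = 2 * (starRingEnd ℂ) τ * (1 - s / 2) := by
      rw [hb, ha, kerB, kerA]; field_simp; rw [hP]; ring
    rw [h1, h2, h3, hN]; field_simp
  have quadr : ∀ u v : ℂ, (u - b / d * v) ^ 2 / (-2 * N / d) + v ^ 2 / d =
      -(kerA (-1 / τ) s * (v - u) ^ 2 + 2 * kerB (-1 / τ) s * (v - u) * (u - v / 2) +
        kerD (-1 / τ) s * (u - v / 2) ^ 2) := by
    intro u v
    have h1 : (u - b / d * v) ^ 2 / (-2 * N / d) + v ^ 2 / d =
        (-d * u ^ 2 + 2 * b * u * v - a * v ^ 2) / (2 * N) := by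
      field_simp
      linear_combination (-v ^ 2) * hb2
    rw [h1, hN, ha, hb, hd, kerA, kerB, kerD, kerA, kerB, kerD, map_div₀, map_neg, map_one]
    field_simp
    ring
  rw [binTermDual, kernelTerm, binTerm, he]
  have hu : (((dualIndex l' p).1 : ℂ) - ((1 / 2 : ℝ) : ℂ)) = p.1 + 2 * p.2 + 1 / 2 - l' := by
    simp only [dualIndex]; push_cast; ring
  have hv : (((dualIndex l' p).2 : ℂ) - ((1 : ℝ) : ℂ)) = 2 * p.1 + 2 * p.2 + 1 - l' := by
    simp only [dualIndex]; push_cast; ring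
  rw [hu, hv, lin, quadr]
  have hexp : ∀ F G : ℂ, F = G → cexp (-Real.pi * I * -F + 2 * Real.pi * I *
      ((dualIndex l' p).1 * ((1 / 2 : ℝ) : ℂ) + (dualIndex l' p).2 * ((-(l / 2) : ℝ) : ℂ))) =
      (-1) ^ (l * l') * I * cexp (Real.pi * I * G + 2 * Real.pi * I *
        ((p.1 + ((1 / 2 : ℝ) : ℂ)) * ((1 / 2 : ℝ) : ℂ) +
          (p.2 + ((-(l' / 2) : ℝ) : ℂ)) * ((1 : ℝ) : ℂ))) := by
    rintro F _ rfl
    have h1 : ((-1 : ℂ)) ^ (l * l') * I = cexp ((l * l' : ℤ) * (Real.pi * I) + Real.pi / 2 * I) := by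
      rw [Complex.exp_add, Complex.exp_int_mul, exp_pi_mul_I, exp_pi_div_two_mul_I]
    rw [h1, ← Complex.exp_add, Complex.exp_eq_exp_iff_exists_int]
    refine ⟨-(l * (p.1 + p.2 + 1)), ?_⟩
    simp only [dualIndex]
    push_cast
    ring
  rw [hexp _ (kerA (-1 / τ) s * (p.1 + ((1 / 2 : ℝ) : ℂ)) ^ 2 + 2 * kerB (-1 / τ) s *
    (p.1 + ((1 / 2 : ℝ) : ℂ)) * (p.2 + ((-(l' / 2) : ℝ) : ℂ)) +
      kerD (-1 / τ) s * (p.2 + ((-(l' / 2) : ℝ) : ℂ)) ^ 2)]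
  · push_cast; ring
  · push_cast; ring

/-- The two square roots from Poisson summation multiply to `√2 |τ|` by `kernel_det`, and the dual
lattice splits into the cosets for `0` and `1`. -/
theorem kernel_inversion (l : ℤ) {τ : ℂ} (hτ : 0 < τ.im) {s : ℝ} (hs : s ∈ Set.Icc (1 : ℝ) 2) :
    (Real.sqrt 2 * ‖τ‖ : ℝ) * ∑' p, kernelTerm l τ s p =
      I / τ * (∑' p, kernelTerm 0 (-1 / τ) s p + (-1) ^ l * ∑' p, kernelTerm 1 (-1 / τ) s p) := by
  have hpd := kernel_imPosDef hτ hs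
  have hτ0 : τ ≠ 0 := fun h => by simp [h] at hτ
  have hd0 : kerD τ s ≠ 0 := fun h => by have := hpd.im_pos; simp [h] at this
  have h := tsum_binTermDual hpd rfl 1 s (1 / 2) (-(l / 2)) (1 / 2) 1
  rw [sqrt_mul_sqrt (r := Real.sqrt 2 * ‖τ‖) hpd.partial_inv.swap.im_pos (by positivity)] at h
  · unfold kernelTerm at *
    rw [← h, tsum_eq_add_of_isCompl (hpd.summable_binTermDual rfl _ _ _ _ _ _)
      (dualIndex_injective 0) (dualIndex_injective 1) dualIndex_isCompl]
    simp_rw [binTermDual_kernel l 0 hτ hs, binTermDual_kernel l 1 hτ hs,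
      tsum_mul_left]
    simp only [kernelTerm, mul_zero, zpow_zero, one_mul, mul_one]
    ring
  · have : (kerA τ s - kerB τ s ^ 2 / kerD τ s) * kerD τ s =
        kerA τ s * kerD τ s - kerB τ s ^ 2 := by field_simp
    rw [this, kernel_det τ hs, mul_pow, Real.sq_sqrt (by norm_num), mul_conj, normSq_eq_norm_sq]
    push_cast; ring

/-! ### The function `β` and the error function -/

lemma integrableOn_gaussian (x : ℝ) :
    IntegrableOn (fun t : ℝ => Real.exp (-Real.pi * t ^ 2)) (Set.Ioi x) :=
  (integrable_exp_neg_mul_sq Real.pi_pos).integrableOn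

lemma integral_gaussian_Ioi_zero :
    ∫ t in Set.Ioi (0 : ℝ), Real.exp (-Real.pi * t ^ 2) = 1 / 2 := by
  rw [integral_gaussian_Ioi, div_self Real.pi_pos.ne', Real.sqrt_one]

lemma beta_sq {x : ℝ} (hx : 0 ≤ x) :
    beta (x ^ 2) = 2 * ∫ t in Set.Ioi x, Real.exp (-Real.pi * t ^ 2) := by
  have him : (fun t : ℝ => t ^ 2) '' Set.Ioi x = Set.Ioi (x ^ 2) := by
    ext w
    simp only [Set.mem_image, Set.mem_Ioi]
    constructor
    · rintro ⟨t, ht, rfl⟩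
      exact pow_lt_pow_left₀ ht hx two_ne_zero
    · intro hw
      exact ⟨Real.sqrt w, Real.lt_sqrt_of_sq_lt hw, Real.sq_sqrt ((sq_nonneg x).trans hw.le)⟩
  have h := integral_image_eq_integral_abs_deriv_smul (s := Set.Ioi x) (f := fun t : ℝ => t ^ 2)
    (f' := fun t => 2 * t) measurableSet_Ioi
    (fun t _ => by simpa using (hasDerivAt_pow 2 t).hasDerivWithinAt)
    (fun a ha b hb hab => by
      have := abs_eq_abs.mpr (sq_eq_sq_iff_eq_or_eq_neg.mp hab)
      rwa [abs_of_pos (hx.trans_lt ha), abs_of_pos (hx.trans_lt hb)] at this)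
    (fun u => u ^ (-(1 / 2) : ℝ) * Real.exp (-Real.pi * u))
  rw [him] at h
  rw [beta, h, ← integral_const_mul]
  refine setIntegral_congr_fun measurableSet_Ioi fun t ht => ?_
  have ht0 : 0 < t := hx.trans_lt ht
  have h1 : (t ^ 2) ^ (-(1 / 2) : ℝ) = t⁻¹ := by
    rw [Real.rpow_neg (sq_nonneg t), ← Real.sqrt_eq_rpow, Real.sqrt_sq ht0.le]
  simp only [smul_eq_mul]
  rw [h1, abs_of_pos (by linarith : 0 < 2 * t)]
  field_simp

/-- `2 ∫₀ˣ e^{-πt²} dt`. -/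
def erfPi (x : ℝ) : ℝ := 2 * ∫ t in (0 : ℝ)..x, Real.exp (-Real.pi * t ^ 2)

lemma hasDerivAt_erfPi (x : ℝ) : HasDerivAt erfPi (2 * Real.exp (-Real.pi * x ^ 2)) x := by
  have hc : Continuous fun t : ℝ => Real.exp (-Real.pi * t ^ 2) := by fun_prop
  exact (intervalIntegral.integral_hasDerivAt_right (hc.intervalIntegrable _ _)
    (hc.stronglyMeasurableAtFilter _ _) hc.continuousAt).const_mul 2

lemma erfPi_neg (x : ℝ) : erfPi (-x) = -erfPi x := by
  have h := intervalIntegral.integral_comp_neg (a := 0) (b := x)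
    (fun t : ℝ => Real.exp (-Real.pi * t ^ 2))
  simp only [neg_sq, neg_zero] at h
  rw [erfPi, erfPi, h, intervalIntegral.integral_symm]
  ring

lemma erfPi_of_nonneg {x : ℝ} (hx : 0 ≤ x) : erfPi x = 1 - beta (x ^ 2) := by
  have h := intervalIntegral.integral_interval_add_Ioi (integrableOn_gaussian 0)
    (integrableOn_gaussian x)
  rw [integral_gaussian_Ioi_zero] at h
  rw [erfPi, beta_sq hx]
  linarith

/-- The factor `1 - β` smooths out the jump of the sign: the product is an odd error function, which
can be differentiated in the vector `c`. -/
lemma sign_mul_one_sub_beta (x : ℝ) : Real.sign x * (1 - beta (x ^ 2)) = erfPi x := by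
  rcases lt_trichotomy x 0 with h | h | h
  · rw [Real.sign_of_neg h, ← neg_neg x, erfPi_neg, erfPi_of_nonneg (by linarith), neg_neg, neg_sq]
    ring
  · simp [h, erfPi]
  · rw [Real.sign_of_pos h, erfPi_of_nonneg h.le, one_mul]

lemma beta_nonneg {x : ℝ} (hx : 0 ≤ x) : 0 ≤ beta x := by
  rw [← Real.sq_sqrt hx, beta_sq (Real.sqrt_nonneg x)]
  have := integral_nonneg (μ := volume.restrict (Set.Ioi (Real.sqrt x)))
    (f := fun t : ℝ => Real.exp (-Real.pi * t ^ 2)) fun t => (Real.exp_pos _).le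
  positivity

/-- Translate the Gaussian tail to `t > 0` and use `(t + r)² ≥ t² + r²` for `t, r ≥ 0`. -/
lemma beta_le {x : ℝ} (hx : 0 ≤ x) : beta x ≤ Real.exp (-Real.pi * x) := by
  rw [← Real.sq_sqrt hx, beta_sq (Real.sqrt_nonneg x)]
  set r := Real.sqrt x with hr
  have hr0 : 0 ≤ r := Real.sqrt_nonneg x
  have himg : (fun t : ℝ => t + r) '' Set.Ioi 0 = Set.Ioi r := by simp
  have h := integral_image_eq_integral_abs_deriv_smul (s := Set.Ioi (0 : ℝ))
    (f := fun t : ℝ => t + r) (f' := fun t => 1) measurableSet_Ioi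
    (fun t _ => ((hasDerivAt_id t).add_const r).hasDerivWithinAt)
    (fun a _ b _ hab => by simpa using hab) (fun t => Real.exp (-Real.pi * t ^ 2))
  rw [himg] at h
  have h2 : ∫ t in Set.Ioi (0 : ℝ), |(1 : ℝ)| • Real.exp (-Real.pi * (t + r) ^ 2) ≤
      ∫ t in Set.Ioi (0 : ℝ), Real.exp (-Real.pi * r ^ 2) * Real.exp (-Real.pi * t ^ 2) := by
    refine setIntegral_mono_on ?_ ((integrableOn_gaussian 0).const_mul _) measurableSet_Ioi
      fun t ht => ?_
    · simp only [abs_one, one_smul]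
      exact ((integrable_exp_neg_mul_sq Real.pi_pos).comp_add_right r).integrableOn
    · rw [abs_one, one_smul, ← Real.exp_add]
      apply Real.exp_le_exp.mpr
      have : 0 ≤ Real.pi * (t * r) := mul_nonneg Real.pi_pos.le (mul_nonneg (le_of_lt ht) hr0)
      nlinarith
  rw [integral_const_mul, integral_gaussian_Ioi_zero] at h2
  rw [h]
  exact (mul_le_mul_of_nonneg_left h2 zero_le_two).trans_eq (by ring)

/-! ### The data of the indefinite theta functions in coordinates -/

lemma bilin_c₁ (ν : Fin 2 → ℝ) : bilin A₀ ν c₁ = ν 0 := by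
  simp [bilin, A₀, c₁, Matrix.mulVec, dotProduct, Fin.sum_univ_two]; ring

lemma bilin_c₂ (ν : Fin 2 → ℝ) : bilin A₀ ν c₂ = -2 * ν 1 := by
  simp [bilin, A₀, c₂, Matrix.mulVec, dotProduct, Fin.sum_univ_two]; ring

lemma bilin_b₀ (ν : Fin 2 → ℝ) : bilin A₀ ν b₀ = ν 0 / 2 + ν 1 := by
  simp [bilin, A₀, b₀, Matrix.mulVec, dotProduct, Fin.sum_univ_two]; ring

lemma quad_A₀ (ν : Fin 2 → ℝ) : quad A₀ ν = ν 0 ^ 2 / 2 + 2 * ν 0 * ν 1 + ν 1 ^ 2 := by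
  simp [quad, bilin, A₀, Matrix.mulVec, dotProduct, Fin.sum_univ_two]; ring

lemma quad_c₁ : quad A₀ c₁ = -(1 / 2) := by
  rw [quad_A₀]; norm_num [c₁]

lemma quad_c₂ : quad A₀ c₂ = -1 := by
  rw [quad_A₀]; norm_num [c₂]

/-- The point `(n₁ + 1/2, n₂ - l/2)` of the coset. -/
def pt (l : ℤ) (p : ℤ × ℤ) : Fin 2 → ℝ := ![p.1 + 1 / 2, p.2 + -(l / 2)]

lemma shift_a₀ (l : ℤ) (n : Fin 2 → ℤ) : shift (a₀ l) n = pt l (finTwoArrowEquiv ℤ n) := by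
  funext i
  fin_cases i <;> simp [shift, a₀, pt, finTwoArrowEquiv] <;> ring

lemma rho_eq (ν : Fin 2 → ℝ) (τ : ℍ) : rho A₀ c₁ c₂ ν τ =
    erfPi (Real.sqrt (2 * τ.im) * ν 0) + erfPi (2 * Real.sqrt τ.im * ν 1) := by
  have hy := τ.im_pos
  have hs : ∀ {r : ℝ} (x : ℝ), 0 < r → Real.sign (r * x) = Real.sign x := by
    intro r x hr
    rcases lt_trichotomy x 0 with h | h | h
    · rw [Real.sign_of_neg h, Real.sign_of_neg (mul_neg_of_pos_of_neg hr h)]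
    · simp [h]
    · rw [Real.sign_of_pos h, Real.sign_of_pos (mul_pos hr h)]
  have h1 : (Real.sqrt (2 * τ.im) * ν 0) ^ 2 = -(ν 0 ^ 2 / -(1 / 2)) * τ.im := by
    rw [mul_pow, Real.sq_sqrt (by positivity)]; ring
  have h2 : (2 * Real.sqrt τ.im * ν 1) ^ 2 = -((-2 * ν 1) ^ 2 / -1) * τ.im := by
    rw [mul_pow, mul_pow, Real.sq_sqrt hy.le]; ring
  have h3 : Real.sign (-2 * ν 1) = -Real.sign (ν 1) := by
    rw [neg_mul, Real.sign_neg, hs _ two_pos]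
  rw [rho, bilin_c₁, bilin_c₂, quad_c₁, quad_c₂, ← sign_mul_one_sub_beta, ← sign_mul_one_sub_beta,
    hs _ (Real.sqrt_pos.mpr (by positivity)), hs _ (mul_pos two_pos (Real.sqrt_pos.mpr hy)),
    h1, h2, h3]
  ring

lemma betaTerm_c₁ (ν : Fin 2 → ℝ) (τ : ℍ) :
    betaTerm A₀ c₁ ν τ = Real.sign (ν 0) * beta (2 * ν 0 ^ 2 * τ.im) := by
  rw [betaTerm, bilin_c₁, quad_c₁]; congr 2; ring

lemma betaTerm_c₂ (ν : Fin 2 → ℝ) (τ : ℍ) :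
    betaTerm A₀ c₂ ν τ = Real.sign (-2 * ν 1) * beta (4 * ν 1 ^ 2 * τ.im) := by
  rw [betaTerm, bilin_c₂, quad_c₂]; congr 2; ring

lemma qTerm_eq (ν : Fin 2 → ℝ) (τ : ℍ) : qTerm A₀ b₀ ν τ =
    cexp (2 * Real.pi * I * (ν 0 / 2 + ν 1) +
      2 * Real.pi * I * (ν 0 ^ 2 / 2 + 2 * ν 0 * ν 1 + ν 1 ^ 2) * τ) := by
  rw [qTerm, bilin_b₀, quad_A₀]; push_cast; rfl

lemma norm_qTerm (ν : Fin 2 → ℝ) (τ : ℍ) : ‖qTerm A₀ b₀ ν τ‖ =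
    Real.exp (-2 * Real.pi * τ.im * (ν 0 ^ 2 / 2 + 2 * ν 0 * ν 1 + ν 1 ^ 2)) := by
  rw [qTerm_eq, add_comm]
  have := norm_exp_add_I_mul_real (2 * Real.pi * I * (ν 0 ^ 2 / 2 + 2 * ν 0 * ν 1 + ν 1 ^ 2) * τ)
    (2 * Real.pi * (ν 0 / 2 + ν 1))
  rw [show (2 * Real.pi * I * (ν 0 / 2 + ν 1) : ℂ) =
    ((2 * Real.pi * (ν 0 / 2 + ν 1) : ℝ) : ℂ) * I by push_cast; ring, this, Complex.norm_exp]
  congr 1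
  rw [show (2 * Real.pi * I * (ν 0 ^ 2 / 2 + 2 * ν 0 * ν 1 + ν 1 ^ 2) * τ : ℂ) =
    ((2 * Real.pi * (ν 0 ^ 2 / 2 + 2 * ν 0 * ν 1 + ν 1 ^ 2) : ℝ) : ℂ) * τ * I by push_cast; ring,
    mul_I_re, im_ofReal_mul, UpperHalfPlane.coe_im]
  ring

/-! ### `ϑ^ℓ` as an integral of theta kernels -/

/-- The weight of the kernel in the integral representation. -/
def kerW (s : ℝ) : ℝ := 2 / (kerP s * Real.sqrt (kerP s))

lemma continuousOn_kerW : ContinuousOn kerW (Set.Icc 1 2) := by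
  unfold kerW
  refine ContinuousOn.div continuousOn_const ?_ fun s hs => ?_
  · unfold kerP; fun_prop
  · have := kerP_pos hs; positivity

lemma kerW_bound {s : ℝ} (hs : s ∈ Set.Icc (1 : ℝ) 2) : |kerW s| ≤ 8 := by
  have hp := kerP_pos hs
  have h := (kerP_mem hs).1
  have h2 : 1 / 2 ≤ Real.sqrt (kerP s) := Real.le_sqrt_of_sq_le (by linarith)
  rw [abs_of_pos (by unfold kerW; positivity), kerW, div_le_iff₀ (by positivity)]
  nlinarith

lemma continuousOn_kernelTerm (l : ℤ) (τ : ℂ) (p : ℤ × ℤ) :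
    ContinuousOn (fun s => kernelTerm l τ s p) (Set.Icc 1 2) := by
  have hc : ContinuousOn (fun s => (kerP s : ℂ)) (Set.Icc 1 2) := by
    unfold kerP; fun_prop
  have h0 : ∀ s ∈ Set.Icc (1 : ℝ) 2, (kerP s : ℂ) ≠ 0 := fun s hs =>
    ofReal_ne_zero.mpr (kerP_pos hs).ne'
  have hA : ContinuousOn (fun s => kerA τ s) (Set.Icc 1 2) :=
    ContinuousOn.div (by fun_prop) hc h0
  have hB : ContinuousOn (fun s => kerB τ s) (Set.Icc 1 2) :=
    ContinuousOn.div (by fun_prop) hc h0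
  have hD : ContinuousOn (fun s => kerD τ s) (Set.Icc 1 2) :=
    ContinuousOn.div (by fun_prop) hc h0
  unfold kernelTerm binTerm
  fun_prop

/-- A summable bound for the theta kernel, uniform in `s`. -/
def kernelBound (l : ℤ) (y : ℝ) (p : ℤ × ℤ) : ℝ :=
  16 * ((1 + |(p.1 : ℝ) + 1 / 2|) * (1 + |(p.2 : ℝ) + -(l / 2)|)) *
    Real.exp (-(Real.pi * (y / 15)) * ((p.1 + 1 / 2) ^ 2 + (p.2 + -(l / 2)) ^ 2))

lemma summable_kernelBound (l : ℤ) {y : ℝ} (hy : 0 < y) : Summable (kernelBound l y) := by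
  refine summable_of_le_linear_gaussian (ε := Real.pi * (y / 15)) (C := 16)
    (by positivity) (1 / 2) (-(l / 2)) fun p => ?_
  rw [Real.norm_of_nonneg (by unfold kernelBound; positivity), kernelBound]

lemma norm_kernelTerm_le (l : ℤ) {τ : ℂ} (hτ : 0 < τ.im) {s : ℝ} (hs : s ∈ Set.Icc (1 : ℝ) 2)
    (p : ℤ × ℤ) : ‖kerW s * kernelTerm l τ s p‖ ≤ kernelBound l τ.im p := by
  set u : ℝ := p.1 + 1 / 2 with hu
  set v : ℝ := p.2 + -(l / 2) with hv
  have eu : ((p.1 : ℂ) + ((1 / 2 : ℝ) : ℂ)) = (u : ℂ) := by rw [hu]; push_cast; rfl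
  have ev : ((p.2 : ℂ) + ((-(l / 2) : ℝ) : ℂ)) = (v : ℂ) := by rw [hv]; push_cast; rfl
  rw [kernelTerm, binTerm, eu, ev, norm_mul, norm_mul, norm_real, Real.norm_eq_abs, kernelBound,
    ← mul_assoc]
  refine mul_le_mul ?_ ?_ (norm_nonneg _) (by positivity)
  · have h1 : ‖(1 * u + s * v : ℂ)‖ ≤ |u| + 2 * |v| := by
      refine (norm_add_le _ _).trans ?_
      rw [norm_mul, norm_mul, norm_real, norm_real, norm_real, norm_one, one_mul,
        Real.norm_eq_abs, Real.norm_eq_abs, Real.norm_eq_abs,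
        abs_of_pos (show (0 : ℝ) < s by linarith [hs.1])]
      nlinarith [abs_nonneg v, hs.2]
    have h2 := kerW_bound hs
    calc _ ≤ 8 * (|u| + 2 * |v|) := mul_le_mul h2 h1 (norm_nonneg _) (by norm_num)
      _ ≤ _ := by nlinarith [abs_nonneg u, abs_nonneg v, mul_nonneg (abs_nonneg u) (abs_nonneg v)]
  · have := norm_exp_add_I_mul_real (Real.pi * I * (kerA τ s * u ^ 2 + 2 * kerB τ s * u * v +
      kerD τ s * v ^ 2)) (2 * Real.pi * (u * (1 / 2) + v * 1))
    rw [show (2 * Real.pi * I * (u * ((1 / 2 : ℝ) : ℂ) + v * ((1 : ℝ) : ℂ)) : ℂ) =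
      ((2 * Real.pi * (u * (1 / 2) + v * 1) : ℝ) : ℂ) * I by push_cast; ring, this,
      Complex.norm_exp]
    apply Real.exp_le_exp.mpr
    rw [show (Real.pi * I * (kerA τ s * u ^ 2 + 2 * kerB τ s * u * v + kerD τ s * v ^ 2) : ℂ) =
      (((Real.pi * u ^ 2 : ℝ) : ℂ) * kerA τ s + ((Real.pi * (2 * u * v) : ℝ) : ℂ) * kerB τ s +
        ((Real.pi * v ^ 2 : ℝ) : ℂ) * kerD τ s) * I by push_cast; ring, mul_I_re, add_im, add_im,
      im_ofReal_mul, im_ofReal_mul, im_ofReal_mul]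
    rw [← hu, ← hv]
    have := mul_le_mul_of_nonneg_left (kernel_im_lower hτ hs u v) Real.pi_pos.le
    linarith

lemma summable_kernelTerm (l : ℤ) {τ : ℂ} (hτ : 0 < τ.im) {s : ℝ} (hs : s ∈ Set.Icc (1 : ℝ) 2) :
    Summable fun p => kernelTerm l τ s p :=
  (kernel_imPosDef hτ hs).summable_binTerm _ _ _ _ _ _

lemma continuousOn_kernel (l : ℤ) {τ : ℂ} (hτ : 0 < τ.im) :
    ContinuousOn (fun s => ∑' p, kerW s * kernelTerm l τ s p) (Set.Icc 1 2) :=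
  continuousOn_tsum (fun p => (continuous_ofReal.comp_continuousOn continuousOn_kerW).mul
    (continuousOn_kernelTerm l τ p)) (summable_kernelBound l hτ)
    fun p _ hs => norm_kernelTerm_le l hτ hs p

/-- `φ s` is a multiple of `B(ν, c(s)) / √(-Q(c(s)))`, and `-erfPi (φ s)` takes at `s = 1, 2` the
values that make up `ρ`. Its derivative is the linear form `u + sv` times `e^{-πφ²}`, and this
Gaussian changes `q^Q` into the kernel exponential. -/
lemma rho_mul_qTerm (l : ℤ) (τ : ℍ) (p : ℤ × ℤ) :
    (rho A₀ c₁ c₂ (pt l p) τ : ℂ) * qTerm A₀ b₀ (pt l p) τ =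
      ∫ s in (1 : ℝ)..2, Real.sqrt τ.im * (kerW s * kernelTerm l τ s p) := by
  have hy := τ.im_pos
  rw [rho_eq, qTerm_eq]
  set u : ℝ := p.1 + 1 / 2 with hu
  set v : ℝ := p.2 + -(l / 2) with hv
  have e0 : pt l p 0 = u := rfl
  have e1 : pt l p 1 = v := rfl
  have eu : ((p.1 : ℂ) + ((1 / 2 : ℝ) : ℂ)) = (u : ℂ) := by rw [hu]; push_cast; rfl
  have ev : ((p.2 : ℂ) + ((-(l / 2) : ℝ) : ℂ)) = (v : ℂ) := by rw [hv]; push_cast; rfl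
  rw [e0, e1]
  set N : ℝ → ℝ := fun s => (2 - s) * u + 2 * (1 - s) * v with hN
  set y := τ.im with hydef
  set φ : ℝ → ℝ := fun s => Real.sqrt y * (N s / Real.sqrt (kerP s)) with hφ
  have hder : ∀ s ∈ Set.uIcc (1 : ℝ) 2, HasDerivAt (fun s => -erfPi (φ s))
      (Real.sqrt y * (kerW s * ((u + s * v) * Real.exp (-Real.pi * φ s ^ 2)))) s := by
    intro s hs
    rw [Set.uIcc_of_le (by norm_num)] at hs
    have hp := kerP_pos hs
    have hsq : Real.sqrt (kerP s) ≠ 0 := (Real.sqrt_pos.mpr hp).ne'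
    have d1 : HasDerivAt N (-u - 2 * v) s := by
      have : HasDerivAt N ((0 - 1) * u + (2 * (0 - 1)) * v) s :=
        (((hasDerivAt_const s (2 : ℝ)).sub (hasDerivAt_id s)).mul_const u).add
          ((((hasDerivAt_const s (1 : ℝ)).sub (hasDerivAt_id s)).const_mul 2).mul_const v)
      convert this using 1; ring
    have d2 : HasDerivAt kerP (2 - s) s := by
      have : HasDerivAt kerP (2 * 1 - 0 - (2 * s ^ 1 * 1) / 2) s := by
        unfold kerP
        exact (((hasDerivAt_id s).const_mul 2).sub (hasDerivAt_const s 1)).sub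
          (((hasDerivAt_id s).pow 2).div_const 2)
      convert this using 1; ring
    have d3 := ((d1.div (d2.sqrt hp.ne') hsq).const_mul (Real.sqrt y))
    have d4 := ((hasDerivAt_erfPi (φ s)).comp s d3).neg
    refine d4.congr_deriv ?_
    rw [kerW]
    have hpp : kerP s = Real.sqrt (kerP s) ^ 2 := (Real.sq_sqrt hp.le).symm
    -- The numerator of `(N/√P)'` is `N'P - NP'/2`. It loses its quadratic dependence on `s` and
    -- becomes the form orthogonal to `c(s)`.
    have key : (-u - 2 * v) * kerP s - N s * ((2 - s) / 2) = -(u + s * v) := by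
      rw [hN, kerP]; ring
    generalize Real.exp (-Real.pi * φ s ^ 2) = E
    generalize hr : Real.sqrt (kerP s) = r at *
    rw [hpp] at key ⊢
    have hr0 := hsq
    field_simp
    linear_combination (-2 * E) * key
  have hcont : ContinuousOn (fun s => Real.sqrt y * (kerW s * ((u + s * v) *
      Real.exp (-Real.pi * φ s ^ 2)))) (Set.uIcc 1 2) := by
    rw [Set.uIcc_of_le (by norm_num)]
    have h1 : ContinuousOn φ (Set.Icc 1 2) := by
      refine continuousOn_const.mul (ContinuousOn.div (by rw [hN]; fun_prop)
        (by unfold kerP; fun_prop) fun s hs => (Real.sqrt_pos.mpr (kerP_pos hs)).ne')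
    have h2 := continuousOn_kerW
    fun_prop
  have hInt := intervalIntegral.integral_eq_sub_of_hasDerivAt hder hcont.intervalIntegrable
  have hend : -erfPi (φ 2) - -erfPi (φ 1) =
      erfPi (Real.sqrt (2 * y) * u) + erfPi (2 * Real.sqrt y * v) := by
    have h1 : φ 1 = Real.sqrt (2 * y) * u := by
      have : kerP 1 = 2⁻¹ := by rw [kerP]; norm_num
      simp only [hφ, hN, this]
      rw [Real.sqrt_mul (by norm_num), Real.sqrt_inv]
      field_simp; ring
    have h2 : φ 2 = -(2 * Real.sqrt y * v) := by
      have : kerP 2 = 1 := by rw [kerP]; norm_num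
      simp only [hφ, hN, this, Real.sqrt_one]
      ring
    rw [h1, h2, erfPi_neg]; ring
  rw [← hend, ← hInt, ← intervalIntegral.integral_ofReal, ← intervalIntegral.integral_mul_const]
  refine intervalIntegral.integral_congr fun s hs => ?_
  rw [Set.uIcc_of_le (by norm_num)] at hs
  have hp := kerP_pos hs
  have hpc : (kerP s : ℂ) ≠ 0 := ofReal_ne_zero.mpr hp.ne'
  rw [kernelTerm, binTerm, eu, ev]
  push_cast
  rw [mul_assoc, mul_assoc, mul_assoc (u + s * v : ℂ), ← Complex.exp_add, one_mul]
  congr 4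
  have h3 : (φ s : ℂ) ^ 2 = y * ((N s : ℂ) ^ 2 / kerP s) := by
    rw [← ofReal_pow, hφ]; simp only
    rw [mul_pow, div_pow, Real.sq_sqrt hy.le, Real.sq_sqrt hp.le]; push_cast; rfl
  -- Writing `τ̄ = τ - 2iy` splits the kernel exponent into `τ(X² - ψ²) = 2τQ` and the Gaussian part
  -- `2iyψ²`, which is `iφ²`.
  have h4 : (starRingEnd ℂ) (τ : ℂ) = τ - 2 * I * y := by
    have := Complex.sub_conj (τ : ℂ)
    rw [UpperHalfPlane.coe_im] at this
    push_cast at this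
    linear_combination -this
  rw [h3, kerA, kerB, kerD, h4, hN]
  field_simp
  rw [kerP]
  push_cast
  ring_nf
  rw [I_sq]
  ring

/-- `kernelBound` does not depend on `s`, so dominated convergence exchanges the lattice sum with
the integral over the segment. -/
theorem hasSum_rho (l : ℤ) (τ : ℍ) : HasSum (fun p : ℤ × ℤ =>
    (rho A₀ c₁ c₂ (pt l p) τ : ℂ) * qTerm A₀ b₀ (pt l p) τ)
      (Real.sqrt τ.im * ∫ s in (1 : ℝ)..2, kerW s * ∑' p, kernelTerm l τ s p) := by
  have hτ : 0 < (τ : ℂ).im := τ.im_pos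
  simp_rw [rho_mul_qTerm, intervalIntegral.integral_const_mul]
  refine HasSum.mul_left _ ?_
  refine intervalIntegral.hasSum_integral_of_dominated_convergence
    (fun p _ => kernelBound l τ.im p) (fun p => ?_) (fun p => ?_) ?_ ?_ ?_
  · rw [Set.uIoc_of_le (by norm_num)]
    exact (((continuous_ofReal.comp_continuousOn continuousOn_kerW).mul
      (continuousOn_kernelTerm l τ p)).mono Set.Ioc_subset_Icc_self).aestronglyMeasurable
      measurableSet_Ioc
  · refine Filter.Eventually.of_forall fun s hs => ?_
    rw [Set.uIoc_of_le (by norm_num)] at hs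
    exact norm_kernelTerm_le l hτ (Set.Ioc_subset_Icc_self hs) p
  · exact Filter.Eventually.of_forall fun _ _ => summable_kernelBound l τ.im_pos
  · exact intervalIntegrable_const
  · refine Filter.Eventually.of_forall fun s hs => ?_
    rw [Set.uIoc_of_le (by norm_num)] at hs
    exact (summable_kernelTerm l hτ (Set.Ioc_subset_Icc_self hs)).hasSum.mul_left _

lemma vartheta_eq_tsum (l : ℤ) (τ : ℍ) : vartheta l τ = ∑' p : ℤ × ℤ,
    (rho A₀ c₁ c₂ (pt l p) τ : ℂ) * qTerm A₀ b₀ (pt l p) τ := by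
  rw [vartheta, indefTheta, ← (finTwoArrowEquiv ℤ).tsum_eq]
  exact tsum_congr fun n => by rw [shift_a₀]

lemma vartheta_eq_integral (l : ℤ) (τ : ℍ) : vartheta l τ =
    Real.sqrt τ.im * ∫ s in (1 : ℝ)..2, kerW s * ∑' p, kernelTerm l τ s p := by
  rw [vartheta_eq_tsum, (hasSum_rho l τ).tsum_eq]

/-- The behaviour of `ϑ^ℓ` under `τ ↦ -1/τ`. -/
theorem vartheta_inversion (l : ℤ) (τ : ℍ) : vartheta l τ = I / (Real.sqrt 2 * τ) *
    (vartheta 0 (ModularGroup.S • τ) + (-1) ^ l * vartheta 1 (ModularGroup.S • τ)) := by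
  have hτ : 0 < (τ : ℂ).im := τ.im_pos
  have hτ0 : (τ : ℂ) ≠ 0 := τ.ne_zero
  have hn : 0 < ‖(τ : ℂ)‖ := norm_pos_iff.mpr hτ0
  have hc : ((ModularGroup.S • τ : ℍ) : ℂ) = -1 / τ := by
    rw [UpperHalfPlane.modular_S_smul]; simp [neg_div]
  have him : (ModularGroup.S • τ : ℍ).im = τ.im / ‖(τ : ℂ)‖ ^ 2 := by
    rw [UpperHalfPlane.modular_S_smul, UpperHalfPlane.im, ]
    simp [normSq_eq_norm_sq, neg_div, inv_im]
  have him' : 0 < (-1 / (τ : ℂ)).im := hc ▸ (ModularGroup.S • τ : ℍ).im_pos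
  have hii : ∀ l, IntervalIntegrable (fun s => kerW s * ∑' p, kernelTerm l (-1 / τ) s p)
      volume 1 2 := by
    intro l
    refine ContinuousOn.intervalIntegrable ?_
    rw [Set.uIcc_of_le (by norm_num)]
    refine (continuousOn_kernel l him').congr fun s _ => ?_
    simp only [tsum_mul_left]
  rw [vartheta_eq_integral, vartheta_eq_integral, vartheta_eq_integral, hc, him,
    Real.sqrt_div' _ (by positivity), Real.sqrt_sq hn.le]
  -- Since `√Im(-1/τ) = √y / |τ|`, the `|τ|` produced by the kernel inversion is absorbed and only
  -- `I / (√2 τ)` is left.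
  have key : ((Real.sqrt 2 * ‖(τ : ℂ)‖ : ℝ) : ℂ) *
      ∫ s in (1 : ℝ)..2, kerW s * ∑' p, kernelTerm l τ s p =
      I / τ * ((∫ s in (1 : ℝ)..2, kerW s * ∑' p, kernelTerm 0 (-1 / τ) s p) +
        (-1) ^ l * ∫ s in (1 : ℝ)..2, kerW s * ∑' p, kernelTerm 1 (-1 / τ) s p) := by
    rw [← intervalIntegral.integral_const_mul, ← intervalIntegral.integral_const_mul,
      ← intervalIntegral.integral_add (hii 0) ((hii 1).const_mul _),
      ← intervalIntegral.integral_const_mul]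
    refine intervalIntegral.integral_congr fun s hs => ?_
    rw [Set.uIcc_of_le (by norm_num)] at hs
    rw [mul_left_comm, kernel_inversion l hτ hs]
    ring
  have h2 : ((Real.sqrt 2 : ℝ) : ℂ) ≠ 0 := ofReal_ne_zero.mpr (by positivity)
  have hnc : ((‖(τ : ℂ)‖ : ℝ) : ℂ) ≠ 0 := ofReal_ne_zero.mpr hn.ne'
  rw [ofReal_mul] at key
  have key2 : ∫ s in (1 : ℝ)..2, kerW s * ∑' p, kernelTerm l τ s p = I / τ *
      ((∫ s in (1 : ℝ)..2, kerW s * ∑' p, kernelTerm 0 (-1 / τ) s p) +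
        (-1) ^ l * ∫ s in (1 : ℝ)..2, kerW s * ∑' p, kernelTerm 1 (-1 / τ) s p) /
        (Real.sqrt 2 * ‖(τ : ℂ)‖) := by
    rw [eq_div_iff (mul_ne_zero h2 hnc), ← key]; ring
  rw [key2]
  push_cast
  field_simp

/-! ### Vanishing of inner theta sums -/

/-- The map is `ν₀ ↦ -ν₀ - 4ν₁`. It preserves `Q = (ν₀ + 2ν₁)²/2 - ν₁²` and changes `e^{πiν₀}` by
`e^{πi}` to an odd power, because `2ν₀` is odd and `4ν₁` is even. -/
lemma qTerm_reflect (l m n : ℤ) (τ : ℍ) :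
    qTerm A₀ b₀ (pt l (-1 - 2 * (2 * n - l) - m, n)) τ = -qTerm A₀ b₀ (pt l (m, n)) τ := by
  have h1 : ∀ z : ℂ, -cexp z = cexp (z + Real.pi * I) := fun z => by
    rw [Complex.exp_add, exp_pi_mul_I]; ring
  rw [qTerm_eq, qTerm_eq, h1, Complex.exp_eq_exp_iff_exists_int]
  refine ⟨-1 - m - (2 * n - l), ?_⟩
  simp only [pt, Matrix.cons_val_zero, Matrix.cons_val_one]
  push_cast
  ring

lemma tsum_qTerm_fst (l n : ℤ) (τ : ℍ) : ∑' m : ℤ, qTerm A₀ b₀ (pt l (m, n)) τ = 0 := by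
  have h := (Equiv.subLeft (-1 - 2 * (2 * n - l))).tsum_eq
    (fun m : ℤ => qTerm A₀ b₀ (pt l (m, n)) τ)
  simp only [Equiv.subLeft_apply, qTerm_reflect, tsum_neg] at h
  exact self_eq_neg.mp h.symm

/-- A summable lattice sum whose coefficients only depend on the second coordinate vanishes. -/
lemma tsum_snd_mul_qTerm {l : ℤ} {τ : ℍ} (c : ℤ → ℂ)
    (h : Summable fun p : ℤ × ℤ => c p.2 * qTerm A₀ b₀ (pt l p) τ) :
    ∑' p : ℤ × ℤ, c p.2 * qTerm A₀ b₀ (pt l p) τ = 0 := by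
  rw [h.tsum_prod]
  rw [← Summable.tsum_comm (f := fun m n => c n * qTerm A₀ b₀ (pt l (m, n)) τ) h]
  simp [tsum_mul_left, tsum_qTerm_fst]

/-! ### Absolute convergence -/

lemma abs_sign_le (x : ℝ) : |Real.sign x| ≤ 1 := by
  rcases Real.sign_apply_eq x with h | h | h <;> simp [h]

lemma exp_bound_of_posDef {y ε Q u v : ℝ} (hy : 0 < y) (h : ε * (u ^ 2 + v ^ 2) ≤ Q) :
    Real.exp (-2 * Real.pi * y * Q) ≤ Real.exp (-(2 * Real.pi * y * ε) * (u ^ 2 + v ^ 2)) := by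
  apply Real.exp_le_exp.mpr
  have := mul_le_mul_of_nonneg_left h (show 0 ≤ 2 * Real.pi * y by positivity)
  nlinarith

/-- The decay of `β` adds `ν₀²` to `Q`, which is enough to make the indefinite form positive
definite; at `c₂` the added term is `2ν₁²`. -/
lemma norm_betaTerm_c₁_le (ν : Fin 2 → ℝ) (τ : ℍ) :
    ‖(betaTerm A₀ c₁ ν τ : ℂ) * qTerm A₀ b₀ ν τ‖ ≤
      Real.exp (-2 * Real.pi * τ.im * (3 / 2 * ν 0 ^ 2 + 2 * ν 0 * ν 1 + ν 1 ^ 2)) := by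
  have hy := τ.im_pos
  have hx : 0 ≤ 2 * ν 0 ^ 2 * τ.im := by positivity
  rw [norm_mul, norm_qTerm, norm_real, betaTerm_c₁, norm_mul, Real.norm_eq_abs,
    Real.norm_of_nonneg (beta_nonneg hx)]
  calc _ ≤ (1 * Real.exp (-Real.pi * (2 * ν 0 ^ 2 * τ.im))) * _ := by
        gcongr
        · exact beta_nonneg hx
        · exact abs_sign_le _
        · exact beta_le hx
    _ = _ := by rw [one_mul, ← Real.exp_add]; congr 1; ring

lemma norm_betaTerm_c₂_le (ν : Fin 2 → ℝ) (τ : ℍ) :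
    ‖(betaTerm A₀ c₂ ν τ : ℂ) * qTerm A₀ b₀ ν τ‖ ≤
      Real.exp (-2 * Real.pi * τ.im * (1 / 2 * ν 0 ^ 2 + 2 * ν 0 * ν 1 + 3 * ν 1 ^ 2)) := by
  have hy := τ.im_pos
  have hx : 0 ≤ 4 * ν 1 ^ 2 * τ.im := by positivity
  rw [norm_mul, norm_qTerm, norm_real, betaTerm_c₂, norm_mul, Real.norm_eq_abs,
    Real.norm_of_nonneg (beta_nonneg hx)]
  calc _ ≤ (1 * Real.exp (-Real.pi * (4 * ν 1 ^ 2 * τ.im))) * _ := by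
        gcongr
        · exact beta_nonneg hx
        · exact abs_sign_le _
        · exact beta_le hx
    _ = _ := by rw [one_mul, ← Real.exp_add]; congr 1; ring

lemma summable_gaussian_pt {ε : ℝ} (hε : 0 < ε) (l : ℤ) : Summable fun p : ℤ × ℤ =>
    Real.exp (-ε * (pt l p 0 ^ 2 + pt l p 1 ^ 2)) :=
  summable_gaussian_prod hε (1 / 2) (-(l / 2))

lemma summable_betaTerm_c₁ (l : ℤ) (τ : ℍ) : Summable fun p : ℤ × ℤ =>
    (betaTerm A₀ c₁ (pt l p) τ : ℂ) * qTerm A₀ b₀ (pt l p) τ := by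
  have hy := τ.im_pos
  refine Summable.of_norm_bounded (summable_gaussian_pt (l := l)
    (show 0 < 2 * Real.pi * τ.im * (1 / 6) by positivity)) fun p =>
    (norm_betaTerm_c₁_le _ _).trans (exp_bound_of_posDef hy ?_)
  nlinarith [sq_nonneg (6 / 5 * pt l p 0 + pt l p 1), sq_nonneg (pt l p 0)]

lemma summable_betaTerm_c₂ (l : ℤ) (τ : ℍ) : Summable fun p : ℤ × ℤ =>
    (betaTerm A₀ c₂ (pt l p) τ : ℂ) * qTerm A₀ b₀ (pt l p) τ := by
  have hy := τ.im_pos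
  refine Summable.of_norm_bounded (summable_gaussian_pt (l := l)
    (show 0 < 2 * Real.pi * τ.im * (1 / 10) by positivity)) fun p =>
    (norm_betaTerm_c₂_le _ _).trans (exp_bound_of_posDef hy ?_)
  nlinarith [sq_nonneg (pt l p 0 + 5 / 2 * pt l p 1), sq_nonneg (pt l p 1)]

/-- The coefficients `sgn B(ν, c₁) - sgn B(ν, c₂)`. -/
def sgnCoeff (ν : Fin 2 → ℝ) : ℝ := Real.sign (bilin A₀ ν c₁) - Real.sign (bilin A₀ ν c₂)

lemma sgnCoeff_eq (ν : Fin 2 → ℝ) : sgnCoeff ν = Real.sign (ν 0) + Real.sign (ν 1) := by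
  have h3 : Real.sign (-2 * ν 1) = -Real.sign (ν 1) := by
    rw [neg_mul, Real.sign_neg]
    rcases lt_trichotomy (ν 1) 0 with h | h | h
    · rw [Real.sign_of_neg h, Real.sign_of_neg (by linarith)]
    · simp [h]
    · rw [Real.sign_of_pos h, Real.sign_of_pos (by linarith)]
  rw [sgnCoeff, bilin_c₁, bilin_c₂, h3, sub_neg_eq_add]

lemma abs_sgnCoeff_le (ν : Fin 2 → ℝ) : |sgnCoeff ν| ≤ 2 := by
  rw [sgnCoeff_eq]
  exact (abs_add_le _ _).trans (by linarith [abs_sign_le (ν 0), abs_sign_le (ν 1)])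

/-- Opposite signs of the coordinates cancel. On what remains the cross term of `Q` is nonnegative,
so `Q ≥ ν₀²/2 + ν₁²` and the series converges. -/
lemma mul_nonneg_of_sgnCoeff_ne_zero {ν : Fin 2 → ℝ} (h : sgnCoeff ν ≠ 0) : 0 ≤ ν 0 * ν 1 := by
  by_contra hc
  push Not at hc
  apply h
  rw [sgnCoeff_eq]
  rcases mul_neg_iff.mp hc with ⟨h1, h2⟩ | ⟨h1, h2⟩
  · rw [Real.sign_of_pos h1, Real.sign_of_neg h2]; ring
  · rw [Real.sign_of_pos h2, Real.sign_of_neg h1]; ring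

lemma norm_sgnTerm_le (ν : Fin 2 → ℝ) (τ : ℍ) : ‖(sgnCoeff ν : ℂ) * qTerm A₀ b₀ ν τ‖ ≤
    2 * Real.exp (-2 * Real.pi * τ.im * (ν 0 ^ 2 / 2 + ν 1 ^ 2)) := by
  by_cases h : sgnCoeff ν = 0
  · rw [h, ofReal_zero, zero_mul, norm_zero]; positivity
  · rw [norm_mul, norm_qTerm, norm_real, Real.norm_eq_abs]
    refine mul_le_mul (abs_sgnCoeff_le ν) (Real.exp_le_exp.mpr ?_) (Real.exp_pos _).le zero_le_two
    have h1 := mul_nonneg_of_sgnCoeff_ne_zero h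
    have : 0 ≤ 2 * Real.pi * τ.im * (2 * (ν 0 * ν 1)) := by have := τ.im_pos; positivity
    nlinarith

lemma summable_sgnTerm (l : ℤ) (τ : ℍ) : Summable fun p : ℤ × ℤ =>
    (sgnCoeff (pt l p) : ℂ) * qTerm A₀ b₀ (pt l p) τ := by
  have hy := τ.im_pos
  refine Summable.of_norm_bounded ((summable_gaussian_pt (l := l)
    (show 0 < 2 * Real.pi * τ.im * (1 / 2) by positivity)).mul_left 2) fun p =>
    (norm_sgnTerm_le _ _).trans (mul_le_mul_of_nonneg_left (exp_bound_of_posDef hy ?_) zero_le_two)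
  nlinarith [sq_nonneg (pt l p 1)]

lemma rho_eq_sgnCoeff (ν : Fin 2 → ℝ) (τ : ℍ) : rho A₀ c₁ c₂ ν τ =
    sgnCoeff ν - betaTerm A₀ c₁ ν τ + betaTerm A₀ c₂ ν τ := by
  rw [rho, sgnCoeff, betaTerm, betaTerm]; ring

/-! ### The expansion of the Appell-Lerch sum -/

/-- `±1` on the two quadrants where geometric series in `ζ qⁿ` converge, and `0` elsewhere. -/
def quadrant (n m : ℤ) : ℂ := if 0 ≤ n then (if 0 ≤ m then 1 else 0) else (if 0 ≤ m then 0 else -1)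

lemma hasSum_geometric_int {w : ℂ} (hw : ‖w‖ < 1) :
    HasSum (fun m : ℤ => if 0 ≤ m then w ^ m else 0) (1 - w)⁻¹ := by
  have h := (hasSum_geometric_of_norm_lt_one hw)
  refine (Function.Injective.hasSum_iff (g := fun n : ℕ => (n : ℤ)) Nat.cast_injective
    (fun x hx => ?_)).mp (by simpa [Function.comp_def] using h)
  rw [if_neg]
  intro h0
  exact hx ⟨x.toNat, by simp [Int.toNat_of_nonneg h0]⟩

lemma hasSum_geometric_int_neg {w : ℂ} (hw : 1 < ‖w‖) :
    HasSum (fun m : ℤ => if 0 ≤ m then 0 else -w ^ m) (1 - w)⁻¹ := by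
  have hw0 : w ≠ 0 := fun h => by simp [h] at hw; linarith
  have hw' : ‖w⁻¹‖ < 1 := by rw [norm_inv]; exact inv_lt_one_of_one_lt₀ hw
  have h := ((hasSum_geometric_of_norm_lt_one hw').mul_left (-w⁻¹))
  have h1 : w ≠ 1 := fun h => by simp [h] at hw
  have e : -w⁻¹ * (1 - w⁻¹)⁻¹ = (1 - w)⁻¹ := by
    have h2 : 1 - w ≠ 0 := sub_ne_zero.mpr h1.symm
    have h3 : 1 - w⁻¹ ≠ 0 := sub_ne_zero.mpr fun h => h1 (by rw [← inv_inv w, ← h, inv_one])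
    field_simp
    ring
  rw [e] at h
  refine (Function.Injective.hasSum_iff (g := fun n : ℕ => -(n : ℤ) - 1)
    (fun a b hab => by simpa using hab) (fun x hx => ?_)).mp ?_
  · rw [if_pos]
    by_contra h0
    exact hx ⟨(-x - 1).toNat, by simp only; omega⟩
  · refine h.congr_fun fun n => ?_
    simp only [Function.comp_apply]
    rw [if_neg (by omega), zpow_sub₀ hw0, _root_.zpow_neg, zpow_one, zpow_natCast, inv_pow]
    field_simp

/-- The sum in the definition of `mu`. -/
def appell (z τ : ℂ) : ℂ :=
  ∑' n : ℤ, (-1 : ℂ) ^ n * cexp (Real.pi * I * (n * (n + 1)) * τ + 2 * Real.pi * I * n * z) /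
      (1 - cexp (2 * Real.pi * I * (z + n * τ)))

lemma theta1_sq_mul_mu (z τ : ℂ) : theta1 z τ ^ 2 * mu z τ =
    I * cexp (Real.pi * I * z) * (thetaChar (1 / 2) (1 / 2) z τ * appell z τ) := by
  have h : mu z τ = I * cexp (Real.pi * I * z) / thetaChar (1 / 2) (1 / 2) z τ * appell z τ := rfl
  rw [theta1, h]
  generalize appell z τ = a
  generalize thetaChar (1 / 2) (1 / 2) z τ = t
  -- At a zero of the theta function both sides are `0`, the left one by the square.
  rcases eq_or_ne t 0 with rfl | h
  · simp
  · field_simp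

/-- The terms of the double series obtained by expanding the denominators of `appell`. -/
def appellTerm (z τ : ℂ) (p : ℤ × ℤ) : ℂ :=
  quadrant p.1 p.2 * ((-1 : ℂ) ^ p.1 *
    cexp (Real.pi * I * (p.1 * (p.1 + 1)) * τ + 2 * Real.pi * I * p.1 * z +
      2 * Real.pi * I * p.2 * (z + p.1 * τ)))

lemma norm_cexp_two_pi_I (z : ℂ) : ‖cexp (2 * Real.pi * I * z)‖ = Real.exp (-2 * Real.pi * z.im) := by
  rw [Complex.norm_exp, show (2 * Real.pi * I * z : ℂ) = ((2 * Real.pi : ℝ) : ℂ) * z * I by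
    push_cast; ring, mul_I_re, im_ofReal_mul]
  congr 1; ring

lemma summable_exp_neg_abs {c : ℝ} (hc : 0 < c) : Summable fun m : ℤ => Real.exp (-c * |(m : ℝ)|) := by
  have h : Summable fun n : ℕ => Real.exp (-c * n) := by
    have := Real.summable_exp_nat_mul_iff.mpr (neg_lt_zero.mpr hc)
    exact this.congr fun n => by rw [mul_comm]
  apply Summable.of_nat_of_neg <;> simpa using h

/-- Only pairs with `n` and `m` on the same side occur, so the factor `q^{mn}` helps. Decay in `m`
has rate given by the distance of `Im z` to the boundary of the strip; the linear term `3y|n|` in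
the theta bound is what the quadrant of negative `n` needs. -/
lemma norm_appellTerm_le {z τ : ℂ} (hz : 0 < z.im) (hz' : z.im < τ.im) (p : ℤ × ℤ) :
    ‖appellTerm z τ p‖ ≤
      (|(p.1 : ℝ)| ^ 0 * Real.exp (-Real.pi * (τ.im * p.1 ^ 2 - 2 * (3 / 2 * τ.im) * |(p.1 : ℝ)|))) *
        Real.exp (-(2 * Real.pi * min z.im (τ.im - z.im)) * |(p.2 : ℝ)|) := by
  obtain ⟨n, m⟩ := p
  have hy : 0 < τ.im := hz.trans hz'
  have hsgn : ‖((-1 : ℂ)) ^ n‖ = 1 := by rw [norm_zpow]; simp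
  set κ := min z.im (τ.im - z.im) with hκ
  have h1 : κ ≤ z.im := min_le_left _ _
  have h2 : κ ≤ τ.im - z.im := min_le_right _ _
  have hpi := Real.pi_pos
  have hn : ‖cexp (Real.pi * I * (n * (n + 1)) * τ + 2 * Real.pi * I * n * z +
      2 * Real.pi * I * m * (z + n * τ))‖ = Real.exp (-Real.pi * (n * (n + 1) * τ.im + 2 * n * z.im
        + 2 * m * (z.im + n * τ.im))) := by
    rw [Complex.norm_exp, show (Real.pi * I * (n * (n + 1)) * τ + 2 * Real.pi * I * n * z +
      2 * Real.pi * I * m * (z + n * τ) : ℂ) = (((Real.pi * (n * (n + 1) + 2 * m * n) : ℝ) : ℂ) * τ +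
        ((Real.pi * (2 * n + 2 * m) : ℝ) : ℂ) * z) * I by push_cast; ring, mul_I_re, add_im,
      im_ofReal_mul, im_ofReal_mul]
    congr 1; ring
  rw [appellTerm, norm_mul, norm_mul, hsgn, one_mul, pow_zero, one_mul, hn, ← Real.exp_add]
  simp only
  unfold quadrant
  split_ifs with h0 h0' h0'
  · rw [norm_one, one_mul]
    apply Real.exp_le_exp.mpr
    have a1 : (0 : ℝ) ≤ n := by exact_mod_cast h0
    have a2 : (0 : ℝ) ≤ m := by exact_mod_cast h0'
    rw [abs_of_nonneg a1, abs_of_nonneg a2]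
    have : 0 ≤ Real.pi * (4 * (n * τ.im) + 2 * (n * z.im) + 2 * (m * (z.im - κ)) +
      2 * (m * n * τ.im)) := by
      have := mul_nonneg a2 (sub_nonneg.mpr h1)
      positivity
    nlinarith
  · rw [norm_zero, zero_mul]; positivity
  · rw [norm_zero, zero_mul]; positivity
  · rw [norm_neg, norm_one, one_mul]
    apply Real.exp_le_exp.mpr
    have a1 : (n : ℝ) ≤ -1 := by exact_mod_cast (by omega : n ≤ -1)
    have a2 : (m : ℝ) ≤ -1 := by exact_mod_cast (by omega : m ≤ -1)
    rw [abs_of_nonpos (by linarith), abs_of_nonpos (by linarith)]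
    have : 0 ≤ Real.pi * (2 * (-n * (τ.im - z.im)) + 2 * (-m * (τ.im - z.im - κ)) +
      2 * (-m * (-n - 1) * τ.im)) := by
      have b1 : 0 ≤ -(n : ℝ) * (τ.im - z.im) := mul_nonneg (by linarith) (by linarith)
      have b2 : 0 ≤ -(m : ℝ) * (τ.im - z.im - κ) := mul_nonneg (by linarith) (by linarith)
      have b3 : 0 ≤ -(m : ℝ) * (-n - 1) * τ.im :=
        mul_nonneg (mul_nonneg (by linarith) (by linarith)) hy.le
      positivity
    nlinarith

lemma summable_norm_appellTerm {z τ : ℂ} (hz : 0 < z.im) (hz' : z.im < τ.im) :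
    Summable fun p => ‖appellTerm z τ p‖ := by
  have hy : 0 < τ.im := hz.trans hz'
  have h1 := summable_pow_mul_jacobiTheta₂_term_bound (3 / 2 * τ.im) hy 0
  have h2 := summable_exp_neg_abs (c := 2 * Real.pi * min z.im (τ.im - z.im))
    (mul_pos (by positivity) (lt_min hz (by linarith)))
  have h3 := h1.mul_of_nonneg h2 (fun _ => by positivity) (fun _ => (Real.exp_pos _).le)
  refine Summable.of_nonneg_of_le (fun _ => norm_nonneg _) (norm_appellTerm_le hz hz') (h3.congr ?_)
  intro p; push_cast; rfl

/-- In the strip `|ζqⁿ| < 1` exactly for `n ≥ 0`. For negative `n` the denominator is expanded in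
powers of the inverse, which produces the coefficient `-1` of `quadrant`. -/
lemma tsum_appellTerm {z τ : ℂ} (hz : 0 < z.im) (hz' : z.im < τ.im) :
    ∑' p, appellTerm z τ p = appell z τ := by
  rw [(summable_norm_appellTerm hz hz').of_norm.tsum_prod, appell]
  refine tsum_congr fun n => ?_
  have hy : 0 < τ.im := hz.trans hz'
  set w := cexp (2 * Real.pi * I * (z + n * τ)) with hw
  have hnw : ‖w‖ = Real.exp (-2 * Real.pi * (z.im + n * τ.im)) := by
    rw [hw, norm_cexp_two_pi_I]; simp
  have hm : ∀ m : ℤ, cexp (2 * Real.pi * I * m * (z + n * τ)) = w ^ m := fun m => by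
    rw [hw, ← Complex.exp_int_mul]; congr 1; ring
  set c := (-1 : ℂ) ^ n * cexp (Real.pi * I * (n * (n + 1)) * τ + 2 * Real.pi * I * n * z) with hc
  have e : ∀ m : ℤ, appellTerm z τ (n, m) = c * (quadrant n m * w ^ m) := fun m => by
    rw [appellTerm, Complex.exp_add, hm, hc]; ring
  simp_rw [e, tsum_mul_left]
  rw [div_eq_mul_inv]
  congr 1
  by_cases h0 : 0 ≤ n
  · have hw1 : ‖w‖ < 1 := by
      rw [hnw, Real.exp_lt_one_iff]
      have : (0 : ℝ) ≤ n := by exact_mod_cast h0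
      have : 0 < Real.pi * (z.im + n * τ.im) := by positivity
      linarith
    rw [← (hasSum_geometric_int hw1).tsum_eq]
    refine tsum_congr fun m => ?_
    simp only [quadrant, if_pos h0]; split_ifs <;> simp
  · have hw1 : 1 < ‖w‖ := by
      rw [hnw, Real.one_lt_exp_iff]
      have : (n : ℝ) ≤ -1 := by exact_mod_cast (by omega : n ≤ -1)
      have : z.im + n * τ.im < 0 := by nlinarith
      have := mul_pos_of_neg_of_neg (neg_lt_zero.mpr Real.pi_pos) this
      linarith
    rw [← (hasSum_geometric_int_neg hw1).tsum_eq]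
    refine tsum_congr fun m => ?_
    simp only [quadrant, if_neg h0]; split_ifs <;> simp

/-! ### The Fourier expansion of `θ₁² μ` -/

lemma thetaChar_eq_tsum (a b : ℝ) (z τ : ℂ) :
    thetaChar a b z τ = ∑' n, linTerm 1 0 a (z + b) τ n := by
  refine tsum_congr fun n => ?_
  rw [linTerm, zero_mul, add_zero, one_mul]
  congr 1; ring

/-- The terms of the lattice sum defining the `l`-th Fourier coefficient. -/
def fourierTerm (τ : ℍ) (l : ℤ) (p : ℤ × ℤ) : ℂ := quadrant p.2 p.1 * qTerm A₀ b₀ (pt l p) τ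

/-- `q^{l²/4} ζ^l`. -/
def fourierMode (τ : ℂ) (l : ℤ) (z : ℂ) : ℂ :=
  cexp (2 * Real.pi * I * l * z + 2 * Real.pi * I * ((l : ℂ) ^ 2 / 4) * τ)

/-- The reindexing `(l, (m, n)) ↦ (l - n - m - 1, (n, m))`. -/
def modeEquiv : ℤ × (ℤ × ℤ) ≃ ℤ × (ℤ × ℤ) where
  toFun x := (x.1 - x.2.2 - x.2.1 - 1, (x.2.2, x.2.1))
  invFun x := (x.1 + x.2.1 + x.2.2 + 1, (x.2.2, x.2.1))
  left_inv := by rintro ⟨a, b, c⟩; simp only [Prod.mk.injEq, and_true]; omega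
  right_inv := by rintro ⟨a, b, c⟩; simp only [Prod.mk.injEq, and_true]; omega

/-- `modeEquiv` is chosen so that the total exponent of `ζ`, namely `1/2 + (k + 1/2) + n + m` with
theta index `k`, equals `l`. The exponent of `q` is then `l²/4 + Q(ν)`. -/
lemma mode_term (τ : ℍ) (z : ℂ) (x : ℤ × (ℤ × ℤ)) :
    I * cexp (Real.pi * I * z) * (linTerm 1 0 ((1 / 2 : ℝ) : ℂ) (z + ((1 / 2 : ℝ) : ℂ)) τ
      (modeEquiv x).1 * appellTerm z τ (modeEquiv x).2) =
      fourierMode τ x.1 z * (-I * fourierTerm τ x.1 x.2) := by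
  obtain ⟨l, m, n⟩ := x
  have h1 : I = cexp (Real.pi / 2 * I) := by rw [exp_pi_div_two_mul_I]
  have h2 : -I = cexp (-(Real.pi / 2) * I) := by
    rw [neg_mul, Complex.exp_neg, ← h1, inv_I]
  have h3 : (-1 : ℂ) ^ n = cexp (n * (Real.pi * I)) := by rw [Complex.exp_int_mul, exp_pi_mul_I]
  simp only [modeEquiv, Equiv.coe_fn_mk, linTerm, appellTerm, fourierMode, fourierTerm, zero_mul,
    add_zero, one_mul]
  rw [qTerm_eq, h3, h2]
  nth_rewrite 1 [h1]
  have key : cexp (Real.pi / 2 * I) * cexp (Real.pi * I * z) *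
      (cexp (Real.pi * I * τ * (((l - n - m - 1 : ℤ) : ℂ) + ((1 / 2 : ℝ) : ℂ)) ^ 2 +
        2 * Real.pi * I * (((l - n - m - 1 : ℤ) : ℂ) + ((1 / 2 : ℝ) : ℂ)) *
          (z + ((1 / 2 : ℝ) : ℂ))) * (cexp (n * (Real.pi * I)) *
        cexp (Real.pi * I * (n * (n + 1)) * τ + 2 * Real.pi * I * n * z +
          2 * Real.pi * I * m * (z + n * τ)))) =
      cexp (2 * Real.pi * I * l * z + 2 * Real.pi * I * ((l : ℂ) ^ 2 / 4) * τ) *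
        (cexp (-(Real.pi / 2) * I) * cexp (2 * Real.pi * I * (pt l (m, n) 0 / 2 + pt l (m, n) 1) +
          2 * Real.pi * I * (pt l (m, n) 0 ^ 2 / 2 + 2 * pt l (m, n) 0 * pt l (m, n) 1 +
            pt l (m, n) 1 ^ 2) * τ)) := by
    simp only [← Complex.exp_add]
    rw [Complex.exp_eq_exp_iff_exists_int]
    refine ⟨l - m - n, ?_⟩
    simp only [pt, Matrix.cons_val_zero, Matrix.cons_val_one]
    push_cast
    ring
  linear_combination (quadrant n m) * key

lemma summable_modes (τ : ℍ) {z : ℂ} (hz : 0 < z.im) (hz' : z.im < τ.im) :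
    Summable fun x : ℤ × (ℤ × ℤ) => fourierMode τ x.1 z * (-I * fourierTerm τ x.1 x.2) := by
  have h1 := (summable_linTerm 1 0 ((1 / 2 : ℝ) : ℂ) (z + ((1 / 2 : ℝ) : ℂ)) τ.im_pos).norm
  have h2 := summable_norm_appellTerm (τ := τ) hz hz'
  have h3 := (summable_mul_of_summable_norm h1 h2).mul_left (I * cexp (Real.pi * I * z))
  exact (modeEquiv.summable_iff.mpr h3).congr fun x => mode_term τ z x

lemma tsum_modes (τ : ℍ) {z : ℂ} (hz : 0 < z.im) (hz' : z.im < τ.im) :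
    ∑' x : ℤ × (ℤ × ℤ), fourierMode τ x.1 z * (-I * fourierTerm τ x.1 x.2) =
      theta1 z τ ^ 2 * mu z τ := by
  have h1 := (summable_linTerm 1 0 ((1 / 2 : ℝ) : ℂ) (z + ((1 / 2 : ℝ) : ℂ)) τ.im_pos).norm
  have h2 := summable_norm_appellTerm (τ := τ) hz hz'
  rw [theta1_sq_mul_mu, thetaChar_eq_tsum, ← tsum_appellTerm hz hz',
    tsum_mul_tsum_of_summable_norm h1 h2, ← tsum_mul_left]
  exact (tsum_congr fun x => (mode_term τ z x).symm).trans (modeEquiv.tsum_eq fun x =>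
    I * cexp (Real.pi * I * z) * (linTerm 1 0 ((1 / 2 : ℝ) : ℂ) (z + ((1 / 2 : ℝ) : ℂ)) τ x.1 *
      appellTerm z τ x.2))

lemma fourierMode_ne_zero (τ : ℂ) (l : ℤ) (z : ℂ) : fourierMode τ l z ≠ 0 := Complex.exp_ne_zero _

lemma summable_fourierTerm (τ : ℍ) (l : ℤ) : Summable (fourierTerm τ l) := by
  have hy := τ.im_pos
  -- Any point of the strip would do; the fibre over `l` is summable and its nonvanishing mode can
  -- be divided out.
  have h := (summable_modes τ (z := I * (τ.im / 2 : ℝ)) (by simp [hy]) (by simp [hy])).prod_factor l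
  rw [summable_mul_left_iff (fourierMode_ne_zero _ _ _),
    summable_mul_left_iff (neg_ne_zero.mpr I_ne_zero)] at h
  exact h

lemma hasSum_modes (τ : ℍ) {z : ℂ} (hz : 0 < z.im) (hz' : z.im < τ.im) :
    HasSum (fun l => fourierMode τ l z * (-I * ∑' p, fourierTerm τ l p))
      (theta1 z τ ^ 2 * mu z τ) := by
  have h := (summable_modes τ hz hz').hasSum
  rw [tsum_modes τ hz hz'] at h
  exact h.prod_fiberwise fun l => ((summable_fourierTerm τ l).hasSum.mul_left _).mul_left _

lemma integral_exp_int (k : ℤ) : ∫ x in (0 : ℝ)..1, cexp (2 * Real.pi * I * k * x) =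
    if k = 0 then 1 else 0 := by
  split_ifs with h
  · simp [h]
  · have hc : (2 * Real.pi * I * k : ℂ) ≠ 0 := by
      have : (k : ℂ) ≠ 0 := by exact_mod_cast h
      have hp : (Real.pi : ℂ) ≠ 0 := ofReal_ne_zero.mpr Real.pi_pos.ne'
      simp [this, hp]
    rw [integral_exp_mul_complex hc]
    have : cexp (2 * Real.pi * I * k * (1 : ℝ)) = 1 := by
      rw [Complex.exp_eq_one_iff]; exact ⟨k, by push_cast; ring⟩
    rw [this]; simp

/-- `S_ℓ` as a lattice sum. -/
theorem S_eq_tsum (l : ℤ) (τ : ℍ) : S l τ = -I * ∑' p, fourierTerm τ l p := by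
  have hy := τ.im_pos
  set a : ℤ → ℂ := fun l => -I * ∑' p, fourierTerm τ l p with ha
  set Z : ℝ → ℂ := fun x => x + I * (τ.im / 2) with hZ
  have hZim : ∀ x, (Z x).im = τ.im / 2 := fun x => by simp [hZ]
  have hs : ∀ x, HasSum (fun k => fourierMode τ k (Z x) * a k) (theta1 (Z x) τ ^ 2 * mu (Z x) τ) :=
    fun x => hasSum_modes τ (by rw [hZim]; linarith) (by rw [hZim]; linarith)
  -- On a horizontal line each term varies only by a character of absolute value one, so the terms
  -- at `x = 0` dominate and orthogonality isolates `k = l`.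
  have hsplit : ∀ (k : ℤ) (x : ℝ), fourierMode τ k (Z x) * a k * cexp (-2 * Real.pi * I * l * Z x) =
      (fourierMode τ k (Z 0) * a k * cexp (-2 * Real.pi * I * l * Z 0)) *
        cexp (2 * Real.pi * I * (k - l : ℤ) * x) := by
    intro k x
    have : fourierMode τ k (Z x) * cexp (-2 * Real.pi * I * l * Z x) =
        fourierMode τ k (Z 0) * cexp (-2 * Real.pi * I * l * Z 0) *
          cexp (2 * Real.pi * I * (k - l : ℤ) * x) := by
      rw [fourierMode, fourierMode]
      simp only [← Complex.exp_add, hZ]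
      congr 1
      push_cast
      ring
    linear_combination a k * this
  have hnorm : ∀ (k : ℤ) (x : ℝ), ‖cexp (2 * Real.pi * I * k * x)‖ = 1 := fun k x => by
    rw [show (2 * Real.pi * I * k * x : ℂ) = ((2 * Real.pi * k * x : ℝ) : ℂ) * I by push_cast; ring,
      Complex.norm_exp_ofReal_mul_I]
  have hInt : HasSum (fun k => ∫ x in (0 : ℝ)..1,
      fourierMode τ k (Z x) * a k * cexp (-2 * Real.pi * I * l * Z x))
      (∫ x in (0 : ℝ)..1, theta1 (Z x) τ ^ 2 * mu (Z x) τ * cexp (-2 * Real.pi * I * l * Z x)) := by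
    refine intervalIntegral.hasSum_integral_of_dominated_convergence
      (fun k _ => ‖fourierMode τ k (Z 0) * a k * cexp (-2 * Real.pi * I * l * Z 0)‖)
      (fun k => ?_) (fun k => ?_) ?_ ?_ ?_
    · refine Continuous.aestronglyMeasurable ?_
      simp only [fourierMode, hZ]; fun_prop
    · refine Filter.Eventually.of_forall fun x _ => ?_
      rw [hsplit, norm_mul, hnorm, mul_one]
    · exact Filter.Eventually.of_forall fun x _ => ((hs 0).summable.mul_right _).norm
    · exact intervalIntegrable_const
    · exact Filter.Eventually.of_forall fun x _ => (hs x).mul_right _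
  have hval : ∀ k, ∫ x in (0 : ℝ)..1,
      fourierMode τ k (Z x) * a k * cexp (-2 * Real.pi * I * l * Z x) =
      if k = l then fourierMode τ l (Z 0) * a l * cexp (-2 * Real.pi * I * l * Z 0) else 0 := by
    intro k
    rw [intervalIntegral.integral_congr fun x _ => hsplit k x, intervalIntegral.integral_const_mul, integral_exp_int]
    by_cases h : k = l
    · simp [h]
    · rw [if_neg h, if_neg (sub_ne_zero.mpr h), mul_zero]
  rw [funext hval] at hInt
  have h2 := hInt.unique (hasSum_ite_eq l _)
  rw [S]
  change cexp (-2 * Real.pi * I * ((l : ℂ) ^ 2 / 4) * τ) * (∫ x in (0 : ℝ)..1,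
    theta1 (Z x) τ ^ 2 * mu (Z x) τ * cexp (-2 * Real.pi * I * l * Z x)) = a l
  rw [h2]
  have : cexp (-2 * Real.pi * I * ((l : ℂ) ^ 2 / 4) * τ) * (fourierMode τ l (Z 0) *
      cexp (-2 * Real.pi * I * l * Z 0)) = 1 := by
    rw [fourierMode]
    simp only [← Complex.exp_add]
    rw [← Complex.exp_zero]; congr 1; ring
  linear_combination (a l) * this

/-- Twice the quadrant indicator is a sum of two signs. The first is `sgn ν₀`, as `ν₀` is never
zero; the second uses the sign of `n`, with `0` counted as positive, instead of `sgn(n - l/2)`. The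
discrepancy is a function of `n` alone and drops out of the sum. -/
lemma two_mul_quadrant (l : ℤ) (p : ℤ × ℤ) : 2 * quadrant p.2 p.1 = (sgnCoeff (pt l p) : ℂ) +
    ((if 0 ≤ p.2 then 1 else -1) - Real.sign ((p.2 : ℝ) + -(l / 2)) : ℝ) := by
  have h0 : Real.sign ((p.1 : ℝ) + 1 / 2) = if 0 ≤ p.1 then 1 else -1 := by
    split_ifs with h
    · have : (0 : ℝ) ≤ p.1 := by exact_mod_cast h
      exact Real.sign_of_pos (by linarith)
    · have : (p.1 : ℝ) ≤ -1 := by exact_mod_cast (by omega : p.1 ≤ -1)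
      exact Real.sign_of_neg (by linarith)
  rw [sgnCoeff_eq]
  simp only [pt, Matrix.cons_val_zero, Matrix.cons_val_one]
  rw [h0]
  unfold quadrant
  split_ifs <;> push_cast <;> ring

/-- `2i S_ℓ` as an indefinite theta series with sign coefficients. -/
theorem hasSum_sgnTerm (l : ℤ) (τ : ℍ) : HasSum (fun p : ℤ × ℤ =>
    (sgnCoeff (pt l p) : ℂ) * qTerm A₀ b₀ (pt l p) τ) (2 * I * S l τ) := by
  have h1 := summable_sgnTerm l τ
  have h2 := (summable_fourierTerm τ l).mul_left 2
  have e : ∀ p, 2 * fourierTerm τ l p = (sgnCoeff (pt l p) : ℂ) * qTerm A₀ b₀ (pt l p) τ +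
      ((if 0 ≤ p.2 then 1 else -1) - Real.sign ((p.2 : ℝ) + -(l / 2)) : ℝ) *
        qTerm A₀ b₀ (pt l p) τ := fun p => by
    rw [fourierTerm, ← mul_assoc, two_mul_quadrant l p, add_mul]
  have h3 : Summable fun p : ℤ × ℤ =>
      (((if 0 ≤ p.2 then 1 else -1) - Real.sign ((p.2 : ℝ) + -(l / 2)) : ℝ) : ℂ) *
        qTerm A₀ b₀ (pt l p) τ :=
    (h2.sub h1).congr fun p => by rw [e]; ring
  have h4 := tsum_snd_mul_qTerm
    (fun n => (((if 0 ≤ n then 1 else -1) - Real.sign ((n : ℝ) + -(l / 2)) : ℝ) : ℂ)) h3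
  have h5 : ∑' p, 2 * fourierTerm τ l p =
      ∑' p : ℤ × ℤ, (sgnCoeff (pt l p) : ℂ) * qTerm A₀ b₀ (pt l p) τ := by
    simp_rw [e]
    rw [h1.tsum_add h3, h4, add_zero]
  have h6 : 2 * I * S l τ = ∑' p, 2 * fourierTerm τ l p := by
    rw [S_eq_tsum, tsum_mul_left]
    linear_combination (-2 * ∑' p, fourierTerm τ l p) * I_sq
  rw [h6, h5]
  exact h1.hasSum

/-- Raising `l` by two shifts the coset by an integral vector, so the sign series is merely
reindexed. -/
lemma S_add_two (l : ℤ) (τ : ℍ) : S (l + 2) τ = S l τ := by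
  have h : 2 * I * S (l + 2) τ = 2 * I * S l τ := by
    rw [← (hasSum_sgnTerm (l + 2) τ).tsum_eq, ← (hasSum_sgnTerm l τ).tsum_eq,
      ← ((Equiv.refl ℤ).prodCongr (Equiv.addRight (1 : ℤ))).tsum_eq]
    refine tsum_congr fun p => ?_
    have : pt (l + 2) (((Equiv.refl ℤ).prodCongr (Equiv.addRight (1 : ℤ))) p) = pt l p := by
      simp only [pt, Equiv.prodCongr_apply, Prod.map, Equiv.refl_apply, Equiv.coe_addRight]
      congr 2; push_cast; ring
    rw [this]
  exact mul_left_cancel₀ (mul_ne_zero two_ne_zero I_ne_zero) h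

lemma S_two_mul_add (l k : ℤ) (τ : ℍ) : S (2 * k + l) τ = S l τ := by
  induction k using Int.induction_on with
  | zero => simp
  | succ i ih => rw [← ih, ← S_add_two (2 * i + l)]; congr 1; ring
  | pred i ih => rw [← ih, ← S_add_two (2 * (-i - 1) + l)]; congr 1; ring

lemma even_odd_isCompl : IsCompl (Set.range fun k : ℤ => 2 * k + 0)
    (Set.range fun k : ℤ => 2 * k + 1) := by
  constructor
  · rw [Set.disjoint_left]
    rintro a ⟨x, h⟩ ⟨y, h2⟩
    simp only at h h2
    omega
  · rw [codisjoint_iff_le_sup]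
    rintro a -
    rcases Int.even_or_odd' a with ⟨k, hk | hk⟩
    · exact Or.inl ⟨k, by simp only; omega⟩
    · exact Or.inr ⟨k, by simp only; omega⟩

/-- The theta decomposition in the strip `0 < Im z < Im τ`. -/
theorem theta_decomposition_strip (τ : ℍ) {z : ℂ} (hz : 0 < z.im) (hz' : z.im < τ.im) :
    theta1 z τ ^ 2 * mu z τ =
      S 0 τ * theta3 (2 * z) (2 * τ) + S 1 τ * theta2 (2 * z) (2 * τ) := by
  have h := hasSum_modes τ hz hz'
  simp_rw [← S_eq_tsum] at h
  rw [← h.tsum_eq, tsum_eq_add_of_isCompl h.summable (fun a b hab => by simpa using hab)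
    (fun a b hab => by simpa using hab) even_odd_isCompl]
  simp_rw [S_two_mul_add]
  rw [tsum_mul_right, tsum_mul_right, mul_comm (S 0 τ), mul_comm (S 1 τ), theta3, theta2,
    thetaChar, thetaChar]
  congr 2
  · refine tsum_congr fun n => ?_
    rw [fourierMode]; congr 1; push_cast; ring
  · refine tsum_congr fun n => ?_
    rw [fourierMode]; congr 1; push_cast; ring

/-! ### The theta decomposition off the lattice -/

lemma thetaChar_add_tau (a b : ℝ) (z τ : ℂ) : thetaChar a b (z + τ) τ =
    cexp (-Real.pi * I * τ - 2 * Real.pi * I * (z + b)) * thetaChar a b z τ := by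
  rw [thetaChar, thetaChar, ← tsum_mul_left, ← (Equiv.addRight (1 : ℤ)).tsum_eq fun n : ℤ =>
    cexp (-Real.pi * I * τ - 2 * Real.pi * I * (z + b)) * cexp (2 * Real.pi * I * ((n + a) * b) +
      Real.pi * I * (n + a) ^ 2 * τ + 2 * Real.pi * I * (n + a) * z)]
  refine tsum_congr fun n => ?_
  rw [← Complex.exp_add]; congr 1
  simp only [Equiv.coe_addRight]; push_cast; ring

lemma appell_add_tau (z τ : ℂ) : appell (z + τ) τ =
    -cexp (-2 * Real.pi * I * τ - 2 * Real.pi * I * z) * appell z τ := by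
  rw [appell, appell, ← tsum_mul_left, ← (Equiv.addRight (1 : ℤ)).tsum_eq fun n : ℤ =>
    -cexp (-2 * Real.pi * I * τ - 2 * Real.pi * I * z) * ((-1 : ℂ) ^ n *
      cexp (Real.pi * I * (n * (n + 1)) * τ + 2 * Real.pi * I * n * z) /
        (1 - cexp (2 * Real.pi * I * (z + n * τ))))]
  refine tsum_congr fun n => ?_
  simp only [Equiv.coe_addRight]
  have h1 : z + τ + n * τ = z + ((n + 1 : ℤ) : ℂ) * τ := by push_cast; ring
  have h2 : cexp (Real.pi * I * (n * (n + 1)) * τ + 2 * Real.pi * I * n * (z + τ)) =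
      cexp (-2 * Real.pi * I * τ - 2 * Real.pi * I * z) * cexp (Real.pi * I *
        (((n + 1 : ℤ) : ℂ) * (((n + 1 : ℤ) : ℂ) + 1)) * τ +
          2 * Real.pi * I * ((n + 1 : ℤ) : ℂ) * z) := by
    rw [← Complex.exp_add]; congr 1; push_cast; ring
  rw [h1, h2, zpow_add_one₀ (by norm_num)]
  ring

/-- The factor is the same one that `θ₃(2z; 2τ)` and `θ₂(2z; 2τ)` acquire, so the decomposition is
invariant under `z ↦ z + τ`. -/
lemma theta1_sq_mul_mu_add_tau (z τ : ℂ) : theta1 (z + τ) τ ^ 2 * mu (z + τ) τ =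
    cexp (-2 * Real.pi * I * τ - 4 * Real.pi * I * z) * (theta1 z τ ^ 2 * mu z τ) := by
  rw [theta1_sq_mul_mu, theta1_sq_mul_mu, thetaChar_add_tau, appell_add_tau]
  have h : cexp (Real.pi * I * (z + τ)) * cexp (-Real.pi * I * τ - 2 * Real.pi * I *
      (z + ((1 / 2 : ℝ) : ℂ))) * cexp (-2 * Real.pi * I * τ - 2 * Real.pi * I * z) =
      -(cexp (-2 * Real.pi * I * τ - 4 * Real.pi * I * z) * cexp (Real.pi * I * z)) := by
    have h1 : ∀ z : ℂ, -cexp z = cexp (z - Real.pi * I) := fun z => by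
      rw [Complex.exp_sub, exp_pi_mul_I]; ring
    simp only [← Complex.exp_add]
    rw [h1]; congr 1; push_cast; ring
  linear_combination (-I * thetaChar (1 / 2) (1 / 2) z τ * appell z τ) * h

lemma theta3_add_tau (z τ : ℂ) : theta3 (2 * (z + τ)) (2 * τ) =
    cexp (-2 * Real.pi * I * τ - 4 * Real.pi * I * z) * theta3 (2 * z) (2 * τ) := by
  rw [theta3, theta3, mul_add, thetaChar_add_tau]
  congr 2; push_cast; ring

lemma theta2_add_tau (z τ : ℂ) : theta2 (2 * (z + τ)) (2 * τ) =
    cexp (-2 * Real.pi * I * τ - 4 * Real.pi * I * z) * theta2 (2 * z) (2 * τ) := by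
  rw [theta2, theta2, mul_add, thetaChar_add_tau]
  congr 2; push_cast; ring

lemma continuous_thetaChar (a b : ℝ) {τ : ℂ} (hτ : 0 < τ.im) :
    Continuous fun z => thetaChar a b z τ := by
  have h : (fun z => thetaChar a b z τ) = fun z => cexp (Real.pi * I * τ * a ^ 2 +
      2 * Real.pi * I * a * (z + b)) * jacobiTheta₂ (z + b + τ * a) τ := by
    funext z
    rw [thetaChar_eq_tsum, (hasSum_linTerm 1 0 a (z + b) hτ).tsum_eq]
    ring
  have hd : Continuous fun z => jacobiTheta₂ z τ :=
    continuous_iff_continuousAt.mpr fun z => (differentiableAt_jacobiTheta₂_fst z hτ).continuousAt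
  rw [h]
  exact (by fun_prop : Continuous _).mul (hd.comp (by fun_prop))

lemma norm_one_sub_ge {w : ℂ} {x y : ℝ} (hw : ‖w‖ = Real.exp x) (hx : y ≤ |x|) :
    1 - Real.exp (-y) ≤ ‖1 - w‖ := by
  rcases abs_cases x with ⟨h, _⟩ | ⟨h, _⟩
  · have h1 : ‖w‖ - 1 ≤ ‖1 - w‖ := by
      have := norm_sub_norm_le w 1
      rwa [norm_one, norm_sub_rev] at this
    have h2 : Real.exp y ≤ ‖w‖ := by rw [hw]; exact Real.exp_le_exp.mpr (by linarith)
    have h3 := Real.add_one_le_exp y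
    have h4 := Real.add_one_le_exp (-y)
    linarith
  · have h1 : 1 - ‖w‖ ≤ ‖1 - w‖ := by
      have := norm_sub_norm_le 1 w
      rwa [norm_one] at this
    have h2 : ‖w‖ ≤ Real.exp (-y) := by rw [hw]; exact Real.exp_le_exp.mpr (by linarith)
    linarith

-- The terms are dominated uniformly as `z` is approached from above: for `n ≠ 0` the imaginary part
-- of `z + it + nτ` stays at least `y/2` away from zero, and for `n = 0` continuity bounds the
-- denominator from below because `z` is not an integer.
open Filter Topology in
lemma tendsto_appell {τ z : ℂ} (hτ : 0 < τ.im) (hz : z.im = 0)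
    (hz' : ∀ m n : ℤ, z ≠ m * τ + n) :
    Tendsto (fun t : ℝ => appell (z + I * t) τ) (𝓝[>] 0) (𝓝 (appell z τ)) := by
  set y := τ.im with hy
  have hne : ∀ n : ℤ, 1 - cexp (2 * Real.pi * I * (z + n * τ)) ≠ 0 := by
    intro n h
    rw [sub_eq_zero, eq_comm, Complex.exp_eq_one_iff] at h
    obtain ⟨k, hk⟩ := h
    have hp : (2 * Real.pi * I : ℂ) ≠ 0 := two_pi_I_ne_zero
    have : z + n * τ = k := mul_left_cancel₀ hp (by rw [hk]; ring)
    exact hz' (-n) k (by push_cast; linear_combination this)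
  have hcont : ∀ n : ℤ, ContinuousAt (fun t : ℝ => (-1 : ℂ) ^ n * cexp (Real.pi * I *
      (n * (n + 1)) * τ + 2 * Real.pi * I * n * (z + I * t)) /
        (1 - cexp (2 * Real.pi * I * (z + I * t + n * τ)))) 0 := by
    intro n
    refine ContinuousAt.div (by fun_prop) (by fun_prop) ?_
    simpa using hne n
  set c₂ := ‖1 - cexp (2 * Real.pi * I * z)‖ / 2 with hc₂
  have hc₂0 : 0 < c₂ := by
    have := hne 0
    simp only [Int.cast_zero, zero_mul, add_zero] at this
    positivity
  set c := min (1 - Real.exp (-(Real.pi * y))) c₂ with hc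
  have hc1 : 0 < 1 - Real.exp (-(Real.pi * y)) := by
    have : Real.exp (-(Real.pi * y)) < 1 := Real.exp_lt_one_iff.mpr (by
      have := mul_pos Real.pi_pos hτ; linarith)
    linarith
  have hc0 : 0 < c := lt_min hc1 hc₂0
  have hev1 : ∀ᶠ t : ℝ in 𝓝[>] 0, c₂ < ‖1 - cexp (2 * Real.pi * I * (z + I * t))‖ := by
    have : ContinuousAt (fun t : ℝ => ‖1 - cexp (2 * Real.pi * I * (z + I * t))‖) 0 := by fun_prop
    have h2 := this.tendsto
    simp only [ofReal_zero, mul_zero, add_zero] at h2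
    exact (h2.mono_left nhdsWithin_le_nhds).eventually_const_lt (by rw [hc₂] at *; linarith)
  have hev2 : ∀ᶠ t : ℝ in 𝓝[>] 0, 0 < t := self_mem_nhdsWithin
  have hev3 : ∀ᶠ t : ℝ in 𝓝[>] 0, t < y / 2 :=
    nhdsWithin_le_nhds (Iio_mem_nhds (by linarith))
  have hbs := (summable_pow_mul_jacobiTheta₂_term_bound y hτ 0).mul_right c⁻¹
  refine tendsto_tsum_of_dominated_convergence hbs (fun n => ?_) ?_
  · have := (hcont n).tendsto
    simp only [ofReal_zero, mul_zero, add_zero] at this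
    exact this.mono_left nhdsWithin_le_nhds
  · filter_upwards [hev1, hev2, hev3] with t h1 h2 h3 n
    rw [norm_div, div_eq_mul_inv]
    refine mul_le_mul ?_ ?_ (by positivity) (by positivity)
    · rw [norm_mul, norm_zpow, norm_neg, norm_one, _root_.one_zpow, one_mul, Complex.norm_exp, pow_zero,
        one_mul]
      apply Real.exp_le_exp.mpr
      rw [show (Real.pi * I * (n * (n + 1)) * τ + 2 * Real.pi * I * n * (z + I * t) : ℂ) =
        (((Real.pi * (n * (n + 1)) : ℝ) : ℂ) * τ + ((2 * Real.pi * n : ℝ) : ℂ) * (z + I * t)) * I by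
        push_cast; ring, mul_I_re, add_im, im_ofReal_mul, im_ofReal_mul]
      have : (z + I * t).im = t := by simp [hz]
      rw [this, ← hy]
      have hn1 := neg_abs_le (n : ℝ)
      push_cast
      have hb : -(n * y + 2 * n * t) ≤ 2 * y * |(n : ℝ)| := by nlinarith [abs_nonneg (n : ℝ)]
      nlinarith [Real.pi_pos, mul_le_mul_of_nonneg_left hb Real.pi_pos.le]
    · refine inv_anti₀ hc0 ?_
      rcases eq_or_ne n 0 with rfl | hn
      · simp only [Int.cast_zero, zero_mul, add_zero]
        exact (min_le_right _ _).trans h1.le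
      · refine (min_le_left _ _).trans (norm_one_sub_ge (norm_cexp_two_pi_I _) ?_)
        have : (z + I * t + n * τ).im = t + n * y := by simp [hz, hy]
        rw [this, abs_mul, abs_mul, abs_neg, abs_two, abs_of_pos Real.pi_pos]
        have h4 : y / 2 ≤ |t + n * y| := by
          rcases lt_or_gt_of_ne hn with h | h
          · have : (n : ℝ) ≤ -1 := by exact_mod_cast (by omega : n ≤ -1)
            exact le_abs.mpr (Or.inr (by nlinarith))
          · have : (1 : ℝ) ≤ n := by exact_mod_cast (by omega : 1 ≤ n)
            exact le_abs.mpr (Or.inl (by nlinarith))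
        nlinarith [Real.pi_pos]

open Filter Topology in
lemma theta_decomposition_real (τ : ℍ) {z : ℂ} (hz : z.im = 0)
    (hz' : ∀ m n : ℤ, z ≠ m * (τ : ℂ) + n) : theta1 z τ ^ 2 * mu z τ =
      S 0 τ * theta3 (2 * z) (2 * τ) + S 1 τ * theta2 (2 * z) (2 * τ) := by
  have hτ : 0 < (τ : ℂ).im := τ.im_pos
  have hτ2 : 0 < (2 * (τ : ℂ)).im := by simpa using τ.im_pos
  have hp : Tendsto (fun t : ℝ => z + I * t) (𝓝[>] 0) (𝓝 z) := by
    have : ContinuousAt (fun t : ℝ => z + I * t) 0 := by fun_prop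
    have h2 := this.tendsto
    simp only [ofReal_zero, mul_zero, add_zero] at h2
    exact h2.mono_left nhdsWithin_le_nhds
  have hL : Tendsto (fun t : ℝ => theta1 (z + I * t) τ ^ 2 * mu (z + I * t) τ) (𝓝[>] 0)
      (𝓝 (theta1 z τ ^ 2 * mu z τ)) := by
    simp_rw [theta1_sq_mul_mu]
    refine Tendsto.mul ?_ (Tendsto.mul (((continuous_thetaChar _ _ hτ).tendsto z).comp hp)
      (tendsto_appell hτ hz hz'))
    exact ((by fun_prop : Continuous fun z => I * cexp (Real.pi * I * z)).tendsto z).comp hp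
  have hR : Tendsto (fun t : ℝ => S 0 τ * theta3 (2 * (z + I * t)) (2 * τ) +
      S 1 τ * theta2 (2 * (z + I * t)) (2 * τ)) (𝓝[>] 0)
      (𝓝 (S 0 τ * theta3 (2 * z) (2 * τ) + S 1 τ * theta2 (2 * z) (2 * τ))) := by
    have hc : Continuous fun z => S 0 τ * theta3 (2 * z) (2 * τ) +
        S 1 τ * theta2 (2 * z) (2 * τ) := by
      have h3 : Continuous fun z => theta3 (2 * z) (2 * τ) :=
        (continuous_thetaChar 0 0 hτ2).comp (by fun_prop)
      have h2 : Continuous fun z => theta2 (2 * z) (2 * τ) :=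
        (continuous_thetaChar (1 / 2) 0 hτ2).comp (by fun_prop)
      fun_prop
    exact (hc.tendsto z).comp hp
  refine tendsto_nhds_unique_of_eventuallyEq hL hR ?_
  have hev3 : ∀ᶠ t : ℝ in 𝓝[>] 0, t < τ.im :=
    nhdsWithin_le_nhds (Iio_mem_nhds τ.im_pos)
  filter_upwards [self_mem_nhdsWithin, hev3] with t h1 h2
  exact theta_decomposition_strip τ (by simpa [hz] using h1) (by simpa [hz] using h2)

/-- Translate by a multiple of `τ` into `0 ≤ Im z < Im τ`. The open strip is covered by the Fourier
expansion and the real line by the limit. -/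
theorem theta_decomposition (τ : ℍ) (z : ℂ) (hz : ∀ m n : ℤ, z ≠ m * (τ : ℂ) + n) :
    theta1 z τ ^ 2 * mu z τ =
      S 0 τ * theta3 (2 * z) (2 * τ) + S 1 τ * theta2 (2 * z) (2 * τ) := by
  set P : ℂ → Prop := fun z => theta1 z τ ^ 2 * mu z τ =
      S 0 τ * theta3 (2 * z) (2 * τ) + S 1 τ * theta2 (2 * z) (2 * τ) with hP
  have hshift : ∀ z, P (z + τ) ↔ P z := by
    intro z
    simp only [hP]
    rw [theta1_sq_mul_mu_add_tau, theta3_add_tau, theta2_add_tau, mul_left_comm (S 0 τ),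
      mul_left_comm (S 1 τ), ← mul_add]
    exact ⟨fun h => mul_left_cancel₀ (Complex.exp_ne_zero _) h, fun h => by rw [h]⟩
  have hInt : ∀ (k : ℤ) (z : ℂ), P (z + k * τ) ↔ P z := by
    intro k z
    induction k using Int.induction_on with
    | zero => simp
    | succ i ih =>
      rw [← ih, ← hshift (z + ((i : ℤ) : ℂ) * τ)]
      push_cast; ring_nf
    | pred i ih =>
      rw [← ih, ← hshift (z + ((-(i : ℤ) - 1 : ℤ) : ℂ) * τ)]
      push_cast; ring_nf
  set k := ⌊z.im / τ.im⌋ with hk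
  have h1 := Int.floor_le (z.im / τ.im)
  have h2 := Int.lt_floor_add_one (z.im / τ.im)
  rw [← hk] at h1 h2
  have hy := τ.im_pos
  rw [le_div_iff₀ hy] at h1
  rw [div_lt_iff₀ hy] at h2
  have him : (z + ((-k : ℤ) : ℂ) * τ).im = z.im - k * τ.im := by simp; ring
  change P z
  rw [← hInt (-k)]
  rcases eq_or_lt_of_le h1 with h | h
  · refine theta_decomposition_real τ (by rw [him, h, sub_self]) fun m n hmn => hz (m + k) n ?_
    push_cast at hmn ⊢
    linear_combination hmn
  · exact theta_decomposition_strip τ (by rw [him]; linarith) (by rw [him]; linarith)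

/-! ### Automorphy factors -/

lemma autFactor_ne_zero (γ : SL(2, ℤ)) (τ : ℍ) : autFactor γ τ ≠ 0 := by
  have := UpperHalfPlane.denom_ne_zero
    (SpecialLinearGroup.toGL ((SpecialLinearGroup.map (Int.castRingHom ℝ)) γ)) τ
  rwa [ModularGroup.denom_apply] at this

lemma coe_smul_eq (γ : SL(2, ℤ)) (τ : ℍ) :
    ((γ • τ : ℍ) : ℂ) = ((γ 0 0 : ℂ) * τ + (γ 0 1 : ℂ)) / autFactor γ τ := by
  rw [UpperHalfPlane.coe_specialLinearGroup_apply, autFactor]; simp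

lemma sl_mul_apply (γ₁ γ₂ : SL(2, ℤ)) (i j : Fin 2) :
    (γ₁ * γ₂) i j = γ₁ i 0 * γ₂ 0 j + γ₁ i 1 * γ₂ 1 j := by
  simp [Matrix.mul_apply, Fin.sum_univ_two]

lemma autFactor_mul (γ₁ γ₂ : SL(2, ℤ)) (τ : ℍ) :
    autFactor (γ₁ * γ₂) τ = autFactor γ₁ (γ₂ • τ) * autFactor γ₂ τ := by
  have h := autFactor_ne_zero γ₂ τ
  rw [autFactor, autFactor, coe_smul_eq, sl_mul_apply, sl_mul_apply]
  field_simp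
  rw [autFactor]
  push_cast
  ring

@[simp] lemma autFactor_one (τ : ℍ) : autFactor 1 τ = 1 := by
  simp [autFactor]

lemma autFactor_T_zpow (n : ℤ) (τ : ℍ) : autFactor (ModularGroup.T ^ n) τ = 1 := by
  simp [autFactor, ModularGroup.coe_T_zpow]

lemma autFactor_T (τ : ℍ) : autFactor ModularGroup.T τ = 1 := by
  simpa using autFactor_T_zpow 1 τ

lemma autFactor_S (τ : ℍ) : autFactor ModularGroup.S τ = τ := by
  simp [autFactor, ModularGroup.S]

lemma coe_T_smul (τ : ℍ) : ((ModularGroup.T • τ : ℍ) : ℂ) = τ + 1 := by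
  have := ModularGroup.coe_T_zpow_smul_eq τ (n := 1)
  simpa using this

lemma coe_S_smul (τ : ℍ) : ((ModularGroup.S • τ : ℍ) : ℂ) = -1 / τ := by
  rw [UpperHalfPlane.modular_S_smul]; simp [neg_div]

lemma S_smul_S_smul (τ : ℍ) : ModularGroup.S • ModularGroup.S • τ = τ := by
  apply UpperHalfPlane.ext
  rw [coe_S_smul, coe_S_smul]
  have := τ.ne_zero
  field_simp

lemma continuous_smul (γ : SL(2, ℤ)) : Continuous fun τ : ℍ => γ • τ := by
  rw [UpperHalfPlane.isEmbedding_coe.continuous_iff]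
  have h : (UpperHalfPlane.coe ∘ fun τ : ℍ => γ • τ) =
      fun τ : ℍ => ((γ 0 0 : ℂ) * τ + (γ 0 1 : ℂ)) / autFactor γ τ :=
    funext fun τ => coe_smul_eq γ τ
  rw [h]
  have hc : Continuous fun τ : ℍ => (τ : ℂ) := UpperHalfPlane.continuous_coe
  exact Continuous.div (by fun_prop) (by unfold autFactor; fun_prop) (autFactor_ne_zero γ)

/-- For `c ≠ 0` the values `cτ + d` are never real, hence avoid the branch cut; for `c = 0` they are
constant, possibly on the cut. -/
lemma continuous_log_autFactor (γ : SL(2, ℤ)) : Continuous fun τ : ℍ => log (autFactor γ τ) := by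
  by_cases h : γ 1 0 = 0
  · simp only [autFactor, h, Int.cast_zero, zero_mul, zero_add]
    exact continuous_const
  · have hc : Continuous fun τ : ℍ => autFactor γ τ := by
      have hc : Continuous fun τ : ℍ => (τ : ℂ) := UpperHalfPlane.continuous_coe
      unfold autFactor; fun_prop
    refine hc.clog fun τ => Or.inr ?_
    have : (autFactor γ τ).im = (γ 1 0 : ℝ) * τ.im := by
      simp [autFactor]
    rw [this]
    exact mul_ne_zero (by exact_mod_cast h) τ.im_pos.ne'

/-- The powers `(cτ + d)^w` form a cocycle up to constants of absolute value one. -/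
lemma exists_cpow_cocycle (w : ℝ) (γ₁ γ₂ : SL(2, ℤ)) : ∃ ε : ℂ, ‖ε‖ = 1 ∧ ∀ τ : ℍ,
    autFactor γ₁ (γ₂ • τ) ^ (w : ℂ) * autFactor γ₂ τ ^ (w : ℂ) =
      ε * autFactor (γ₁ * γ₂) τ ^ (w : ℂ) := by
  -- The logarithms agree up to `2πi n(τ)`. The integer `n(τ)` depends continuously on `τ`, so it is
  -- constant on the connected half-plane.
  have hn : ∀ τ : ℍ, ∃ n : ℤ, log (autFactor γ₁ (γ₂ • τ)) + log (autFactor γ₂ τ) =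
      log (autFactor (γ₁ * γ₂) τ) + n * (2 * Real.pi * I) := by
    intro τ
    rw [← Complex.exp_eq_exp_iff_exists_int, Complex.exp_add, exp_log (autFactor_ne_zero _ _),
      exp_log (autFactor_ne_zero _ _), exp_log (autFactor_ne_zero _ _), autFactor_mul]
  choose n hn using hn
  have hcont : Continuous n := by
    rw [Int.isClosedEmbedding_coe_real.isEmbedding.continuous_iff]
    have h1 : ((fun m : ℤ => (m : ℝ)) ∘ n) = fun τ : ℍ =>
        ((log (autFactor γ₁ (γ₂ • τ)) + log (autFactor γ₂ τ) - log (autFactor (γ₁ * γ₂) τ)) /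
          (2 * Real.pi * I)).re := by
      funext τ
      rw [hn, add_sub_cancel_left, mul_div_cancel_right₀ _ two_pi_I_ne_zero]
      simp
    rw [h1]
    have a1 := (continuous_log_autFactor γ₁).comp (continuous_smul γ₂)
    have a2 := continuous_log_autFactor γ₂
    have a3 := continuous_log_autFactor (γ₁ * γ₂)
    exact continuous_re.comp (((a1.add a2).sub a3).div_const _)
  refine ⟨cexp ((2 * Real.pi * n UpperHalfPlane.I * w : ℝ) * I), Complex.norm_exp_ofReal_mul_I _,
    fun τ => ?_⟩
  have hc : n UpperHalfPlane.I = n τ :=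
    PreconnectedSpace.constant inferInstance hcont
  rw [cpow_def_of_ne_zero (autFactor_ne_zero _ _), cpow_def_of_ne_zero (autFactor_ne_zero _ _),
    cpow_def_of_ne_zero (autFactor_ne_zero _ _), ← Complex.exp_add, ← add_mul, hn, hc,
    ← Complex.exp_add]
  congr 1
  push_cast
  ring

/-! ### Functions transforming with multipliers -/

/-- The subgroup of `SL₂(ℤ)` under which `f` transforms in weight `w` with unitary multipliers. -/
def multiplierSubgroup (w : ℝ) (f : ℍ → ℂ) : Subgroup SL(2, ℤ) where
  carrier := {γ | ∃ v : ℂ, ‖v‖ = 1 ∧ ∀ τ : ℍ, f (γ • τ) = v * autFactor γ τ ^ (w : ℂ) * f τ}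
  one_mem' := ⟨1, norm_one, fun τ => by simp⟩
  mul_mem' := by
    rintro γ₁ γ₂ ⟨v₁, h₁, e₁⟩ ⟨v₂, h₂, e₂⟩
    obtain ⟨ε, hε, e⟩ := exists_cpow_cocycle w γ₁ γ₂
    refine ⟨v₁ * v₂ * ε, by simp [h₁, h₂, hε], fun τ => ?_⟩
    rw [mul_smul, e₁, e₂]
    linear_combination (v₁ * v₂ * f τ) * e τ
  inv_mem' := by
    rintro γ ⟨v, h, e⟩
    obtain ⟨ε, hε, e'⟩ := exists_cpow_cocycle w γ γ⁻¹
    have hv : v ≠ 0 := fun h0 => by simp [h0] at h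
    have hε0 : ε ≠ 0 := fun h0 => by simp [h0] at hε
    refine ⟨v⁻¹ * ε⁻¹, by simp [h, hε], fun τ => ?_⟩
    have h1 := e (γ⁻¹ • τ)
    have h2 := e' τ
    rw [smul_inv_smul] at h1
    rw [mul_inv_cancel, autFactor_one, one_cpow, mul_one] at h2
    rw [h1]
    field_simp
    linear_combination (-f (γ⁻¹ • τ)) * h2

/-- The relation `F(γτ) = (cτ + d)^w M F(τ)` for a vector `F` of functions. -/
def VecTransforms {d : ℕ} (w : ℝ) (F : ℍ → Fin d → ℂ) (γ : SL(2, ℤ))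
    (M : Matrix (Fin d) (Fin d) ℂ) : Prop :=
  ∀ τ : ℍ, F (γ • τ) = autFactor γ τ ^ (w : ℂ) • (M *ᵥ F τ)

lemma VecTransforms.mul {d : ℕ} {w : ℝ} {F : ℍ → Fin d → ℂ} {γ₁ γ₂ : SL(2, ℤ)}
    {M₁ M₂ : Matrix (Fin d) (Fin d) ℂ} (h₁ : VecTransforms w F γ₁ M₁)
    (h₂ : VecTransforms w F γ₂ M₂) :
    ∃ ε : ℂ, ‖ε‖ = 1 ∧ VecTransforms w F (γ₁ * γ₂) (ε • (M₁ * M₂)) := by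
  obtain ⟨ε, hε, e⟩ := exists_cpow_cocycle w γ₁ γ₂
  refine ⟨ε, hε, fun τ => ?_⟩
  rw [mul_smul, h₁, h₂, Matrix.mulVec_smul, Matrix.mulVec_mulVec, smul_smul, Matrix.smul_mulVec,
    smul_smul, e, mul_comm]

lemma VecTransforms.inv {d : ℕ} {w : ℝ} {F : ℍ → Fin d → ℂ} {γ : SL(2, ℤ)}
    {M N : Matrix (Fin d) (Fin d) ℂ} (h : VecTransforms w F γ M) (hN : N * M = 1) :
    ∃ ε : ℂ, ‖ε‖ = 1 ∧ VecTransforms w F γ⁻¹ (ε • N) := by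
  obtain ⟨ε, hε, e⟩ := exists_cpow_cocycle w γ γ⁻¹
  have hε0 : ε ≠ 0 := fun h0 => by simp [h0] at hε
  refine ⟨ε⁻¹, by simp [hε], fun τ => ?_⟩
  have h1 := h (γ⁻¹ • τ)
  have h2 := e τ
  rw [smul_inv_smul] at h1
  rw [mul_inv_cancel, autFactor_one, one_cpow, mul_one] at h2
  rw [h1, Matrix.mulVec_smul, Matrix.smul_mulVec, Matrix.mulVec_mulVec, hN, Matrix.one_mulVec,
    smul_smul, smul_smul, mul_comm (autFactor γ⁻¹ τ ^ (w : ℂ)), h2, mul_inv_cancel₀ hε0, one_smul]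

/-- Transformation under the generators `S`, `T` by invertible matrices extends to `SL₂(ℤ)`. -/
lemma exists_vecTransforms {d : ℕ} {w : ℝ} {F : ℍ → Fin d → ℂ}
    {MS NS MT NT : Matrix (Fin d) (Fin d) ℂ} (hS : VecTransforms w F ModularGroup.S MS)
    (hS' : NS * MS = 1) (hT : VecTransforms w F ModularGroup.T MT) (hT' : NT * MT = 1)
    (γ : SL(2, ℤ)) : ∃ M, VecTransforms w F γ M := by
  have hγ : γ ∈ Subgroup.closure {ModularGroup.S, ModularGroup.T} := by
    simp [SpecialLinearGroup.SL2Z_generators]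
  -- A left inverse is carried along in the induction, since inverse group elements have to be
  -- handled.
  suffices ∃ M N, N * M = 1 ∧ VecTransforms w F γ M by
    obtain ⟨M, _, _, h⟩ := this; exact ⟨M, h⟩
  induction hγ using Subgroup.closure_induction with
  | mem x hx =>
    rcases hx with rfl | rfl
    · exact ⟨MS, NS, hS', hS⟩
    · exact ⟨MT, NT, hT', hT⟩
  | one => exact ⟨1, 1, one_mul 1, fun τ => by simp⟩
  | mul x y _ _ hx hy =>
    obtain ⟨M₁, N₁, h₁, e₁⟩ := hx
    obtain ⟨M₂, N₂, h₂, e₂⟩ := hy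
    obtain ⟨ε, hε, e⟩ := e₁.mul e₂
    have hε0 : ε ≠ 0 := fun h0 => by simp [h0] at hε
    refine ⟨_, ε⁻¹ • (N₂ * N₁), ?_, e⟩
    rw [smul_mul_smul_comm, inv_mul_cancel₀ hε0, one_smul, Matrix.mul_assoc,
      ← Matrix.mul_assoc N₁, h₁, Matrix.one_mul, h₂]
  | inv x _ hx =>
    obtain ⟨M₁, N₁, h₁, e₁⟩ := hx
    obtain ⟨ε, hε, e⟩ := e₁.inv h₁
    have hε0 : ε ≠ 0 := fun h0 => by simp [h0] at hε
    refine ⟨_, ε⁻¹ • M₁, ?_, e⟩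
    rw [smul_mul_smul_comm, inv_mul_cancel₀ hε0, one_smul, mul_eq_one_comm.mp h₁]

/-! ### Generation of `Γ₀(4)` -/

lemma exists_add_mul_abs_le (a : ℤ) {b : ℤ} (hb : b ≠ 0) : ∃ n : ℤ, 2 * |a + n * b| ≤ |b| := by
  have h0 : 0 < |b| := abs_pos.mpr hb
  have h1 := Int.emod_nonneg a hb
  have h2 := Int.emod_lt_abs a hb
  have h3 := Int.emod_add_mul_ediv a b
  by_cases h : 2 * (a % b) ≤ |b|
  · refine ⟨-(a / b), ?_⟩
    have : a + -(a / b) * b = a % b := by linear_combination -h3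
    rw [this, abs_of_nonneg h1]; exact h
  · push Not at h
    refine ⟨-(a / b) - b.sign, ?_⟩
    have h5 : b.sign * b = |b| := Int.sign_mul_self_eq_abs b
    have : a + (-(a / b) - b.sign) * b = a % b - |b| := by
      linear_combination -h3 - h5
    rw [this, abs_of_nonpos (by linarith)]; linarith

lemma S_mul_T_zpow_mul_S_inv_apply (k : ℤ) (j : Fin 2) :
    (ModularGroup.S * ModularGroup.T ^ k * ModularGroup.S⁻¹) 0 j = ![1, 0] j ∧
    (ModularGroup.S * ModularGroup.T ^ k * ModularGroup.S⁻¹) 1 j = ![-k, 1] j := by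
  have h1 : ModularGroup.S⁻¹ = -ModularGroup.S := by
    rw [inv_eq_iff_mul_eq_one]
    decide
  rw [h1]
  simp only [sl_mul_apply]
  fin_cases j <;> simp [ModularGroup.coe_T_zpow, ModularGroup.coe_S, -_root_.zpow_neg]

/-- `Γ₀(4)` is generated by `T`, `-1` and `S T⁴ S⁻¹`. -/
theorem mem_of_mem_Gamma0_four {K : Subgroup SL(2, ℤ)} (hT : ModularGroup.T ∈ K)
    (hneg : (-1 : SL(2, ℤ)) ∈ K)
    (hU : ModularGroup.S * ModularGroup.T ^ (4 : ℤ) * ModularGroup.S⁻¹ ∈ K) {γ : SL(2, ℤ)}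
    (hγ : γ ∈ CongruenceSubgroup.Gamma0 4) : γ ∈ K := by
  obtain ⟨N, hN⟩ : ∃ N : ℕ, (γ 1 0).natAbs = N := ⟨_, rfl⟩
  induction N using Nat.strong_induction_on generalizing γ with
  | _ N ih =>
  have hdvd : (4 : ℤ) ∣ γ 1 0 := by
    rw [CongruenceSubgroup.Gamma0_mem] at hγ
    exact (ZMod.intCast_zmod_eq_zero_iff_dvd _ 4).mp hγ
  have hdet : γ 0 0 * γ 1 1 - γ 0 1 * γ 1 0 = 1 := by
    have := γ.det_coe
    rwa [Matrix.det_fin_two] at this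
  by_cases hc : γ 1 0 = 0
  · rw [hc, mul_zero, sub_zero] at hdet
    rcases Int.mul_eq_one_iff_eq_one_or_neg_one.mp hdet with ⟨h1, h2⟩ | ⟨h1, h2⟩
    · have : γ = ModularGroup.T ^ (γ 0 1) := by
        ext i j
        fin_cases i <;> fin_cases j <;> simp [ModularGroup.coe_T_zpow, h1, h2, hc]
      rw [this]
      exact K.zpow_mem hT _
    · have : γ = -1 * ModularGroup.T ^ (-γ 0 1) := by
        ext i j
        fin_cases i <;> fin_cases j <;>
          simp [ModularGroup.coe_T_zpow, h1, h2, hc, -_root_.zpow_neg, Matrix.neg_apply]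
      rw [this]
      exact K.mul_mem hneg (K.zpow_mem hT _)
  · obtain ⟨c, hc4⟩ := hdvd
    -- Euclidean descent on `|c|`: a power of `T` makes `2|d'| ≤ |c|`, then a power of `S T⁴ S⁻¹`
    -- replaces `c` by `c + 4md'` of size at most `2|d'|`.
    obtain ⟨n, hn⟩ := exists_add_mul_abs_le (γ 1 1) hc
    set d' := γ 1 1 + n * γ 1 0 with hd'
    have hodd : d' % 2 = 1 := by
      have h1 : (γ 0 0 * γ 1 1) % 2 = 1 := by
        have : γ 0 0 * γ 1 1 = 1 + 2 * (γ 0 1 * (2 * c)) := by rw [hc4] at hdet; linarith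
        omega
      have h2 : γ 1 1 % 2 = 1 := by
        rcases Int.emod_two_eq_zero_or_one (γ 1 1) with h | h
        · rw [Int.mul_emod, h] at h1; simp at h1
        · exact h
      have : d' = γ 1 1 + 2 * (2 * (n * c)) := by rw [hd', hc4]; ring
      omega
    have hd0 : 4 * d' ≠ 0 := by omega
    obtain ⟨m, hm⟩ := exists_add_mul_abs_le (γ 1 0) hd0
    -- Strict descent could fail only if `2|d'| = |c|`; as `4 ∣ c`, this would make `d'` even, but
    -- `d'` is odd by the determinant.
    have hlt : |γ 1 0 + m * (4 * d')| < |γ 1 0| := by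
      rw [abs_mul, abs_of_pos (by norm_num : (0 : ℤ) < 4)] at hm
      rcases eq_or_lt_of_le hn with h | h
      · exfalso
        rw [hc4, abs_mul, abs_of_pos (by norm_num : (0 : ℤ) < 4)] at h
        rcases abs_cases d' with ⟨h1, _⟩ | ⟨h1, _⟩ <;> rw [h1] at h <;> omega
      · linarith
    set U := ModularGroup.S * ModularGroup.T ^ (4 : ℤ) * ModularGroup.S⁻¹ with hUdef
    have hUm : U ^ (-m) = ModularGroup.S * ModularGroup.T ^ (4 * -m) * ModularGroup.S⁻¹ := by
      rw [hUdef, conj_zpow, _root_.zpow_mul]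
    have hUmem : U ∈ CongruenceSubgroup.Gamma0 4 := by
      rw [CongruenceSubgroup.Gamma0_mem]
      rw [hUdef, (S_mul_T_zpow_mul_S_inv_apply 4 0).2]
      decide
    have hTmem : ModularGroup.T ∈ CongruenceSubgroup.Gamma0 4 := by
      rw [CongruenceSubgroup.Gamma0_mem]; simp [ModularGroup.T]
    have hmem : γ * ModularGroup.T ^ n * U ^ (-m) ∈ CongruenceSubgroup.Gamma0 4 :=
      Subgroup.mul_mem _ (Subgroup.mul_mem _ hγ (Subgroup.zpow_mem _ hTmem _))
        (Subgroup.zpow_mem _ hUmem _)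
    have hentry : (γ * ModularGroup.T ^ n * U ^ (-m)) 1 0 = γ 1 0 + m * (4 * d') := by
      rw [hUm, sl_mul_apply, (S_mul_T_zpow_mul_S_inv_apply _ 0).1,
        (S_mul_T_zpow_mul_S_inv_apply _ 0).2, sl_mul_apply, sl_mul_apply, hd']
      simp [ModularGroup.coe_T_zpow]
      ring
    have hlt' : ((γ * ModularGroup.T ^ n * U ^ (-m)) 1 0).natAbs < N := by
      rw [← hN, hentry]
      rw [Int.abs_eq_natAbs, Int.abs_eq_natAbs] at hlt
      exact_mod_cast hlt
    have := ih _ hlt' hmem rfl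
    have h2 : γ = (γ * ModularGroup.T ^ n * U ^ (-m)) * (U ^ (-m))⁻¹ * (ModularGroup.T ^ n)⁻¹ := by
      group
    rw [h2]
    exact K.mul_mem (K.mul_mem this (K.inv_mem (K.zpow_mem hU _))) (K.inv_mem (K.zpow_mem hT _))

/-! ### Generalized `q`-series -/

/-- The series `∑ᵢ cᵢ q^{Qᵢ}` with real exponents. -/
def qSeries {ι : Type*} (c : ι → ℂ) (Q : ι → ℝ) (τ : ℍ) : ℂ :=
  ∑' i, c i * cexp (2 * Real.pi * I * Q i * τ)

lemma norm_mul_cexp_two_pi_I (c : ℂ) (Q : ℝ) (z : ℂ) :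
    ‖c * cexp (2 * Real.pi * I * Q * z)‖ = ‖c‖ * Real.exp (-(2 * Real.pi * Q * z.im)) := by
  rw [norm_mul, Complex.norm_exp]
  congr 2
  simp

/-- Compare with height `y`: moving up multiplies the term by `e^{-2πQ(Im z - y)}`. This yields
uniform convergence on half-planes and the rate of decay at `i∞`. -/
lemma norm_qSeries_term_le {ε Q : ℝ} {c z : ℂ} {y : ℝ} (hQ : c ≠ 0 → ε ≤ Q)
    (hz : y ≤ z.im) : ‖c * cexp (2 * Real.pi * I * Q * z)‖ ≤
      Real.exp (-(2 * Real.pi * ε * (z.im - y))) * (‖c‖ * Real.exp (-(2 * Real.pi * Q * y))) := by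
  rw [norm_mul_cexp_two_pi_I, mul_left_comm, ← Real.exp_add]
  by_cases hc : c = 0
  · simp [hc]
  · gcongr
    have h1 := mul_le_mul_of_nonneg_right (hQ hc) (sub_nonneg.mpr hz)
    have h2 := mul_le_mul_of_nonneg_left h1 Real.two_pi_pos.le
    nlinarith

lemma summable_norm_qSeries_term {ι : Type*} {c : ι → ℂ} {Q : ι → ℝ}
    (hs : ∀ τ : ℍ, Summable fun i => c i * cexp (2 * Real.pi * I * Q i * τ)) {y : ℝ} (hy : 0 < y) :
    Summable fun i => ‖c i‖ * Real.exp (-(2 * Real.pi * Q i * y)) := by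
  refine (hs ⟨y * I, by simpa using hy⟩).norm.congr fun i => ?_
  rw [norm_mul_cexp_two_pi_I]
  simp

/-- A `q`-series is `O(q^ε)` if all its exponents are at least `ε`. -/
lemma norm_qSeries_le {ι : Type*} {c : ι → ℂ} {Q : ι → ℝ} {ε : ℝ}
    (hQ : ∀ i, c i ≠ 0 → ε ≤ Q i)
    (hs : ∀ τ : ℍ, Summable fun i => c i * cexp (2 * Real.pi * I * Q i * τ)) {τ : ℍ}
    (hτ : 1 ≤ τ.im) : ‖qSeries c Q τ‖ ≤ Real.exp (-(2 * Real.pi * ε * (τ.im - 1))) *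
      ∑' i, ‖c i‖ * Real.exp (-(2 * Real.pi * Q i * 1)) := by
  rw [← tsum_mul_left]
  exact tsum_of_norm_bounded ((summable_norm_qSeries_term hs one_pos).mul_left _).hasSum
    fun i => norm_qSeries_term_le (hQ i) hτ

lemma mdifferentiable_qSeries {ι : Type*} {c : ι → ℂ} {Q : ι → ℝ}
    (hQ : ∀ i, c i ≠ 0 → 0 ≤ Q i)
    (hs : ∀ τ : ℍ, Summable fun i => c i * cexp (2 * Real.pi * I * Q i * τ)) :
    MDifferentiable 𝓘(ℂ) 𝓘(ℂ) (qSeries c Q) := by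
  rw [UpperHalfPlane.mdifferentiable_iff]
  intro z hz
  have hz : 0 < z.im := hz
  have hU : IsOpen {w : ℂ | z.im / 2 < w.im} := isOpen_lt continuous_const continuous_im
  have hd : DifferentiableOn ℂ (fun w : ℂ => ∑' i, c i * cexp (2 * Real.pi * I * Q i * w))
      {w : ℂ | z.im / 2 < w.im} := by
    refine differentiableOn_tsum_of_summable_norm
      (summable_norm_qSeries_term hs (half_pos hz)) (fun i => by fun_prop) hU fun i w hw => ?_
    have := norm_qSeries_term_le (hQ i) (le_of_lt hw)
    simpa using this
  have hmem : {w : ℂ | z.im / 2 < w.im} ∈ nhds z :=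
    hU.mem_nhds (by simp only [Set.mem_ofPred_eq]; linarith)
  refine ((hd.differentiableAt hmem).congr_of_eventuallyEq ?_).differentiableWithinAt
  filter_upwards [hmem] with w hw
  have hw' : 0 < w.im := (half_pos hz).trans hw
  simp [qSeries, UpperHalfPlane.ofComplex_apply_of_im_pos hw']

lemma isBoundedAtImInfty_qSeries {ι : Type*} {c : ι → ℂ} {Q : ι → ℝ}
    (hQ : ∀ i, c i ≠ 0 → 0 ≤ Q i)
    (hs : ∀ τ : ℍ, Summable fun i => c i * cexp (2 * Real.pi * I * Q i * τ)) :
    UpperHalfPlane.IsBoundedAtImInfty (qSeries c Q) :=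
  UpperHalfPlane.isBoundedAtImInfty_iff.mpr ⟨_, 1, fun τ hτ => by
    simpa using norm_qSeries_le hQ hs hτ⟩

lemma tendsto_exp_neg_mul_sub_one {ε : ℝ} (hε : 0 < ε) (C : ℝ) :
    Filter.Tendsto (fun y : ℝ => Real.exp (-(2 * Real.pi * ε * (y - 1))) * C) Filter.atTop
      (nhds 0) := by
  have h : Filter.Tendsto (fun y : ℝ => 2 * Real.pi * ε * (y - 1)) Filter.atTop Filter.atTop :=
    (Filter.tendsto_atTop_add_const_right _ (-1) Filter.tendsto_id).const_mul_atTop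
      (by positivity)
  simpa using (Real.tendsto_exp_neg_atTop_nhds_zero.comp h).mul_const C

lemma isZeroAtImInfty_qSeries {ι : Type*} {c : ι → ℂ} {Q : ι → ℝ} {ε : ℝ} (hε : 0 < ε)
    (hQ : ∀ i, c i ≠ 0 → ε ≤ Q i)
    (hs : ∀ τ : ℍ, Summable fun i => c i * cexp (2 * Real.pi * I * Q i * τ)) :
    UpperHalfPlane.IsZeroAtImInfty (qSeries c Q) := by
  rw [UpperHalfPlane.isZeroAtImInfty_iff]
  intro δ hδ
  obtain ⟨A, hA⟩ := Filter.eventually_atTop.mp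
    ((tendsto_exp_neg_mul_sub_one hε _).eventually_le_const hδ)
  exact ⟨max A 1, fun τ hτ => (norm_qSeries_le hQ hs (le_of_max_le_right hτ)).trans
    (hA _ (le_of_max_le_left hτ))⟩

/-! ### Two theta functions -/

/-- `∑ q^{k²}`, summed over `k ∈ (1 + ℓ)/2 + ℤ`. -/
def fTheta (l : ℤ) (τ : ℍ) : ℂ := ∑' n : ℤ, linTerm 1 0 ((1 + l) / 2) 0 (2 * τ) n

/-- `∑ ν e^{πiν} q^{ν²/2}`, summed over `ν ∈ 1/2 + ℤ`. -/
def gTheta (τ : ℍ) : ℂ := ∑' n : ℤ, linTerm 0 1 (1 / 2) (1 / 2) τ n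

lemma two_mul_im_pos (τ : ℍ) : 0 < (2 * (τ : ℂ)).im := by
  have := τ.im_pos
  simpa using this

lemma fTheta_term (l n : ℤ) (τ : ℍ) : linTerm 1 0 ((1 + l) / 2) 0 (2 * τ) n =
    1 * cexp (2 * Real.pi * I * (((n + (1 + l) / 2) ^ 2 : ℝ) : ℂ) * τ) := by
  rw [linTerm]
  push_cast
  congr 1
  · ring
  · congr 1; ring

lemma gTheta_term (n : ℤ) (τ : ℍ) : linTerm 0 1 (1 / 2) (1 / 2) τ n =
    ((n + 1 / 2) * cexp (Real.pi * I * (n + 1 / 2))) *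
      cexp (2 * Real.pi * I * (((n + 1 / 2) ^ 2 / 2 : ℝ) : ℂ) * τ) := by
  rw [linTerm, mul_assoc (n + 1 / 2 : ℂ), ← Complex.exp_add]
  push_cast
  congr 1
  · ring
  · congr 1; ring

lemma summable_fTheta (l : ℤ) (τ : ℍ) : Summable fun n : ℤ =>
    (1 : ℂ) * cexp (2 * Real.pi * I * (((n + (1 + l) / 2) ^ 2 : ℝ) : ℂ) * τ) :=
  (summable_linTerm 1 0 ((1 + l) / 2) 0 (two_mul_im_pos τ)).congr fun n => fTheta_term l n τ

lemma summable_gTheta (τ : ℍ) : Summable fun n : ℤ =>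
    ((n + 1 / 2) * cexp (Real.pi * I * (n + 1 / 2))) *
      cexp (2 * Real.pi * I * (((n + 1 / 2) ^ 2 / 2 : ℝ) : ℂ) * τ) :=
  (summable_linTerm 0 1 (1 / 2) (1 / 2) (d := τ) τ.im_pos).congr fun n => gTheta_term n τ

lemma fTheta_eq_qSeries (l : ℤ) :
    fTheta l = qSeries (fun _ : ℤ => 1) fun n => (n + (1 + l) / 2) ^ 2 :=
  funext fun τ => tsum_congr fun n => fTheta_term l n τ

lemma gTheta_eq_qSeries : gTheta = qSeries
    (fun n : ℤ => (n + 1 / 2) * cexp (Real.pi * I * (n + 1 / 2))) fun n => (n + 1 / 2) ^ 2 / 2 :=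
  funext fun τ => tsum_congr fun n => gTheta_term n τ

lemma quarter_le_sq_add_half (n : ℤ) : (1 / 4 : ℝ) ≤ (n + 1 / 2) ^ 2 := by
  have h : (0 : ℤ) ≤ n * (n + 1) := by
    rcases le_or_gt 0 n with h | h
    · positivity
    · exact mul_nonneg_of_nonpos_of_nonpos h.le (by omega)
  have : (0 : ℝ) ≤ n * (n + 1) := by exact_mod_cast h
  nlinarith

lemma mdifferentiable_fTheta (l : ℤ) : MDifferentiable 𝓘(ℂ) 𝓘(ℂ) (fTheta l) := by
  rw [fTheta_eq_qSeries]
  exact mdifferentiable_qSeries (fun _ _ => sq_nonneg _) (summable_fTheta l)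

lemma isBoundedAtImInfty_fTheta (l : ℤ) : UpperHalfPlane.IsBoundedAtImInfty (fTheta l) := by
  rw [fTheta_eq_qSeries]
  exact isBoundedAtImInfty_qSeries (fun _ _ => sq_nonneg _) (summable_fTheta l)

lemma mdifferentiable_gTheta : MDifferentiable 𝓘(ℂ) 𝓘(ℂ) gTheta := by
  rw [gTheta_eq_qSeries]
  exact mdifferentiable_qSeries (fun _ _ => by positivity) summable_gTheta

lemma isZeroAtImInfty_gTheta : UpperHalfPlane.IsZeroAtImInfty gTheta := by
  rw [gTheta_eq_qSeries]
  refine isZeroAtImInfty_qSeries (ε := 1 / 8) (by norm_num) (fun n _ => ?_) summable_gTheta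
  linarith [quarter_le_sq_add_half n]

lemma cexp_eq_cexp_of_sub_int {x y : ℂ} (n : ℤ) (h : x = y + n * (2 * Real.pi * I)) :
    cexp x = cexp y := by
  rw [h, Complex.exp_add, exp_int_mul_two_pi_mul_I, mul_one]

lemma fTheta_T_smul (l : ℤ) (τ : ℍ) : fTheta l (ModularGroup.T • τ) =
    cexp (2 * Real.pi * I * ((1 + l) / 2) ^ 2) * fTheta l τ := by
  rw [fTheta, fTheta, ← tsum_mul_left]
  refine tsum_congr fun n => ?_
  rw [linTerm, linTerm, coe_T_smul, mul_left_comm (cexp _), ← Complex.exp_add]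
  congr 1
  refine cexp_eq_cexp_of_sub_int (n ^ 2 + n * (1 + l)) ?_
  push_cast
  ring

lemma gTheta_T_smul (τ : ℍ) :
    gTheta (ModularGroup.T • τ) = cexp ((Real.pi / 4 : ℝ) * I) * gTheta τ := by
  rw [gTheta, gTheta, ← tsum_mul_left]
  refine tsum_congr fun n => ?_
  rw [linTerm, linTerm, coe_T_smul, mul_left_comm (cexp _), ← Complex.exp_add]
  congr 1
  obtain ⟨k, hk⟩ := Int.even_mul_succ_self n
  refine cexp_eq_cexp_of_sub_int k ?_
  have : (n : ℂ) * (n + 1) = k + k := by exact_mod_cast hk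
  push_cast
  linear_combination (Real.pi * I) * this

lemma cexp_int_mul_pi (n : ℤ) : cexp (Real.pi * I * n) = (-1) ^ n := by
  rw [mul_comm, Complex.exp_int_mul, exp_pi_mul_I]

/-- The Poisson dual runs over all integers `m` with exponent `(m/2)²` at `-1/τ`. Even `m` give the
integral class `fTheta 1`, and odd `m` give the half-integral class `fTheta 0` with the sign
`(-1)^{1+l}`. -/
lemma fTheta_inversion (l : ℤ) (τ : ℍ) : (-I * (2 * τ)) ^ (1 / 2 : ℂ) * fTheta l τ =
    fTheta 1 (ModularGroup.S • τ) + (-1) ^ (1 + l) * fTheta 0 (ModularGroup.S • τ) := by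
  have h0 : (τ : ℂ) ≠ 0 := τ.ne_zero
  have h := hasSum_linTermDual 1 0 ((1 + l) / 2) 0 (two_mul_im_pos τ)
  rw [fTheta, ← h.tsum_eq, tsum_eq_add_of_isCompl h.summable (g₀ := fun k : ℤ => 2 * k + 0)
    (g₁ := fun k : ℤ => 2 * k + 1) (fun a b h => by simpa using h)
    (fun a b h => by simpa using h) even_odd_isCompl, fTheta, fTheta, ← tsum_mul_left]
  congr 1
  · rw [← (Equiv.addRight (1 : ℤ)).tsum_eq]
    refine tsum_congr fun k => ?_
    rw [linTermDual, linTerm, coe_S_smul]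
    congr 1
    · simp
    · refine cexp_eq_cexp_of_sub_int ((k + 1) * (1 + l)) ?_
      simp only [Equiv.coe_addRight]
      push_cast
      field_simp
      ring
  · refine tsum_congr fun k => ?_
    rw [linTermDual, linTerm, coe_S_smul, ← cexp_int_mul_pi, mul_left_comm (cexp _), ← Complex.exp_add]
    congr 1
    · simp
    · refine cexp_eq_cexp_of_sub_int (k * (1 + l)) ?_
      push_cast
      field_simp
      ring

/-- The half-integral class with half-integral character is its own Poisson dual; the linear factor
contributes `1/τ` and the phases contribute `I`. -/
lemma gTheta_inversion (τ : ℍ) :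
    (-I * τ) ^ (1 / 2 : ℂ) * gTheta τ = I / τ * gTheta (ModularGroup.S • τ) := by
  have h0 : (τ : ℂ) ≠ 0 := τ.ne_zero
  have h := hasSum_linTermDual 0 1 (1 / 2) (1 / 2) (d := τ) τ.im_pos
  rw [gTheta, ← h.tsum_eq, ← (Equiv.addRight (1 : ℤ)).tsum_eq, gTheta, ← tsum_mul_left]
  refine tsum_congr fun k => ?_
  have hI : cexp (Real.pi / 2 * I) = I := Complex.exp_pi_div_two_mul_I
  have e : ∀ x y : ℂ, I / τ * (y * cexp x) = y / τ * cexp (Real.pi / 2 * I + x) := fun x y => by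
    rw [Complex.exp_add, hI]; ring
  rw [linTermDual, linTerm, coe_S_smul, e]
  congr 1
  · simp only [Equiv.coe_addRight]; push_cast; ring
  · congr 1
    simp only [Equiv.coe_addRight]
    push_cast
    field_simp
    ring

/-! ### Modularity of the theta functions -/

lemma neg_I_mul_re_pos (τ : ℍ) : 0 < (-I * (τ : ℂ)).re := by
  have := τ.im_pos
  simpa using this

/-- `-Iτ` has argument in `(-π/2, π/2)`, so adding the argument `π/2` of `I` stays inside the
principal range. -/
lemma coe_cpow_eq (τ : ℍ) (s : ℂ) : (τ : ℂ) ^ s = I ^ s * (-I * (τ : ℂ)) ^ s := by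
  have h := abs_lt.mp (abs_arg_lt_pi_div_two_iff.mpr (Or.inl (neg_I_mul_re_pos τ)))
  have h0 : -I * (τ : ℂ) ≠ 0 := mul_ne_zero (neg_ne_zero.mpr I_ne_zero) τ.ne_zero
  have e : (τ : ℂ) = I * (-I * τ) := by rw [← mul_assoc]; simp
  have hl : log (τ : ℂ) = log I + log (-I * τ) := by
    conv_lhs => rw [e]
    rw [Complex.log_mul I_ne_zero h0]
    rw [arg_I]
    constructor <;> linarith [h.1, h.2, Real.pi_pos]
  rw [cpow_def_of_ne_zero τ.ne_zero, cpow_def_of_ne_zero I_ne_zero, cpow_def_of_ne_zero h0, hl,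
    add_mul, Complex.exp_add]

lemma norm_I_cpow_half : ‖I ^ (1 / 2 : ℂ)‖ = 1 := by
  have h := Complex.norm_cpow_real I (1 / 2)
  push_cast at h
  rw [h, Complex.norm_I, Real.one_rpow]

lemma two_cpow_half : (2 : ℂ) ^ (1 / 2 : ℂ) = (Real.sqrt 2 : ℂ) := by
  rw [Real.sqrt_eq_rpow, ofReal_cpow (by norm_num)]
  push_cast
  rfl

lemma neg_I_mul_two_mul_cpow (τ : ℍ) : (-I * (2 * (τ : ℂ))) ^ (1 / 2 : ℂ) =
    Real.sqrt 2 * ((I ^ (1 / 2 : ℂ))⁻¹ * (τ : ℂ) ^ (1 / 2 : ℂ)) := by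
  have hI : I ^ (1 / 2 : ℂ) ≠ 0 := by simp [cpow_eq_zero_iff]
  have h0 : -I * (τ : ℂ) ≠ 0 := mul_ne_zero (neg_ne_zero.mpr I_ne_zero) τ.ne_zero
  have e : -I * (2 * (τ : ℂ)) = ((2 : ℝ) : ℂ) * (-I * τ) := by push_cast; ring
  rw [coe_cpow_eq, inv_mul_cancel_left₀ hI, e, ← two_cpow_half, cpow_def_of_ne_zero (mul_ne_zero (by norm_num) h0),
    Complex.log_ofReal_mul two_pos h0, add_mul, Complex.exp_add, ← cpow_def_of_ne_zero h0,
    Complex.ofReal_log two_pos.le, cpow_def_of_ne_zero two_ne_zero]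
  norm_num

/-! ### The theta functions as modular forms -/

lemma cpow_neg_mul_cpow {x : ℂ} (hx : x ≠ 0) (w : ℂ) : x ^ (-w) * x ^ w = 1 := by
  rw [← cpow_add _ _ hx, neg_add_cancel, cpow_zero]

/-- At every cusp a component becomes a linear combination of the components at `i∞`, so boundedness
at all cusps follows from boundedness of the vector at one. -/
lemma isModularForm_of_vecTransforms {d : ℕ} {w : ℝ} {F : ℍ → Fin d → ℂ} {Γ : Subgroup SL(2, ℤ)}
    (hF : ∀ γ, ∃ M, VecTransforms w F γ M)
    (hb : ∀ i, UpperHalfPlane.IsBoundedAtImInfty fun τ => F τ i) {i : Fin d}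
    (hd : MDifferentiable 𝓘(ℂ) 𝓘(ℂ) fun τ => F τ i)
    (hΓ : Γ ≤ multiplierSubgroup w fun τ => F τ i) : IsModularForm Γ w fun τ => F τ i := by
  refine ⟨hd, ?_, fun γ => ?_⟩
  · choose v hv using fun γ : Γ => hΓ γ.2
    exact ⟨v, fun γ => (hv γ).1, fun γ => (hv γ).2⟩
  · obtain ⟨M, hM⟩ := hF γ
    have e : (fun τ => autFactor γ τ ^ (-w : ℂ) * F (γ • τ) i) = fun τ => ∑ j, M i j * F τ j := by
      funext τ
      rw [hM, Pi.smul_apply, smul_eq_mul, ← mul_assoc, cpow_neg_mul_cpow (autFactor_ne_zero γ τ),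
        one_mul]
      rfl
    rw [e]
    choose B A hAB using fun j => UpperHalfPlane.isBoundedAtImInfty_iff.mp (hb j)
    rw [UpperHalfPlane.isBoundedAtImInfty_iff]
    refine ⟨∑ j, ‖M i j‖ * B j, ∑ j, |A j|, fun τ hτ => (norm_sum_le _ _).trans ?_⟩
    refine Finset.sum_le_sum fun j _ => ?_
    rw [norm_mul]
    refine mul_le_mul_of_nonneg_left (hAB j τ ?_) (norm_nonneg _)
    exact (le_abs_self _).trans
      ((Finset.single_le_sum (fun k _ => abs_nonneg (A k)) (Finset.mem_univ j)).trans hτ)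

lemma IsModularForm.const_mul {Γ : Subgroup SL(2, ℤ)} {w : ℝ} {f : ℍ → ℂ}
    (h : IsModularForm Γ w f) (c : ℂ) : IsModularForm Γ w fun τ => c * f τ := by
  obtain ⟨v, hv, e⟩ := h.modular
  refine ⟨mdifferentiable_const.mul h.holo, ⟨v, hv, fun γ τ => by rw [e]; ring⟩, fun γ => ?_⟩
  obtain ⟨B, A, hB⟩ := UpperHalfPlane.isBoundedAtImInfty_iff.mp (h.cusps γ)
  refine UpperHalfPlane.isBoundedAtImInfty_iff.mpr ⟨‖c‖ * B, A, fun τ hτ => ?_⟩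
  rw [mul_left_comm, norm_mul]
  exact mul_le_mul_of_nonneg_left (hB τ hτ) (norm_nonneg _)

/-- When all of `SL₂(ℤ)` acts by multipliers, vanishing at `i∞` carries over to every cusp. -/
lemma isCuspForm_of_multiplierSubgroup {w : ℝ} {f : ℍ → ℂ}
    (hd : MDifferentiable 𝓘(ℂ) 𝓘(ℂ) f) (h0 : UpperHalfPlane.IsZeroAtImInfty f)
    (h : multiplierSubgroup w f = ⊤) (Γ : Subgroup SL(2, ℤ)) : IsCuspForm Γ w f := by
  have hz : ∀ γ : SL(2, ℤ), UpperHalfPlane.IsZeroAtImInfty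
      fun τ => autFactor γ τ ^ (-w : ℂ) * f (γ • τ) := by
    intro γ
    obtain ⟨v, hv, e⟩ : γ ∈ multiplierSubgroup w f := h ▸ Subgroup.mem_top γ
    rw [UpperHalfPlane.isZeroAtImInfty_iff] at h0 ⊢
    intro ε hε
    obtain ⟨A, hA⟩ := h0 ε hε
    refine ⟨A, fun τ hτ => ?_⟩
    rw [e, mul_assoc, mul_left_comm, ← mul_assoc (autFactor γ τ ^ (-w : ℂ)),
      cpow_neg_mul_cpow (autFactor_ne_zero γ τ), one_mul, norm_mul, hv, one_mul]
    exact hA τ hτ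
  refine ⟨⟨hd, ?_, fun γ => (hz γ).isBoundedAtImInfty⟩, hz⟩
  choose v hv using fun γ : Γ => (h ▸ Subgroup.mem_top γ.1 : γ.1 ∈ multiplierSubgroup w f)
  exact ⟨v, fun γ => (hv γ).1, fun γ => (hv γ).2⟩

lemma gTheta_multiplierSubgroup : multiplierSubgroup (3 / 2) gTheta = ⊤ := by
  rw [eq_top_iff, ← SpecialLinearGroup.SL2Z_generators, Subgroup.closure_le]
  rintro γ (rfl | rfl)
  · refine ⟨-I * (I ^ (1 / 2 : ℂ))⁻¹, by simp [norm_I_cpow_half, -one_div], fun τ => ?_⟩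
    have h0 : (τ : ℂ) ≠ 0 := τ.ne_zero
    have hI : I ^ (1 / 2 : ℂ) ≠ 0 := by simp [cpow_eq_zero_iff]
    have h := gTheta_inversion τ
    have e : (τ : ℂ) ^ ((3 / 2 : ℝ) : ℂ) = τ * (I ^ (1 / 2 : ℂ) * (-I * (τ : ℂ)) ^ (1 / 2 : ℂ)) := by
      rw [← coe_cpow_eq]
      have : ((3 / 2 : ℝ) : ℂ) = 1 + 1 / 2 := by push_cast; norm_num
      rw [this, cpow_add _ _ h0, cpow_one]
    have e2 : gTheta (ModularGroup.S • τ) =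
        -I * τ * (I / τ * gTheta (ModularGroup.S • τ)) := by
      field_simp
      rw [I_sq]; ring
    rw [autFactor_S, e, e2, ← h]
    field_simp
  · refine ⟨cexp ((Real.pi / 4 : ℝ) * I), Complex.norm_exp_ofReal_mul_I _, fun τ => ?_⟩
    rw [gTheta_T_smul, autFactor_T, one_cpow, mul_one]

lemma isCuspForm_gTheta (Γ : Subgroup SL(2, ℤ)) : IsCuspForm Γ (3 / 2) gTheta :=
  isCuspForm_of_multiplierSubgroup mdifferentiable_gTheta isZeroAtImInfty_gTheta
    gTheta_multiplierSubgroup Γ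

/-- The vector `(f₀, f₁)` of theta functions. -/
def fVec (τ : ℍ) : Fin 2 → ℂ := fun i => fTheta (i : ℕ) τ

/-- The matrix of the inversion `τ ↦ -1/τ` on the vector `(f₀, f₁)`. -/
def fMatrix : Matrix (Fin 2) (Fin 2) ℂ := ((I ^ (1 / 2 : ℂ))⁻¹ / Real.sqrt 2) • !![-1, 1; 1, 1]

lemma ofReal_sqrt_two_sq : (Real.sqrt 2 : ℂ) ^ 2 = 2 := by
  rw [← ofReal_pow, Real.sq_sqrt (by norm_num)]; norm_num

lemma ofReal_sqrt_two_ne_zero : (Real.sqrt 2 : ℂ) ≠ 0 := by simp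

lemma vecTransforms_fVec_S : VecTransforms (1 / 2) fVec ModularGroup.S fMatrix := by
  intro τ
  have h0 := fTheta_inversion 0 τ
  have h1 := fTheta_inversion 1 τ
  rw [neg_I_mul_two_mul_cpow] at h0 h1
  have h2 := ofReal_sqrt_two_sq
  have h3 := ofReal_sqrt_two_ne_zero
  have e : ((1 / 2 : ℝ) : ℂ) = 1 / 2 := by push_cast; rfl
  rw [autFactor_S, e, fMatrix]
  generalize (I ^ (1 / 2 : ℂ))⁻¹ = κ at h0 h1 ⊢
  generalize (τ : ℂ) ^ (1 / 2 : ℂ) = X at h0 h1 ⊢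
  generalize (Real.sqrt 2 : ℂ) = r at h0 h1 h2 h3 ⊢
  have e0 : (-1 : ℂ) ^ (1 + 0 : ℤ) = -1 := by norm_num
  have e1 : (-1 : ℂ) ^ (1 + 1 : ℤ) = 1 := by norm_num
  rw [e0] at h0
  rw [e1] at h1
  have k0 : fTheta 0 (ModularGroup.S • τ) = X * (κ / r * (-fTheta 0 τ + fTheta 1 τ)) := by
    field_simp
    linear_combination (-(r / 2)) * (h1 - h0) + (X * κ * (fTheta 1 τ - fTheta 0 τ) / 2) * h2
  have k1 : fTheta 1 (ModularGroup.S • τ) = X * (κ / r * (fTheta 0 τ + fTheta 1 τ)) := by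
    field_simp
    linear_combination (-(r / 2)) * (h1 + h0) + (X * κ * (fTheta 1 τ + fTheta 0 τ) / 2) * h2
  ext i
  fin_cases i
  · simpa [fVec, vecHead, vecTail, mul_add, -ModularGroup.sl_moeb] using k0
  · simpa [fVec, vecHead, vecTail, mul_add, -ModularGroup.sl_moeb] using k1

lemma fMatrix_mul_self : fMatrix * fMatrix = ((I ^ (1 / 2 : ℂ))⁻¹ ^ 2) • 1 := by
  have h2 := ofReal_sqrt_two_sq
  have h3 := ofReal_sqrt_two_ne_zero
  have e : (!![-1, 1; 1, 1] : Matrix (Fin 2) (Fin 2) ℂ) * !![-1, 1; 1, 1] = (2 : ℂ) • 1 := by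
    ext i j; fin_cases i <;> fin_cases j <;> norm_num [Matrix.mul_apply, Fin.sum_univ_two]
  rw [fMatrix, smul_mul_smul_comm, e, smul_smul]
  congr 1
  field_simp
  rw [h2]

lemma inv_smul_fMatrix_mul_self : ((I ^ (1 / 2 : ℂ)) ^ 2 • fMatrix) * fMatrix = 1 := by
  have hI : I ^ (1 / 2 : ℂ) ≠ 0 := by simp [cpow_eq_zero_iff]
  rw [Matrix.smul_mul, fMatrix_mul_self, smul_smul, ← mul_pow, mul_inv_cancel₀ hI, one_pow,
    one_smul]

lemma vecTransforms_fVec_T : VecTransforms (1 / 2) fVec ModularGroup.T !![I, 0; 0, 1] := by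
  intro τ
  rw [autFactor_T, one_cpow, one_smul]
  have e0 : cexp (2 * Real.pi * I * ((1 + (0 : ℤ)) / 2) ^ 2) = I := by
    refine Eq.trans (congrArg _ ?_) Complex.exp_pi_div_two_mul_I; push_cast; ring
  have e1 : cexp (2 * Real.pi * I * ((1 + (1 : ℤ)) / 2) ^ 2) = 1 := by
    refine Eq.trans (congrArg _ ?_) Complex.exp_two_pi_mul_I; push_cast; ring
  have k0 := fTheta_T_smul 0 τ
  have k1 := fTheta_T_smul 1 τ
  rw [e0] at k0
  rw [e1, one_mul] at k1
  ext i
  fin_cases i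
  · simpa [fVec, vecHead, vecTail, mul_add, -ModularGroup.sl_moeb] using k0
  · simpa [fVec, vecHead, vecTail, mul_add, -ModularGroup.sl_moeb] using k1

lemma vecTransforms_fVec_T_zpow_four :
    VecTransforms (1 / 2) fVec (ModularGroup.T ^ (4 : ℤ)) 1 := by
  intro τ
  have hT : ∀ τ : ℍ, fVec (ModularGroup.T • τ) = !![I, 0; 0, 1] *ᵥ fVec τ := fun τ => by
    have := vecTransforms_fVec_T τ
    rwa [autFactor_T, one_cpow, one_smul] at this
  have e : ModularGroup.T ^ (4 : ℤ) • τ =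
      ModularGroup.T • ModularGroup.T • ModularGroup.T • ModularGroup.T • τ := by
    simp only [← mul_smul]; rfl
  have e2 : (!![I, 0; 0, 1] * !![I, 0; 0, 1] * !![I, 0; 0, 1] * !![I, 0; 0, 1] :
      Matrix (Fin 2) (Fin 2) ℂ) = 1 := by
    ext i j; fin_cases i <;> fin_cases j <;> simp [Matrix.mul_apply, Fin.sum_univ_two]
  rw [e, hT, hT, hT, hT, Matrix.mulVec_mulVec, Matrix.mulVec_mulVec, Matrix.mulVec_mulVec, e2,
    autFactor_T_zpow, one_cpow, one_smul]

lemma VecTransforms.mem_multiplierSubgroup {d : ℕ} {w : ℝ} {F : ℍ → Fin d → ℂ} {γ : SL(2, ℤ)}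
    {v : ℂ} (h : VecTransforms w F γ (v • 1)) (hv : ‖v‖ = 1) (i : Fin d) :
    γ ∈ multiplierSubgroup w fun τ => F τ i :=
  ⟨v, hv, fun τ => by
    simp only [h τ, Matrix.smul_mulVec, Matrix.one_mulVec, Pi.smul_apply, smul_eq_mul]; ring⟩

lemma neg_one_mem_multiplierSubgroup (w : ℝ) (f : ℍ → ℂ) :
    (-1 : SL(2, ℤ)) ∈ multiplierSubgroup w f := by
  have h1 : ‖(-1 : ℂ) ^ (w : ℂ)‖ = 1 := by
    rw [Complex.norm_cpow_real]; simp
  have h0 : (-1 : ℂ) ^ (w : ℂ) ≠ 0 := fun h => by simp [h] at h1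
  refine ⟨((-1 : ℂ) ^ (w : ℂ))⁻¹, by rw [norm_inv, h1, inv_one], fun τ => ?_⟩
  have e : autFactor (-1) τ = -1 := by simp [autFactor]
  rw [e, inv_mul_cancel₀ h0, one_mul, ModularGroup.SL_neg_smul, one_smul]

/-- `T` is diagonal on the vector. `S` mixes the components, but `T⁴` acts trivially, so its
conjugate by `S` acts by a scalar. -/
lemma Gamma0_four_le_multiplierSubgroup_fVec (i : Fin 2) :
    CongruenceSubgroup.Gamma0 4 ≤ multiplierSubgroup (1 / 2) fun τ => fVec τ i := by
  refine fun γ hγ => mem_of_mem_Gamma0_four ?_ (neg_one_mem_multiplierSubgroup _ _) ?_ hγ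
  · refine ⟨![I, 1] i, by fin_cases i <;> simp, fun τ => ?_⟩
    simp only [vecTransforms_fVec_T τ, autFactor_T, one_cpow, one_smul, mul_one]
    fin_cases i <;> simp [vecHead, vecTail]
  · obtain ⟨ε, hε, h⟩ := vecTransforms_fVec_S.mul vecTransforms_fVec_T_zpow_four
    obtain ⟨ε', hε', h'⟩ := vecTransforms_fVec_S.inv inv_smul_fMatrix_mul_self
    obtain ⟨ε'', hε'', h''⟩ := h.mul h'
    have e : ε'' • ((ε • (fMatrix * 1)) * (ε' • ((I ^ (1 / 2 : ℂ)) ^ 2 • fMatrix))) =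
        (ε'' * (ε * ε')) • 1 := by
      rw [smul_mul_smul_comm, smul_smul, Matrix.mul_one, mul_eq_one_comm.mp
        inv_smul_fMatrix_mul_self]
    rw [e] at h''
    exact h''.mem_multiplierSubgroup (by simp [hε, hε', hε'']) i

lemma isModularForm_fTheta (i : Fin 2) :
    IsModularForm (CongruenceSubgroup.Gamma0 4) (1 / 2) (fTheta (i : ℕ)) := by
  have hT : (!![-I, 0; 0, 1] * !![I, 0; 0, 1] : Matrix (Fin 2) (Fin 2) ℂ) = 1 := by
    ext i j; fin_cases i <;> fin_cases j <;> simp [Matrix.mul_apply, Fin.sum_univ_two]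
  exact isModularForm_of_vecTransforms (F := fVec)
    (exists_vecTransforms vecTransforms_fVec_S inv_smul_fMatrix_mul_self vecTransforms_fVec_T hT)
    (fun j => isBoundedAtImInfty_fTheta _) (mdifferentiable_fTheta _)
    (Gamma0_four_le_multiplierSubgroup_fVec i)

/-! ### The Eichler integral of `gTheta` -/

lemma integrableOn_rpow_mul_exp {a y : ℝ} (ha : 0 < a) (hy : 0 < y) :
    IntegrableOn (fun t : ℝ => (t + y) ^ (-(1 / 2) : ℝ) * Real.exp (-(Real.pi * a * t)))
      (Set.Ioi y) := by
  have h := (exp_neg_integrableOn_Ioi y (mul_pos Real.pi_pos ha)).const_mul (y ^ (-(1 / 2) : ℝ))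
  refine Integrable.mono' h ?_ ?_
  · exact Measurable.aestronglyMeasurable (by fun_prop)
  · refine (ae_restrict_iff' measurableSet_Ioi).mpr (Filter.Eventually.of_forall fun t ht => ?_)
    have ht : y < t := ht
    rw [Real.norm_of_nonneg (by have : 0 < t + y := by linarith
                                positivity), neg_mul]
    refine mul_le_mul_of_nonneg_right ?_ (Real.exp_pos _).le
    exact Real.rpow_le_rpow_of_nonpos hy (by linarith) (by norm_num)

/-- Substitute `w = a(t + y)`; the lower limit `t = y` becomes `2ay`. -/
lemma integral_rpow_mul_exp {a y : ℝ} (ha : 0 < a) (hy : 0 < y) :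
    ∫ t in Set.Ioi y, (t + y) ^ (-(1 / 2) : ℝ) * Real.exp (-(Real.pi * a * t)) =
      Real.exp (Real.pi * a * y) * a ^ (-(1 / 2) : ℝ) * beta (2 * a * y) := by
  have him : (fun t : ℝ => a * (t + y)) '' Set.Ioi y = Set.Ioi (2 * a * y) := by
    ext w
    simp only [Set.mem_image, Set.mem_Ioi]
    constructor
    · rintro ⟨t, ht, rfl⟩
      nlinarith
    · intro hw
      refine ⟨w / a - y, ?_, by field_simp; ring⟩
      rw [lt_sub_iff_add_lt, lt_div_iff₀ ha]
      linarith
  have hder : ∀ t ∈ Set.Ioi y, HasDerivWithinAt (fun t : ℝ => a * (t + y)) a (Set.Ioi y) t :=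
    fun t _ => by
      simpa using (((hasDerivAt_id t).add_const y).const_mul a).hasDerivWithinAt
  have hinj : Set.InjOn (fun t : ℝ => a * (t + y)) (Set.Ioi y) := fun s _ t _ h => by
    have := mul_left_cancel₀ ha.ne' h
    linarith
  rw [beta, ← him, integral_image_eq_integral_abs_deriv_smul measurableSet_Ioi hder hinj,
    ← integral_const_mul]
  refine setIntegral_congr_fun measurableSet_Ioi fun t ht => ?_
  have ht : y < t := ht
  have hty : 0 < t + y := by linarith
  simp only [smul_eq_mul, abs_of_pos ha]
  rw [Real.mul_rpow ha.le hty.le]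
  have e1 : a ^ (-(1 / 2) : ℝ) * a ^ (-(1 / 2) : ℝ) * a = 1 := by
    rw [← Real.rpow_add ha, ← Real.rpow_add_one ha.ne']; norm_num
  have e2 : Real.exp (-(Real.pi * a * t)) =
      Real.exp (Real.pi * a * y) * Real.exp (-Real.pi * (a * (t + y))) := by
    rw [← Real.exp_add]; congr 1; ring
  rw [e2]
  linear_combination (-(t + y) ^ (-(1 / 2) : ℝ) * (Real.exp (Real.pi * a * y) *
    Real.exp (-Real.pi * (a * (t + y))))) * e1

lemma rpow_neg_half_sq (x : ℝ) : (x ^ 2) ^ (-(1 / 2) : ℝ) = |x|⁻¹ := by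
  rw [Real.rpow_neg (sq_nonneg x), ← Real.sqrt_eq_rpow, Real.sqrt_sq_eq_abs]

lemma add_half_ne_zero (n : ℤ) : (n + 1 / 2 : ℝ) ≠ 0 := by
  have := quarter_le_sq_add_half n
  intro h
  rw [h] at this
  norm_num at this

/-- The general term of the Eichler integral of `gTheta`. -/
def eichlerTerm (τ : ℍ) (n : ℤ) : ℂ :=
  ((Real.sign (n + 1 / 2) * beta (2 * (n + 1 / 2) ^ 2 * τ.im) : ℝ) : ℂ) *
    cexp (-Real.pi * I * (n + 1 / 2) - Real.pi * I * (n + 1 / 2) ^ 2 * τ)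

/-- The terms of the series of integrands of the Eichler integral. -/
def eichlerIntegrand (τ : ℍ) (n : ℤ) (t : ℝ) : ℂ :=
  (((n + 1 / 2 : ℝ) : ℂ) * cexp (-Real.pi * I * (n + 1 / 2) - Real.pi * I * (n + 1 / 2) ^ 2 * τ.re)) *
    (((t + τ.im) ^ (-(1 / 2) : ℝ) * Real.exp (-(Real.pi * (n + 1 / 2) ^ 2 * t)) : ℝ) : ℂ)

lemma norm_eichlerIntegrand (τ : ℍ) (n : ℤ) {t : ℝ} (ht : t ∈ Set.Ioi τ.im) :
    ‖eichlerIntegrand τ n t‖ = |(n + 1 / 2 : ℝ)| *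
      ((t + τ.im) ^ (-(1 / 2) : ℝ) * Real.exp (-(Real.pi * (n + 1 / 2) ^ 2 * t))) := by
  have ht : τ.im < t := ht
  have h0 : 0 < t + τ.im := by linarith [τ.im_pos]
  have e : -Real.pi * I * ((n : ℂ) + 1 / 2) - Real.pi * I * (n + 1 / 2) ^ 2 * τ.re =
      ((-Real.pi * (n + 1 / 2) - Real.pi * (n + 1 / 2) ^ 2 * τ.re : ℝ) : ℂ) * I := by
    push_cast; ring
  rw [eichlerIntegrand, norm_mul, norm_mul, e, Complex.norm_exp_ofReal_mul_I, mul_one, norm_real,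
    norm_real, Real.norm_eq_abs, Real.norm_of_nonneg (by positivity)]

/-- With `a = ν²` the factor `a^{-1/2} = 1/|ν|` cancels the linear coefficient `ν` of the cusp form
down to its sign, and `e^{πν²y}` completes `τ.re` to `τ` in the exponent. -/
lemma integral_eichlerIntegrand (τ : ℍ) (n : ℤ) :
    ∫ t in Set.Ioi τ.im, eichlerIntegrand τ n t = eichlerTerm τ n := by
  have hν := add_half_ne_zero n
  have ha : (0 : ℝ) < (n + 1 / 2) ^ 2 := by positivity
  simp only [eichlerIntegrand]
  rw [integral_const_mul, integral_complex_ofReal, integral_rpow_mul_exp ha τ.im_pos,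
    rpow_neg_half_sq, eichlerTerm]
  have hs : Real.sign (n + 1 / 2) = (n + 1 / 2) * |(n + 1 / 2 : ℝ)|⁻¹ := by
    rcases lt_or_gt_of_ne hν with h | h
    · rw [Real.sign_of_neg h, abs_of_neg h, inv_neg, mul_neg, mul_inv_cancel₀ hν]
    · rw [Real.sign_of_pos h, abs_of_pos h, mul_inv_cancel₀ hν]
  have he : cexp (-Real.pi * I * (n + 1 / 2) - Real.pi * I * (n + 1 / 2) ^ 2 * τ) =
      cexp (-Real.pi * I * (n + 1 / 2) - Real.pi * I * (n + 1 / 2) ^ 2 * τ.re) *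
        cexp (Real.pi * (n + 1 / 2) ^ 2 * τ.im) := by
    rw [← Complex.exp_add]
    congr 1
    have : (τ : ℂ) = τ.re + τ.im * I := (Complex.re_add_im (τ : ℂ)).symm
    conv_lhs => rw [this]
    linear_combination (-Real.pi * (n + 1 / 2) ^ 2 * τ.im : ℂ) * I_sq
  rw [he, hs]
  push_cast
  ring

/-- The growth `e^{πν²y}` is beaten by `β(2ν²y) ≤ e^{-2πν²y}`, which permits termwise integration.
-/
lemma integral_norm_eichlerIntegrand_le (τ : ℍ) (n : ℤ) :
    ∫ t in Set.Ioi τ.im, ‖eichlerIntegrand τ n t‖ ≤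
      Real.exp (-(Real.pi * τ.im) * (n + 1 / 2) ^ 2) := by
  have hν := add_half_ne_zero n
  have hy := τ.im_pos
  rw [setIntegral_congr_fun measurableSet_Ioi fun t ht => norm_eichlerIntegrand τ n ht,
    integral_const_mul, integral_rpow_mul_exp (by positivity) τ.im_pos, rpow_neg_half_sq,
    mul_comm (Real.exp _), mul_assoc, mul_inv_cancel_left₀ (abs_ne_zero.mpr hν)]
  refine (mul_le_mul_of_nonneg_left (beta_le (by positivity)) (Real.exp_pos _).le).trans ?_
  rw [← Real.exp_add]
  apply le_of_eq
  congr 1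
  ring

lemma norm_eichlerTerm_le (τ : ℍ) (n : ℤ) :
    ‖eichlerTerm τ n‖ ≤ Real.exp (-(Real.pi * τ.im) * (n + 1 / 2) ^ 2) := by
  rw [← integral_eichlerIntegrand]
  exact (norm_integral_le_integral_norm _).trans (integral_norm_eichlerIntegrand_le τ n)

lemma summable_eichlerTerm (τ : ℍ) : Summable (eichlerTerm τ) :=
  Summable.of_norm_bounded (summable_gaussian_int (mul_pos Real.pi_pos τ.im_pos) (1 / 2))
    (norm_eichlerTerm_le τ)

lemma eichlerIntegral_gTheta (τ : ℍ) :
    eichlerIntegral (1 / 2) gTheta τ = ∑' n, eichlerTerm τ n := by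
  have hInt : ∀ n : ℤ, Integrable (eichlerIntegrand τ n) (volume.restrict (Set.Ioi τ.im)) := by
    intro n
    have hν := add_half_ne_zero n
    exact ((integrableOn_rpow_mul_exp (a := (n + 1 / 2) ^ 2) (by positivity)
      τ.im_pos).ofReal).const_mul _
  have hsum : Summable fun n : ℤ => ∫ t in Set.Ioi τ.im, ‖eichlerIntegrand τ n t‖ :=
    Summable.of_nonneg_of_le (fun n => integral_nonneg fun t => norm_nonneg _)
      (integral_norm_eichlerIntegrand_le τ)
      (summable_gaussian_int (mul_pos Real.pi_pos τ.im_pos) (1 / 2))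
  have h := hasSum_integral_of_summable_integral_norm hInt hsum
  simp_rw [integral_eichlerIntegrand] at h
  rw [h.tsum_eq, eichlerIntegral]
  refine setIntegral_congr_fun measurableSet_Ioi fun t ht => ?_
  have ht : τ.im < t := ht
  have ht0 : 0 < t := τ.im_pos.trans ht
  have him : 0 < ((τ.re : ℂ) + I * t).im := by simpa using ht0
  rw [UpperHalfPlane.ofComplex_apply_of_im_pos him, gTheta, Complex.conj_tsum, ← tsum_mul_left]
  refine tsum_congr fun n => ?_
  have conj_two : (starRingEnd ℂ) 2 = 2 := map_ofNat _ 2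
  have conj_intCast : (starRingEnd ℂ) (n : ℂ) = n := map_intCast _ n
  have e1 : (starRingEnd ℂ) (linTerm 0 1 (1 / 2) (1 / 2) (τ.re + I * t) n) =
      ((n + 1 / 2 : ℝ) : ℂ) * (cexp (-Real.pi * I * (n + 1 / 2) -
        Real.pi * I * (n + 1 / 2) ^ 2 * τ.re) * cexp (-(Real.pi * (n + 1 / 2) ^ 2 * t))) := by
    rw [linTerm, map_mul, ← Complex.exp_conj, ← Complex.exp_add]
    congr 1
    · simp [conj_two]
    · congr 1
      simp only [map_add, map_mul, map_pow, map_div₀, map_one, conj_two, conj_ofReal, conj_I,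
        conj_intCast]
      linear_combination (Real.pi * (n + 1 / 2) ^ 2 * t : ℂ) * I_sq
  change _ * (starRingEnd ℂ) (linTerm 0 1 (1 / 2) (1 / 2) (τ.re + I * t) n) = _
  rw [e1, eichlerIntegrand]
  push_cast
  ring

/-! ### The non-holomorphic part of `ϑ^ℓ` -/

/-- The choice `n = k - m + l` makes `ν₀ + ν₁ = k + (1 + l)/2`, and `Q = (ν₀ + ν₁)² - ν₀²/2`
separates `k` from `m`. The change of indices is unimodular, so the lattice sum is a single product
without gluing. -/
lemma betaTerm_c₁_mul_qTerm (l : ℤ) (τ : ℍ) (m k : ℤ) :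
    (betaTerm A₀ c₁ (pt l (m, k - m + l)) τ : ℂ) * qTerm A₀ b₀ (pt l (m, k - m + l)) τ =
      -(-1) ^ l * (eichlerTerm τ m * linTerm 1 0 ((1 + l) / 2) 0 (2 * τ) k) := by
  rw [betaTerm_c₁, qTerm_eq, eichlerTerm, linTerm, ← cexp_int_mul_pi]
  have hneg : ∀ x : ℂ, -cexp x = cexp (x + Real.pi * I) := fun x => by
    rw [Complex.exp_add, exp_pi_mul_I]; ring
  simp only [pt, Matrix.cons_val_zero, Matrix.cons_val_one]
  rw [show ∀ a b c d e : ℂ, -a * (b * c * ((1 + 0 * e) * d)) = b * (-a * c * d) by intros; ring,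
    hneg, ← Complex.exp_add, ← Complex.exp_add]
  congr 1
  refine cexp_eq_cexp_of_sub_int k ?_
  push_cast
  ring

lemma tsum_betaTerm_c₁ (l : ℤ) (τ : ℍ) :
    ∑' p : ℤ × ℤ, (betaTerm A₀ c₁ (pt l p) τ : ℂ) * qTerm A₀ b₀ (pt l p) τ =
      -(-1) ^ l * (fTheta l τ * eichlerIntegral (1 / 2) gTheta τ) := by
  let e : ℤ × ℤ ≃ ℤ × ℤ :=
    { toFun := fun p => (p.1, p.2 - p.1 + l)
      invFun := fun p => (p.1, p.2 + p.1 - l)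
      left_inv := fun p => Prod.ext rfl (by simp only; ring)
      right_inv := fun p => Prod.ext rfl (by simp only; ring) }
  rw [← e.tsum_eq, eichlerIntegral_gTheta, mul_comm (fTheta l τ), fTheta,
    tsum_mul_tsum_of_summable_norm (summable_eichlerTerm τ).norm
      (summable_linTerm 1 0 ((1 + l) / 2) 0 (two_mul_im_pos τ)).norm, ← tsum_mul_left]
  exact tsum_congr fun p => betaTerm_c₁_mul_qTerm l τ p.1 p.2

/-- `B(ν, c₂) = -2ν₁` involves the second coordinate only, so the inner sum vanishes. -/
lemma tsum_betaTerm_c₂ (l : ℤ) (τ : ℍ) :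
    ∑' p : ℤ × ℤ, (betaTerm A₀ c₂ (pt l p) τ : ℂ) * qTerm A₀ b₀ (pt l p) τ = 0 := by
  have h := summable_betaTerm_c₂ l τ
  simp only [betaTerm_c₂, pt, Matrix.cons_val_one] at h ⊢
  exact tsum_snd_mul_qTerm (fun n => ((Real.sign (-2 * (n + -(l / 2))) *
    beta (4 * (n + -(l / 2)) ^ 2 * τ.im) : ℝ) : ℂ)) h

lemma vartheta_eq_sub_add (l : ℤ) (τ : ℍ) : vartheta l τ = 2 * I * S l τ -
    (∑' p : ℤ × ℤ, (betaTerm A₀ c₁ (pt l p) τ : ℂ) * qTerm A₀ b₀ (pt l p) τ) +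
    ∑' p : ℤ × ℤ, (betaTerm A₀ c₂ (pt l p) τ : ℂ) * qTerm A₀ b₀ (pt l p) τ := by
  rw [vartheta_eq_tsum, ← (hasSum_sgnTerm l τ).tsum_eq,
    ← (hasSum_sgnTerm l τ).summable.tsum_sub (summable_betaTerm_c₁ l τ),
    ← ((hasSum_sgnTerm l τ).summable.sub (summable_betaTerm_c₁ l τ)).tsum_add
      (summable_betaTerm_c₂ l τ)]
  refine tsum_congr fun p => ?_
  rw [rho_eq_sgnCoeff]
  push_cast
  ring

theorem vartheta_eq_add_eichlerIntegral (l : ℤ) (τ : ℍ) : vartheta l τ =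
    2 * I * S l τ + (-1) ^ l * (fTheta l τ * eichlerIntegral (1 / 2) gTheta τ) := by
  rw [vartheta_eq_sub_add, tsum_betaTerm_c₁, tsum_betaTerm_c₂]
  ring

/-! ### `S_ℓ` as holomorphic part -/

lemma two_I_mul_S_eq_qSeries (l : ℤ) (τ : ℍ) : 2 * I * S l τ = qSeries (fun p : ℤ × ℤ =>
    (sgnCoeff (pt l p) : ℂ) * cexp (2 * Real.pi * I * bilin A₀ (pt l p) b₀))
    (fun p => quad A₀ (pt l p)) τ := by
  rw [← (hasSum_sgnTerm l τ).tsum_eq, qSeries]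
  refine tsum_congr fun p => ?_
  rw [qTerm, Complex.exp_add]
  ring

lemma summable_S_term (l : ℤ) (τ : ℍ) : Summable fun p : ℤ × ℤ =>
    ((sgnCoeff (pt l p) : ℂ) * cexp (2 * Real.pi * I * bilin A₀ (pt l p) b₀)) *
      cexp (2 * Real.pi * I * (quad A₀ (pt l p) : ℝ) * τ) :=
  (hasSum_sgnTerm l τ).summable.congr fun p => by
    rw [qTerm, Complex.exp_add]
    ring

lemma quad_nonneg_of_sgnCoeff_ne_zero {ν : Fin 2 → ℝ} (h : sgnCoeff ν ≠ 0) : 0 ≤ quad A₀ ν := by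
  have := mul_nonneg_of_sgnCoeff_ne_zero h
  rw [quad_A₀]
  nlinarith [sq_nonneg (ν 0), sq_nonneg (ν 1)]

lemma S_eq_qSeries (l : ℤ) : S l = fun τ => (1 / (2 * I)) * qSeries (fun p : ℤ × ℤ =>
    (sgnCoeff (pt l p) : ℂ) * cexp (2 * Real.pi * I * bilin A₀ (pt l p) b₀))
    (fun p => quad A₀ (pt l p)) τ := by
  funext τ
  rw [← two_I_mul_S_eq_qSeries]
  have := I_ne_zero
  field_simp

lemma mdifferentiable_S (l : ℤ) : MDifferentiable 𝓘(ℂ) 𝓘(ℂ) (S l) := by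
  rw [S_eq_qSeries]
  exact mdifferentiable_const.mul (mdifferentiable_qSeries (fun p hp =>
    quad_nonneg_of_sgnCoeff_ne_zero fun h => hp (by simp [h])) (summable_S_term l))

lemma isBoundedAtImInfty_S (l : ℤ) : UpperHalfPlane.IsBoundedAtImInfty (S l) := by
  obtain ⟨B, A, h⟩ := UpperHalfPlane.isBoundedAtImInfty_iff.mp (isBoundedAtImInfty_qSeries
    (fun p hp => quad_nonneg_of_sgnCoeff_ne_zero fun h => hp (by simp [h])) (summable_S_term l))
  refine UpperHalfPlane.isBoundedAtImInfty_iff.mpr ⟨‖1 / (2 * I)‖ * B, A, fun τ hτ => ?_⟩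
  rw [S_eq_qSeries, norm_mul]
  exact mul_le_mul_of_nonneg_left (h τ hτ) (norm_nonneg _)

/-- The completion `ϑ^ℓ / 2i` of `S_ℓ`. -/
def completion (l : ℤ) (τ : ℍ) : ℂ := vartheta l τ / (2 * I)

theorem isHolomorphicPart_S (i : Fin 2) :
    IsHolomorphicPart (CongruenceSubgroup.Gamma0 4) 1 (S (i : ℕ)) (completion (i : ℕ)) := by
  -- A single product suffices; the integer `1` supplied for `w` is twice the weight `1/2` of
  -- `fTheta`.
  refine ⟨mdifferentiable_S _, isBoundedAtImInfty_S _, 1, fun _ => 1,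
    fun _ τ => ((-1) ^ ((i : ℕ) : ℤ) / (2 * I)) * fTheta (i : ℕ) τ, fun _ => gTheta,
    fun _ => ?_, fun _ => ?_, fun τ => ?_⟩
  · simpa using (isModularForm_fTheta i).const_mul ((-1) ^ ((i : ℕ) : ℤ) / (2 * I))
  · have e : (2 - (((1 : ℤ) : ℝ) - ((1 : ℤ) : ℝ) / 2)) = 3 / 2 := by norm_num
    rw [e]
    exact isCuspForm_gTheta _
  · have e : (((1 : ℤ) : ℝ) - ((1 : ℤ) : ℝ) / 2) = 1 / 2 := by norm_num
    simp only [e, Finset.univ_unique, Finset.sum_singleton]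
    rw [completion, vartheta_eq_add_eichlerIntegral]
    have := I_ne_zero
    field_simp

/-! ### Growth of the completions -/

lemma norm_eichlerIntegral_gTheta_le {τ : ℍ} (hτ : 1 ≤ τ.im) :
    ‖eichlerIntegral (1 / 2) gTheta τ‖ ≤ ∑' n : ℤ, Real.exp (-Real.pi * (n + 1 / 2) ^ 2) := by
  rw [eichlerIntegral_gTheta]
  refine tsum_of_norm_bounded (summable_gaussian_int Real.pi_pos (1 / 2)).hasSum fun n =>
    (norm_eichlerTerm_le τ n).trans (Real.exp_le_exp.mpr ?_)
  have := mul_le_mul_of_nonneg_left hτ (by positivity : 0 ≤ Real.pi * ((n : ℝ) + 1 / 2) ^ 2)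
  linarith

lemma isBoundedAtImInfty_completion (l : ℤ) :
    UpperHalfPlane.IsBoundedAtImInfty (completion l) := by
  obtain ⟨B, A, h⟩ := UpperHalfPlane.isBoundedAtImInfty_iff.mp (isBoundedAtImInfty_S l)
  obtain ⟨B', A', h'⟩ := UpperHalfPlane.isBoundedAtImInfty_iff.mp (isBoundedAtImInfty_fTheta l)
  refine UpperHalfPlane.isBoundedAtImInfty_iff.mpr
    ⟨(2 * B + B' * ∑' n : ℤ, Real.exp (-Real.pi * (n + 1 / 2) ^ 2)) / 2, max (max A A') 1,
      fun τ hτ => ?_⟩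
  have h1 := h τ ((le_max_left _ _).trans ((le_max_left _ _).trans hτ))
  have h2 := h' τ ((le_max_right _ _).trans ((le_max_left _ _).trans hτ))
  have h3 := norm_eichlerIntegral_gTheta_le ((le_max_right _ _).trans hτ)
  rw [completion, vartheta_eq_add_eichlerIntegral, norm_div]
  have e : ‖2 * I‖ = 2 := by simp
  rw [e]
  gcongr
  refine (norm_add_le _ _).trans (add_le_add ?_ ?_)
  · rw [norm_mul, e]; gcongr
  · rw [norm_mul, norm_zpow, norm_neg, norm_one, _root_.one_zpow, one_mul, norm_mul]
    exact mul_le_mul h2 h3 (norm_nonneg _) ((norm_nonneg _).trans h2)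

/-- The two excluded points `ν = (±1/2, 0)` are the only ones in the support with exponent `1/8`;
the gap to `1/4` separates the leading term. -/
lemma quarter_le_quad_of_sgnCoeff_ne_zero {p : ℤ × ℤ} (h : sgnCoeff (pt 0 p) ≠ 0)
    (hp : p ∉ ({(0, 0), (-1, 0)} : Finset (ℤ × ℤ))) : 1 / 4 ≤ quad A₀ (pt 0 p) := by
  obtain ⟨m, n⟩ := p
  have h1 := mul_nonneg_of_sgnCoeff_ne_zero h
  rw [quad_A₀]
  simp only [pt, Matrix.cons_val_zero, Matrix.cons_val_one, Int.cast_zero, zero_div, neg_zero,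
    add_zero] at h1 ⊢
  simp only [Finset.mem_insert, Prod.mk.injEq, Finset.mem_singleton, not_or, not_and] at hp
  by_cases hn : n = 0
  · subst hn
    have hm : 2 ≤ m * (m + 1) := by
      rcases le_or_gt 1 m with h | h
      · nlinarith
      · have h2 : m ≠ 0 := fun h0 => hp.1 h0 rfl
        have h3 : m ≠ -1 := fun h0 => hp.2 h0 rfl
        have : m ≤ -2 := by omega
        nlinarith
    have : (2 : ℝ) ≤ m * (m + 1) := by exact_mod_cast hm
    push_cast
    nlinarith
  · have hn2 : (1 : ℝ) ≤ (n : ℝ) ^ 2 := by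
      have : 0 < n ^ 2 := by positivity
      have : 1 ≤ n ^ 2 := this
      exact_mod_cast this
    nlinarith [sq_nonneg ((m : ℝ) + 1 / 2)]

/-- The leading term of `2i S₀` is `2i q^{1/8}`. -/
lemma exists_norm_two_I_mul_S_zero_sub_le : ∃ C : ℝ, ∀ τ : ℍ, 1 ≤ τ.im →
    ‖2 * I * S 0 τ - 2 * I * cexp (2 * Real.pi * I * (1 / 8) * τ)‖ ≤
      Real.exp (-(2 * Real.pi * (1 / 4) * (τ.im - 1))) * C := by
  refine ⟨∑' p : {p : ℤ × ℤ // p ∉ ({(0, 0), (-1, 0)} : Finset (ℤ × ℤ))},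
    ‖(sgnCoeff (pt 0 p.1) : ℂ) * cexp (2 * Real.pi * I * bilin A₀ (pt 0 p.1) b₀)‖ *
      Real.exp (-(2 * Real.pi * quad A₀ (pt 0 p.1) * 1)), fun τ hτ => ?_⟩
  have hs : (∑ p ∈ ({(0, 0), (-1, 0)} : Finset (ℤ × ℤ)),
      (sgnCoeff (pt 0 p) : ℂ) * cexp (2 * Real.pi * I * bilin A₀ (pt 0 p) b₀) *
        cexp (2 * Real.pi * I * (quad A₀ (pt 0 p) : ℝ) * τ)) =
      2 * I * cexp (2 * Real.pi * I * (1 / 8) * τ) := by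
    have e1 : cexp (2 * Real.pi * I * (1 / 4)) = I := by
      refine Eq.trans (congrArg _ ?_) Complex.exp_pi_div_two_mul_I; ring
    have e2 : cexp (2 * Real.pi * I * (-(1 / 4))) = -I := by
      rw [mul_neg, Complex.exp_neg, e1, inv_I]
    have k0 : pt 0 (0, 0) = ![1 / 2, 0] := by simp [pt]
    have k1 : pt 0 (-1, 0) = ![-(1 / 2), 0] := by simp [pt]; norm_num
    have s0 : Real.sign (1 / 2) = 1 := Real.sign_of_pos (by norm_num)
    have s1 : Real.sign (-(1 / 2)) = -1 := Real.sign_of_neg (by norm_num)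
    rw [Finset.sum_pair (by decide), k0, k1, sgnCoeff_eq, sgnCoeff_eq, bilin_b₀, bilin_b₀, quad_A₀,
      quad_A₀]
    simp only [Matrix.cons_val_zero, Matrix.cons_val_one, s0, s1, Real.sign_zero]
    have q0 : (((1 / 2 : ℝ) / 2 + 0 : ℝ) : ℂ) = 1 / 4 := by push_cast; norm_num
    have q1 : ((-(1 / 2 : ℝ) / 2 + 0 : ℝ) : ℂ) = -(1 / 4) := by push_cast; norm_num
    have r0 : (((1 / 2 : ℝ) ^ 2 / 2 + 2 * (1 / 2) * 0 + 0 ^ 2 : ℝ) : ℂ) = 1 / 8 := by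
      push_cast; norm_num
    have r1 : (((-(1 / 2) : ℝ) ^ 2 / 2 + 2 * (-(1 / 2)) * 0 + 0 ^ 2 : ℝ) : ℂ) = 1 / 8 := by
      push_cast; norm_num
    rw [q0, q1, r0, r1, e1, e2]
    push_cast
    ring
  have h := (summable_S_term 0 τ).sum_add_tsum_subtype_compl {(0, 0), (-1, 0)}
  rw [hs] at h
  rw [two_I_mul_S_eq_qSeries, qSeries, ← h, add_sub_cancel_left]
  exact norm_qSeries_le (ι := {p : ℤ × ℤ // p ∉ ({(0, 0), (-1, 0)} : Finset (ℤ × ℤ))})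
    (c := fun p => (sgnCoeff (pt 0 p.1) : ℂ) * cexp (2 * Real.pi * I * bilin A₀ (pt 0 p.1) b₀))
    (Q := fun p => quad A₀ (pt 0 p.1))
    (fun p hp => quarter_le_quad_of_sgnCoeff_ne_zero (fun h => hp (by simp [h])) p.2)
    (fun τ => (summable_S_term 0 τ).subtype _) hτ

lemma exists_norm_fTheta_zero_le : ∃ C : ℝ, ∀ τ : ℍ, 1 ≤ τ.im →
    ‖fTheta 0 τ‖ ≤ Real.exp (-(2 * Real.pi * (1 / 4) * (τ.im - 1))) * C := by
  rw [fTheta_eq_qSeries]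
  exact ⟨_, fun τ hτ => norm_qSeries_le
    (fun n _ => by simpa using quarter_le_sq_add_half n) (summable_fTheta 0) hτ⟩

/-- If it vanished identically, the leading term `2i q^{1/8}` would equal a quantity of size
`O(q^{1/4})`: the rest of `2i S₀`, together with `fTheta 0 = O(q^{1/4})` times a bounded Eichler
integral. This is impossible as `Im τ → ∞`. -/
lemma exists_completion_zero_ne_zero : ∃ τ : ℍ, completion 0 τ ≠ 0 := by
  by_contra! hc
  obtain ⟨C, hC⟩ := exists_norm_two_I_mul_S_zero_sub_le
  obtain ⟨D, hD⟩ := exists_norm_fTheta_zero_le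
  set E : ℝ := ∑' n : ℤ, Real.exp (-Real.pi * (n + 1 / 2) ^ 2) with hE
  have key : ∀ y : ℝ, 1 ≤ y → 2 * Real.exp (-(Real.pi / 4)) ≤
      Real.exp (-(2 * Real.pi * (1 / 8) * (y - 1))) * (C + D * E) := by
    intro y hy
    obtain ⟨τ, hτ⟩ : ∃ τ : ℍ, τ.im = y :=
      ⟨⟨y * I, by simpa using one_pos.trans_le hy⟩, by simp [UpperHalfPlane.im]⟩
    have h1 := hC τ (hτ ▸ hy)
    have h2 := hD τ (hτ ▸ hy)
    have h3 := norm_eichlerIntegral_gTheta_le (τ := τ) (hτ ▸ hy)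
    have h4 : vartheta 0 τ = 0 := by
      have := hc τ
      rw [completion, div_eq_zero_iff] at this
      simpa using this
    rw [vartheta_eq_add_eichlerIntegral, _root_.zpow_zero, one_mul] at h4
    have h5 : ‖2 * I * cexp (2 * Real.pi * I * (1 / 8) * τ)‖ =
        2 * Real.exp (-(Real.pi / 4)) * Real.exp (-(2 * Real.pi * (1 / 8) * (y - 1))) := by
      have := norm_mul_cexp_two_pi_I (2 * I) (1 / 8) τ
      push_cast at this
      rw [this, mul_assoc (2 : ℝ) (Real.exp _), ← Real.exp_add]
      congr 1
      · simp
      · congr 1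
        rw [UpperHalfPlane.coe_im, hτ]
        ring
    have h6 : ‖2 * I * cexp (2 * Real.pi * I * (1 / 8) * τ)‖ ≤
        Real.exp (-(2 * Real.pi * (1 / 4) * (y - 1))) * (C + D * E) := by
      have e : 2 * I * cexp (2 * Real.pi * I * (1 / 8) * τ) =
          -(2 * I * S 0 τ - 2 * I * cexp (2 * Real.pi * I * (1 / 8) * τ)) -
            fTheta 0 τ * eichlerIntegral (1 / 2) gTheta τ := by
        linear_combination h4
      rw [e]
      refine (norm_sub_le _ _).trans ?_
      rw [norm_neg, mul_add, norm_mul, ← mul_assoc]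
      rw [hτ] at h1 h2
      exact add_le_add h1 (mul_le_mul h2 h3 (norm_nonneg _) ((norm_nonneg _).trans h2))
    have e : Real.exp (-(2 * Real.pi * (1 / 4) * (y - 1))) =
        Real.exp (-(2 * Real.pi * (1 / 8) * (y - 1))) *
          Real.exp (-(2 * Real.pi * (1 / 8) * (y - 1))) := by
      rw [← Real.exp_add]; congr 1; ring
    rw [h5, e, mul_assoc, mul_comm] at h6
    refine le_of_mul_le_mul_left ?_ (Real.exp_pos (-(2 * Real.pi * (1 / 8) * (y - 1))))
    linarith
  have hlim := tendsto_exp_neg_mul_sub_one (ε := 1 / 8) (by norm_num) (C + D * E)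
  have := ge_of_tendsto hlim (Filter.eventually_atTop.mpr ⟨1, key⟩)
  have := Real.exp_pos (-(Real.pi / 4))
  linarith

/-! ### The representation -/

lemma completion_S_smul (l : ℤ) (τ : ℍ) : completion l (ModularGroup.S • τ) =
    τ * (-I / Real.sqrt 2 * (completion 0 τ + (-1) ^ l * completion 1 τ)) := by
  have h := vartheta_inversion l (ModularGroup.S • τ)
  rw [S_smul_S_smul, coe_S_smul] at h
  have h0 : (τ : ℂ) ≠ 0 := τ.ne_zero
  have h3 := ofReal_sqrt_two_ne_zero
  rw [completion, completion, completion, h]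
  field_simp

lemma completion_T_smul (l : ℤ) (τ : ℍ) : completion l (ModularGroup.T • τ) =
    cexp (2 * Real.pi * I * (1 / 8 - l / 2 + l ^ 2 / 4)) * completion l τ := by
  have him : (ModularGroup.T • τ : ℍ).im = τ.im := by
    have := congrArg Complex.im (coe_T_smul τ)
    simpa [-ModularGroup.sl_moeb] using this
  rw [completion, completion, mul_div_assoc', vartheta_eq_tsum, vartheta_eq_tsum, ← tsum_mul_left]
  congr 1
  refine tsum_congr fun p => ?_
  have hr : rho A₀ c₁ c₂ (pt l p) (ModularGroup.T • τ) = rho A₀ c₁ c₂ (pt l p) τ := by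
    rw [rho, rho, him]
  rw [hr, mul_left_comm, qTerm_eq, qTerm_eq, coe_T_smul, ← Complex.exp_add]
  congr 1
  obtain ⟨k, hk⟩ := Int.even_mul_succ_self p.1
  have hk : (p.1 : ℂ) * (p.1 + 1) = k + k := by exact_mod_cast hk
  -- On the coset `Q` is constant modulo `1`; this integer is `Q(ν) - (1/8 - l/2 + l²/4)`, where
  -- `m(m + 1) = 2k` for the first index `m`.
  refine cexp_eq_cexp_of_sub_int (k + 2 * p.1 * p.2 - p.1 * l + p.2 + p.2 ^ 2 - p.2 * l) ?_
  simp only [pt, Matrix.cons_val_zero, Matrix.cons_val_one]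
  push_cast
  linear_combination (Real.pi * I) * hk

/-- The vector of completions. -/
def completionVec (τ : ℍ) : Fin 2 → ℂ := fun i => completion (i : ℕ) τ

/-- The matrix of `S` in the representation. -/
def repS : Matrix (Fin 2) (Fin 2) ℂ := (-I / (Real.sqrt 2 : ℂ)) • !![1, 1; 1, -1]

/-- The matrix of `T` in the representation. -/
def repT : Matrix (Fin 2) (Fin 2) ℂ :=
  !![cexp (Real.pi * I / 4), 0; 0, cexp (-(Real.pi * I / 4))]

lemma vecTransforms_completionVec_S : VecTransforms 1 completionVec ModularGroup.S repS := by
  intro τ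
  have k0 := completion_S_smul 0 τ
  have k1 := completion_S_smul 1 τ
  rw [_root_.zpow_zero, one_mul] at k0
  rw [_root_.zpow_one] at k1
  rw [autFactor_S, ofReal_one, cpow_one, repS, smul_mulVec]
  ext i
  fin_cases i
  · simpa [completionVec, vecHead, vecTail, -ModularGroup.sl_moeb] using k0
  · simpa [completionVec, vecHead, vecTail, -ModularGroup.sl_moeb] using k1

lemma vecTransforms_completionVec_T : VecTransforms 1 completionVec ModularGroup.T repT := by
  intro τ
  have k0 := completion_T_smul 0 τ
  have k1 := completion_T_smul 1 τ
  have e0 : 2 * Real.pi * I * (1 / 8 - (0 : ℤ) / 2 + (0 : ℤ) ^ 2 / 4) = Real.pi * I / 4 := by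
    push_cast; ring
  have e1 : 2 * Real.pi * I * (1 / 8 - (1 : ℤ) / 2 + (1 : ℤ) ^ 2 / 4) = -(Real.pi * I / 4) := by
    push_cast; ring
  rw [e0] at k0
  rw [e1] at k1
  rw [autFactor_T, one_cpow, one_smul, repT]
  ext i
  fin_cases i
  · simpa [completionVec, vecHead, vecTail, -ModularGroup.sl_moeb] using k0
  · simpa [completionVec, vecHead, vecTail, -ModularGroup.sl_moeb] using k1

lemma repS_mul_self : repS * repS = -1 := by
  have h2 := ofReal_sqrt_two_sq
  have h3 := ofReal_sqrt_two_ne_zero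
  have e : (!![1, 1; 1, -1] : Matrix (Fin 2) (Fin 2) ℂ) * !![1, 1; 1, -1] = (2 : ℂ) • 1 := by
    ext i j; fin_cases i <;> fin_cases j <;> norm_num [Matrix.mul_apply, Fin.sum_univ_two]
  have e2 : -I / (Real.sqrt 2 : ℂ) * (-I / Real.sqrt 2) * 2 = -1 := by
    field_simp
    rw [I_sq, h2]
    ring
  rw [repS, smul_mul_smul_comm, e, smul_smul, e2, neg_one_smul]

lemma repT_eq_diagonal : repT =
    Matrix.diagonal ![cexp (Real.pi * I / 4), cexp (-(Real.pi * I / 4))] := by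
  ext i j; fin_cases i <;> fin_cases j <;> simp [repT]

lemma cexp_pi_div_four_pow_four : cexp (Real.pi * I / 4) ^ 4 = -1 := by
  rw [← Complex.exp_nat_mul, ← exp_pi_mul_I]; congr 1; push_cast; ring

lemma repT_pow_four : repT ^ 4 = -1 := by
  have e0 := cexp_pi_div_four_pow_four
  have e1 : cexp (-(Real.pi * I / 4)) ^ 4 = -1 := by
    rw [Complex.exp_neg, inv_pow, e0]; norm_num
  rw [repT_eq_diagonal, Matrix.diagonal_pow]
  ext i j; fin_cases i <;> fin_cases j <;> simp [e0, e1]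

lemma exists_vecTransforms_completionVec (γ : SL(2, ℤ)) :
    ∃ M, VecTransforms 1 completionVec γ M := by
  refine exists_vecTransforms (NS := -repS) (NT := -repT ^ 3) vecTransforms_completionVec_S ?_
    vecTransforms_completionVec_T ?_ γ
  · rw [neg_mul, repS_mul_self, neg_neg]
  · rw [neg_mul, ← pow_succ, repT_pow_four, neg_neg]

lemma cexp_pi_div_four_ne : cexp (Real.pi * I / 4) ≠ cexp (-(Real.pi * I / 4)) := by
  intro h
  have h : cexp (Real.pi * I / 4) ^ 2 = 1 := by
    rw [sq]
    nth_rw 2 [h]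
    rw [← Complex.exp_add, add_neg_cancel, Complex.exp_zero]
  have h4 := cexp_pi_div_four_pow_four
  rw [show 4 = 2 * 2 from rfl, pow_mul, h] at h4
  norm_num at h4

/-- The distinct eigenvalues under `T` separate the two terms of a relation. The first completion is
nonzero, and vanishing of the second would force that of the first through `S`. -/
lemma completionVec_linearIndependent {a b : ℂ}
    (h : ∀ τ, a * completion 0 τ + b * completion 1 τ = 0) : a = 0 ∧ b = 0 := by
  have hω := sub_ne_zero.mpr cexp_pi_div_four_ne
  have hT : ∀ τ, completion 0 (ModularGroup.T • τ) = cexp (Real.pi * I / 4) * completion 0 τ ∧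
      completion 1 (ModularGroup.T • τ) = cexp (-(Real.pi * I / 4)) * completion 1 τ := fun τ => by
    rw [completion_T_smul, completion_T_smul]
    constructor <;> congr 2 <;> push_cast <;> ring
  have h0 : ∀ τ, a * completion 0 τ = 0 ∧ b * completion 1 τ = 0 := by
    intro τ
    have h1 := h τ
    have h2 := h (ModularGroup.T • τ)
    rw [(hT τ).1, (hT τ).2] at h2
    constructor
    · refine (mul_eq_zero.mp ?_).resolve_left hω
      linear_combination h2 - cexp (-(Real.pi * I / 4)) * h1
    · refine (mul_eq_zero.mp ?_).resolve_left hω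
      linear_combination cexp (Real.pi * I / 4) * h1 - h2
  obtain ⟨τ, hτ⟩ := exists_completion_zero_ne_zero
  refine ⟨(mul_eq_zero.mp (h0 τ).1).resolve_right hτ, ?_⟩
  by_contra hb
  have h1 : ∀ τ, completion 1 τ = 0 := fun τ => (mul_eq_zero.mp (h0 τ).2).resolve_left hb
  have h2 := completion_S_smul 1 τ
  rw [h1, h1, mul_zero, add_zero] at h2
  have h3 := ofReal_sqrt_two_ne_zero
  have h4 : (τ : ℂ) ≠ 0 := τ.ne_zero
  exact mul_ne_zero h4 (mul_ne_zero (div_ne_zero (neg_ne_zero.mpr I_ne_zero) h3) hτ) h2.symm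

lemma eq_of_mulVec_completionVec {M N : Matrix (Fin 2) (Fin 2) ℂ}
    (h : ∀ τ, M *ᵥ completionVec τ = N *ᵥ completionVec τ) : M = N := by
  have key : ∀ i, M i 0 - N i 0 = 0 ∧ M i 1 - N i 1 = 0 := fun i =>
    completionVec_linearIndependent fun τ => by
      have := congrFun (h τ) i
      simp only [Matrix.mulVec, dotProduct, Fin.sum_univ_two, completionVec, Fin.val_zero,
        Fin.val_one, Nat.cast_zero, Nat.cast_one] at this
      linear_combination this
  ext i j
  fin_cases j
  · exact sub_eq_zero.mp (key i).1
  · exact sub_eq_zero.mp (key i).2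

lemma VecTransforms.eq {γ : SL(2, ℤ)} {M N : Matrix (Fin 2) (Fin 2) ℂ}
    (hM : VecTransforms 1 completionVec γ M) (hN : VecTransforms 1 completionVec γ N) : M = N := by
  refine eq_of_mulVec_completionVec fun τ => ?_
  have h := (hM τ).symm.trans (hN τ)
  rw [ofReal_one, cpow_one] at h
  exact smul_right_injective _ (autFactor_ne_zero γ τ) h

/-- The representation of `SL₂(ℤ)` on the span of the completions. -/
def rep : SL(2, ℤ) →* Matrix (Fin 2) (Fin 2) ℂ where
  toFun γ := (exists_vecTransforms_completionVec γ).choose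
  map_one' := (exists_vecTransforms_completionVec 1).choose_spec.eq fun τ => by simp
  -- In weight one the factor `cτ + d` is an exact cocycle, so the product of matrices also
  -- transforms the vector, and uniqueness identifies it with the chosen matrix.
  map_mul' γ₁ γ₂ := (exists_vecTransforms_completionVec (γ₁ * γ₂)).choose_spec.eq fun τ => by
    rw [mul_smul, (exists_vecTransforms_completionVec γ₁).choose_spec,
      (exists_vecTransforms_completionVec γ₂).choose_spec, Matrix.mulVec_smul,
      Matrix.mulVec_mulVec, smul_smul, ofReal_one, cpow_one, cpow_one, cpow_one, autFactor_mul]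

lemma vecTransforms_rep (γ : SL(2, ℤ)) : VecTransforms 1 completionVec γ (rep γ) :=
  (exists_vecTransforms_completionVec γ).choose_spec

lemma rep_S : rep ModularGroup.S = repS :=
  (vecTransforms_rep _).eq vecTransforms_completionVec_S

lemma rep_T : rep ModularGroup.T = repT :=
  (vecTransforms_rep _).eq vecTransforms_completionVec_T

lemma completion_smul (γ : SL(2, ℤ)) (τ : ℍ) (i : Fin 2) : completion (i : ℕ) (γ • τ) =
    autFactor γ τ * ∑ j : Fin 2, rep γ i j * completion (j : ℕ) τ := by
  have := congrFun (vecTransforms_rep γ τ) i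
  rwa [ofReal_one, cpow_one] at this

lemma isBoundedAtImInfty_slash_completion (γ : SL(2, ℤ)) (i : Fin 2) :
    UpperHalfPlane.IsBoundedAtImInfty
      fun τ => autFactor γ τ ^ (-1 : ℤ) * completion (i : ℕ) (γ • τ) := by
  have e : (fun τ => autFactor γ τ ^ (-1 : ℤ) * completion (i : ℕ) (γ • τ)) =
      fun τ => rep γ i 0 * completion 0 τ + rep γ i 1 * completion 1 τ := by
    funext τ
    rw [completion_smul, _root_.zpow_neg_one, inv_mul_cancel_left₀ (autFactor_ne_zero γ τ),
      Fin.sum_univ_two]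
    simp
  obtain ⟨B, A, h⟩ := UpperHalfPlane.isBoundedAtImInfty_iff.mp (isBoundedAtImInfty_completion 0)
  obtain ⟨B', A', h'⟩ := UpperHalfPlane.isBoundedAtImInfty_iff.mp (isBoundedAtImInfty_completion 1)
  rw [e, UpperHalfPlane.isBoundedAtImInfty_iff]
  refine ⟨‖rep γ i 0‖ * B + ‖rep γ i 1‖ * B', max A A', fun τ hτ => (norm_add_le _ _).trans ?_⟩
  rw [norm_mul, norm_mul]
  gcongr
  · exact h τ ((le_max_left _ _).trans hτ)
  · exact h' τ ((le_max_right _ _).trans hτ)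

/-! ### The characters on `Γ₀(4)` -/

/-- The elements of `SL₂(ℤ)` acting by diagonal unitary matrices. -/
def diagSubgroup : Subgroup SL(2, ℤ) where
  carrier := {γ | ∃ d : Fin 2 → ℂ, (∀ i, ‖d i‖ = 1) ∧ rep γ = Matrix.diagonal d}
  one_mem' := ⟨1, fun _ => by simp, by simp⟩
  mul_mem' := by
    rintro γ₁ γ₂ ⟨d₁, h₁, e₁⟩ ⟨d₂, h₂, e₂⟩
    exact ⟨fun i => d₁ i * d₂ i, fun i => by rw [norm_mul, h₁, h₂, one_mul], by
      rw [map_mul, e₁, e₂, Matrix.diagonal_mul_diagonal]⟩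
  inv_mem' := by
    rintro γ ⟨d, h, e⟩
    have h0 : ∀ i, d i ≠ 0 := fun i h0 => by simpa [h0] using h i
    refine ⟨fun i => (d i)⁻¹, fun i => by rw [norm_inv, h, inv_one], ?_⟩
    have h1 : rep γ⁻¹ * rep γ = 1 := by rw [← map_mul, inv_mul_cancel, map_one]
    have h2 : rep γ * Matrix.diagonal (fun i => (d i)⁻¹) = 1 := by
      rw [e, Matrix.diagonal_mul_diagonal]
      simp [h0]
    exact left_inv_eq_right_inv h1 h2

/-- `T` is diagonal, `-1 = S²` acts by `-1`, and `S T⁴ S⁻¹` acts by `-1` because `T⁴` already does.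
-/
lemma Gamma0_four_le_diagSubgroup : CongruenceSubgroup.Gamma0 4 ≤ diagSubgroup := by
  have hneg : (-1 : Matrix (Fin 2) (Fin 2) ℂ) = Matrix.diagonal fun _ => -1 := by
    rw [← Matrix.diagonal_one, ← Matrix.diagonal_neg]
  refine fun γ hγ => mem_of_mem_Gamma0_four ?_ ?_ ?_ hγ
  · refine ⟨_, fun i => ?_, rep_T.trans repT_eq_diagonal⟩
    have e0 : ‖cexp (Real.pi * I / 4)‖ = 1 := by
      have := Complex.norm_exp_ofReal_mul_I (Real.pi / 4)
      rwa [show ((Real.pi / 4 : ℝ) : ℂ) * I = Real.pi * I / 4 by push_cast; ring] at this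
    fin_cases i
    · exact e0
    · simp [Complex.exp_neg, e0]
  · refine ⟨fun _ => -1, fun _ => by simp, ?_⟩
    have e : (-1 : SL(2, ℤ)) = ModularGroup.S * ModularGroup.S := by decide
    rw [e, map_mul, rep_S, repS_mul_self, hneg]
  · refine ⟨fun _ => -1, fun _ => by simp, ?_⟩
    have e : ModularGroup.T ^ (4 : ℤ) = ModularGroup.T ^ 4 := by norm_cast
    have h1 : rep ModularGroup.S * rep ModularGroup.S⁻¹ = 1 := by
      rw [← map_mul, mul_inv_cancel, map_one]
    rw [map_mul, map_mul, e, map_pow, rep_T, repT_pow_four, ← hneg, mul_neg, mul_one, neg_mul, h1]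

/-- The diagonal entries of the representation on `Γ₀(4)`. -/
def repChar (i : Fin 2) : CongruenceSubgroup.Gamma0 4 →* ℂ where
  toFun γ := rep γ i i
  map_one' := by simp
  map_mul' γ₁ γ₂ := by
    obtain ⟨d₁, h₁, e₁⟩ := Gamma0_four_le_diagSubgroup γ₁.2
    obtain ⟨d₂, h₂, e₂⟩ := Gamma0_four_le_diagSubgroup γ₂.2
    rw [Subgroup.coe_mul, map_mul, e₁, e₂, Matrix.diagonal_mul_diagonal]
    simp

theorem isMockModularForm_S (i : Fin 2) : IsMockModularForm (CongruenceSubgroup.Gamma0 4) 1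
    (repChar i) (S (i : ℕ)) (completion (i : ℕ)) := by
  refine ⟨fun γ => ?_, isHolomorphicPart_S i, fun γ τ => ?_,
    fun γ => isBoundedAtImInfty_slash_completion γ i⟩
  · obtain ⟨d, h, e⟩ := Gamma0_four_le_diagSubgroup γ.2
    change ‖rep γ i i‖ = 1
    rw [e, Matrix.diagonal_apply_eq, h]
  · obtain ⟨d, h, e⟩ := Gamma0_four_le_diagSubgroup γ.2
    change _ = rep γ i i * _ * _
    rw [completion_smul, e, Matrix.diagonal_apply_eq, _root_.zpow_one]
    simp [Matrix.diagonal_apply]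
    ring

theorem isVectorMockModularForm_S : IsVectorMockModularForm 1 rep
    (fun i : Fin 2 => S (i : ℕ)) fun i : Fin 2 => completion (i : ℕ) := by
  refine ⟨⟨CongruenceSubgroup.Gamma0 4, inferInstance, isHolomorphicPart_S⟩, fun γ τ i => ?_,
    fun i => isBoundedAtImInfty_completion _⟩
  rw [_root_.zpow_one]
  exact completion_smul γ τ i

end MockTheta

end

theorem proposition1p2 :
    -- `S₀`, `S₁` are the theta-decomposition coefficients of `θ₁² μ`
    (∀ (τ : ℍ) (z : ℂ), (∀ m n : ℤ, z ≠ m * (τ : ℂ) + n) →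
      theta1 z τ ^ 2 * mu z τ
        = S 0 τ * theta3 (2 * z) (2 * τ) + S 1 τ * theta2 (2 * z) (2 * τ)) ∧
    -- the data of the indefinite theta functions are admissible
    (A₀.IsSymm ∧ A₀.det < 0 ∧ quad A₀ c₁ < 0 ∧ quad A₀ c₂ < 0 ∧ bilin A₀ c₁ c₂ < 0) ∧
    -- `ϑ^ℓ` converges absolutely, and `2i S_ℓ` is its holomorphic part
    (∀ (l : ℤ) (τ : ℍ),
      Summable (fun n : Fin 2 → ℤ =>
        (rho A₀ c₁ c₂ (shift (a₀ l) n) τ : ℂ) * qTerm A₀ b₀ (shift (a₀ l) n) τ) ∧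
      HasSum (fun n : Fin 2 → ℤ =>
        ((Real.sign (bilin A₀ (shift (a₀ l) n) c₁) - Real.sign (bilin A₀ (shift (a₀ l) n) c₂) : ℝ)
          : ℂ) * qTerm A₀ b₀ (shift (a₀ l) n) τ) (2 * Complex.I * S l τ) ∧
      Summable (fun n : Fin 2 → ℤ =>
        (betaTerm A₀ c₁ (shift (a₀ l) n) τ : ℂ) * qTerm A₀ b₀ (shift (a₀ l) n) τ) ∧
      Summable (fun n : Fin 2 → ℤ =>
        (betaTerm A₀ c₂ (shift (a₀ l) n) τ : ℂ) * qTerm A₀ b₀ (shift (a₀ l) n) τ) ∧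
      vartheta l τ = 2 * Complex.I * S l τ
        - (∑' n : Fin 2 → ℤ,
            (betaTerm A₀ c₁ (shift (a₀ l) n) τ : ℂ) * qTerm A₀ b₀ (shift (a₀ l) n) τ)
        + ∑' n : Fin 2 → ℤ,
            (betaTerm A₀ c₂ (shift (a₀ l) n) τ : ℂ) * qTerm A₀ b₀ (shift (a₀ l) n) τ) ∧
    -- each `S_ℓ` is a mock modular form of weight one on `Γ₀(4)`, completed by `ϑ^ℓ / 2i`
    (∀ l : Fin 2, ∃ χ : CongruenceSubgroup.Gamma0 4 →* ℂ,
      IsMockModularForm (CongruenceSubgroup.Gamma0 4) 1 χ (S (l : ℕ))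
        (fun τ => vartheta (l : ℕ) τ / (2 * Complex.I))) ∧
    -- `(S₀, S₁)` is a vector-valued mock modular form of weight one on `SL₂(ℤ)`
    (∃ R : SL(2, ℤ) →* Matrix (Fin 2) (Fin 2) ℂ,
      R ModularGroup.T = !![Complex.exp (Real.pi * Complex.I / 4), 0;
        0, Complex.exp (-(Real.pi * Complex.I / 4))] ∧
      R ModularGroup.S = (-Complex.I / (Real.sqrt 2 : ℂ)) • !![1, 1; 1, -1] ∧
      IsVectorMockModularForm 1 R (fun l : Fin 2 => S (l : ℕ))
        (fun l : Fin 2 => fun τ => vartheta (l : ℕ) τ / (2 * Complex.I))) := by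
  refine ⟨theta_decomposition, ⟨?_, ?_, ?_, ?_, ?_⟩, fun l τ => ?_,
    fun l => ⟨repChar l, isMockModularForm_S l⟩, rep, rep_T, rep_S, isVectorMockModularForm_S⟩
  · ext i j; fin_cases i <;> fin_cases j <;> simp [A₀]
  · simp only [A₀, Matrix.det_fin_two_of]; norm_num
  · rw [quad_c₁]; norm_num
  · rw [quad_c₂]; norm_num
  · rw [bilin_c₂]; norm_num [c₁]
  · have e : ∀ f : ℤ × ℤ → ℂ, ∑' p, f p = ∑' n, f (finTwoArrowEquiv ℤ n) :=
      fun f => ((finTwoArrowEquiv ℤ).tsum_eq f).symm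
    have hρ := (finTwoArrowEquiv ℤ).summable_iff.mpr (hasSum_rho l τ).summable
    have hsgn := (finTwoArrowEquiv ℤ).hasSum_iff.mpr (hasSum_sgnTerm l τ)
    have h₁ := (finTwoArrowEquiv ℤ).summable_iff.mpr (summable_betaTerm_c₁ l τ)
    have h₂ := (finTwoArrowEquiv ℤ).summable_iff.mpr (summable_betaTerm_c₂ l τ)
    have hθ := vartheta_eq_sub_add l τ
    rw [e fun p => (betaTerm A₀ c₁ (pt l p) τ : ℂ) * qTerm A₀ b₀ (pt l p) τ,
      e fun p => (betaTerm A₀ c₂ (pt l p) τ : ℂ) * qTerm A₀ b₀ (pt l p) τ] at hθ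
    simp only [Function.comp_def, sgnCoeff, ← shift_a₀] at hρ hsgn h₁ h₂ hθ
    exact ⟨hρ, hsgn, h₁, h₂, hθ⟩
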